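/- **Setting.** Equip $[0,1]$ with Lebesgue measure. A graphon is a measurable symmetric $W:[0,1]^2\to[0,1]$, with $(T_WX)(v)=\int_0^1W(u,v)X(u)\,du$; the same formula defines $T_K$ for any bounded measurable kernel $K$. A graphon filter is $T_{B,W}=\sum_{k=0}^{K-1}b_kT_W^k$, with spectral response $b(\lambda)=\sum_k b_k\lambda^k$. A graphon neural network (WNN) $T_{\mathcal B,W}$ composes $L\ge 1$ layers $X_\ell^f=\rho_\ell\big(\sum_g T_{B_\ell^{fg},W}X_{\ell-1}^g\big)$, with $F$ features in each hidden layer. A graphon recurrent network (WRNN) $\Psi$ with $T$ rounds, $p$ input, $h$ hidden-state and $q$ output features maps $X$ to $Y$ by $Z_0=0$, $Z_t=\rho_1(T_{\mathcal B_1,W}X+T_{\mathcal B_2,W}Z_{t-1})$ $(1\le t\le T)$, $Y=\rho_2(T_{\mathcal B_3,W}Z_T)$. Given $\epsilon\in(0,1]$ and $\Omega_i,\omega_i\ge 0$ $(i=1,2,3)$, call $\Psi$ *admissible* if each filter of $T_{\mathcal B_i,W}$ has a response $b$ that is $\Omega_i$-Lipschitz on $[-1,-\epsilon]\cup[\epsilon,1]$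 and $\omega_i$-Lipschitz on $(-\epsilon,\epsilon)$, with $\omega_i<\Omega_i$ and $|b|<1$ on $[-1,1]$, and if each activation $\rho$ satisfies $|\rho(x)-\rho(y)|\le|x-y|$ and $\rho(0)=0$. Fix $\Delta\in\mathbb R^{q\times q}$. Let $J_1,\dots,J_q$ be the partition of $[0,1]$ into consecutive intervals of length $1/q$ and $W_\Delta(x,y)=\sum_{i,j}\Delta_{ij}1_{x\in J_i}1_{y\in J_j}$. For $q$-feature signals $Y_1,Y_2$ identify the feature vector $Y_j(u)\in\mathbb R^q$ at $u$ with the step function on $[0,1]$ equal to $Y_j^f(u)$ on $J_f$, and put $$\mathcal X(u,v)=\langle Y_1(u),T_{W_\Delta}Y_2(v)\rangle_{L^2([0,1])},\qquad A(u,v)=\frac{e^{\mathcal X(u,v)}}{\int_0^1\!\int_0^1e^{\mathcal X(u',v')}\,du'\,dv'} .$$ The stochastic graph on $n$ nodes has independent uniform labels $u_i\in[0,1]$ and a symmetric adjacency matrix $\Xi_n$ whose entries with $i\le j$ are, given the labels, independent with $[\Xi_n]_{ij}\sim\mathrm{Bernoulli}(W(u_i,u_j))$. Let $I_i$ run from $u_i$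 to the next label to the right (cyclically in $[0,1]$), and let $W_{\Xi_n}=\sum_{i,j}[\Xi_n]_{ij}1_{I_i\times I_j}$ and $X_n=\sum_iX(u_i)1_{I_i}$ be the induced graphon and signal. **Theorem.** Let $W$ be a graphon, $\Delta\in\mathbb R^{q\times q}$, and let $X_1,X_2$ be $p$-feature graphon signals such that $\int_0^1e^{c\,X_j^g(u)^2}du<\infty$ for all $c>0$, $j\in\{1,2\}$ and $g\le p$ (for example, bounded signals). There is a constant $\Gamma>0$, independent of the WRNN, such that for all $L,F,h,T,\Omega_i,\omega_i$ and every $\eta>0$ there is $\epsilon_0\in(0,1]$ such that for every $\delta>0$ there is $N$ with the following property. For all $0<\epsilon\le\epsilon_0$ and $n\ge N$, with probability at least $1-\delta$ over the sampled graph, every admissible WRNN $\Psi$ satisfies $$\|A-A_n\|_{L^2([0,1]^2)}\le\Gamma\,\eta ,$$ where $A$ is built as above from the outputs $Y_1,Y_2$ of $\Psi$ on $(W,X_1),(W,X_2)$, and $A_n$ from the outputs on $(W_{\Xi_n},X_{n,1}),(W_{\Xi_n},X_{n,2})$; in particular both softmax distributions are well defined ($e^{\mathcal X}$ and $e^{\mathcal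 X_n}$ are integrable). -/

import Mathlib

open MeasureTheory unitInterval
open scoped NNReal ENNReal Polynomial

/-! Everything lives on `I = [0, 1]` with Lebesgue (probability) measure `volume`. -/

noncomputable section

/-- A graphon: a measurable symmetric function `[0, 1]² → [0, 1]`. -/
structure Graphon where
  toFun : I → I → ℝ
  measurable' : Measurable (Function.uncurry toFun)
  symm' : ∀ u v, toFun u v = toFun v u
  mem_Icc' : ∀ u v, toFun u v ∈ Set.Icc (0 : ℝ) 1

/-- The diffusion operator `(T_W X)(v) = ∫₀¹ W(u, v) X(u) du` of a kernel `W`. -/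
def diffusion (W : I → I → ℝ) (X : I → ℝ) : I → ℝ :=
  fun v => ∫ u, W u v * X u

/-- The graphon filter `T_{B,W} X = ∑ₖ bₖ T_W^{(k)} X`. The taps `b₀, …, b_{K-1}` are recorded as
the polynomial `b(λ) = ∑ₖ bₖ λᵏ`, which is the spectral response of the filter. -/
def graphonFilter (b : ℝ[X]) (W : I → I → ℝ) (X : I → ℝ) : I → ℝ :=
  fun v => b.sum fun k c => c * ((diffusion W)^[k] X) v

/-! ### Graphon neural networks -/

/-- Parameters of a graphon neural network with `L ≥ 1` layers, `p` input features, `q` output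
features and `F` features in every hidden layer. Each layer carries its pointwise nonlinearity
`ρ` and a matrix `B` of filters, `B f g` leading from input feature `g` to output feature `f`. -/
inductive WNN (F : ℕ) : ℕ → ℕ → ℕ → Type
  | last {p q : ℕ} (ρ : ℝ → ℝ) (B : Fin q → Fin p → ℝ[X]) : WNN F 1 p q
  | layer {L p q : ℕ} (ρ : ℝ → ℝ) (B : Fin F → Fin p → ℝ[X]) (rest : WNN F L F q) :
      WNN F (L + 1) p q

/-- One layer: `X^f ↦ ρ (∑_g T_{B^{fg}, W} X^g)`. -/
def layerMap {p q : ℕ} (ρ : ℝ → ℝ) (B : Fin q → Fin p → ℝ[X]) (W : I → I → ℝ)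
    (X : Fin p → I → ℝ) : Fin q → I → ℝ :=
  fun f v => ρ (∑ g, graphonFilter (B f g) W (X g) v)

/-- The map `X ↦ T_{ℬ,W} X` of a graphon neural network. -/
def WNN.eval {F : ℕ} (W : I → I → ℝ) :
    {L p q : ℕ} → WNN F L p q → (Fin p → I → ℝ) → (Fin q → I → ℝ)
  | _, _, _, .last ρ B, X => layerMap ρ B W X
  | _, _, _, .layer ρ B rest, X => rest.eval W (layerMap ρ B W X)

/-- All convolutional filters of the network satisfy `P`. -/
def WNN.AllFilters {F : ℕ} (P : ℝ[X] → Prop) : {L p q : ℕ} → WNN F L p q → Prop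
  | _, _, _, .last _ B => ∀ f g, P (B f g)
  | _, _, _, .layer _ B rest => (∀ f g, P (B f g)) ∧ rest.AllFilters P

/-- All nonlinearities of the network satisfy `P`. -/
def WNN.AllActivations {F : ℕ} (P : (ℝ → ℝ) → Prop) : {L p q : ℕ} → WNN F L p q → Prop
  | _, _, _, .last ρ _ => P ρ
  | _, _, _, .layer ρ _ rest => P ρ ∧ rest.AllActivations P

/-- The filter assumption: the spectral response `b` is `Ω`-Lipschitz on `[-1, -ε] ∪ [ε, 1]`,
`ω`-Lipschitz on `(-ε, ε)` with `ω < Ω`, and `|b| < 1` on `[-1, 1]`. -/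
def FilterLipschitz (Ω ω : ℝ≥0) (ε : ℝ) (b : ℝ[X]) : Prop :=
  LipschitzOnWith Ω (fun x => b.eval x) (Set.Icc (-1) (-ε) ∪ Set.Icc ε 1) ∧
  LipschitzOnWith ω (fun x => b.eval x) (Set.Ioo (-ε) ε) ∧
  ω < Ω ∧ ∀ x ∈ Set.Icc (-1 : ℝ) 1, |b.eval x| < 1

/-- The activation assumption: normalized Lipschitz. -/
def NormalizedLipschitz (ρ : ℝ → ℝ) : Prop :=
  (∀ x y, |ρ x - ρ y| ≤ |x - y|) ∧ ρ 0 = 0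

/-! ### Graphon recurrent neural networks -/

/-- Parameters of a graphon recurrent neural network: `p` input features, `h` hidden-state
features, `q` output features, built from three graphon neural networks of depth `L`, width `F`. -/
structure WRNN (L F p h q : ℕ) where
  /-- input network -/
  B₁ : WNN F L p h
  /-- recurrent network -/
  B₂ : WNN F L h h
  /-- output network -/
  B₃ : WNN F L h q
  ρ₁ : ℝ → ℝ
  ρ₂ : ℝ → ℝ

variable {L F p h q : ℕ}

/-- The hidden states: `Z₀ = 0` and `Z_t = ρ₁ (T_{ℬ₁,W} X + T_{ℬ₂,W} Z_{t-1})`;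
the same input `X` is used in every round. -/
def WRNN.hidden (Ψ : WRNN L F p h q) (W : I → I → ℝ) (X : Fin p → I → ℝ) :
    ℕ → Fin h → I → ℝ
  | 0 => fun _ _ => 0
  | t + 1 => fun f v => Ψ.ρ₁ (Ψ.B₁.eval W X f v + Ψ.B₂.eval W (Ψ.hidden W X t) f v)

/-- The output `Y = ρ₂ (T_{ℬ₃,W} Z_T)` after `T` rounds. -/
def WRNN.output (Ψ : WRNN L F p h q) (T : ℕ) (W : I → I → ℝ) (X : Fin p → I → ℝ) :
    Fin q → I → ℝ :=
  fun f v => Ψ.ρ₂ (Ψ.B₃.eval W (Ψ.hidden W X T) f v)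

/-- The standing assumptions on the network: the filters of the `i`-th constituent network satisfy
the filter assumption with constants `Ω i, ω i`, and all nonlinearities are normalized Lipschitz. -/
structure WRNN.Admissible (Ψ : WRNN L F p h q) (Ω ω : Fin 3 → ℝ≥0) (ε : ℝ) : Prop where
  filters₁ : Ψ.B₁.AllFilters (FilterLipschitz (Ω 0) (ω 0) ε)
  filters₂ : Ψ.B₂.AllFilters (FilterLipschitz (Ω 1) (ω 1) ε)
  filters₃ : Ψ.B₃.AllFilters (FilterLipschitz (Ω 2) (ω 2) ε)
  act₁ : Ψ.B₁.AllActivations NormalizedLipschitz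
  act₂ : Ψ.B₂.AllActivations NormalizedLipschitz
  act₃ : Ψ.B₃.AllActivations NormalizedLipschitz
  rho₁ : NormalizedLipschitz Ψ.ρ₁
  rho₂ : NormalizedLipschitz Ψ.ρ₂

/-! ### Graphons and graphon signals induced by labelled matrices and vectors -/

/-- The cell of the `i`-th label: the points `v` whose closest label to the left, going cyclically
around `[0, 1]`, is `u i`. If `u 0 < u 1 < ⋯ < u (n-1)` this is `[u i, u (i+1))` for `i < n - 1`
and `[u (n-1), 1] ∪ [0, u 0)` for `i = n - 1`; the labels need not be sorted, and among equal
labels the one of largest index gets the cell. -/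
def cell {n : ℕ} (u : Fin n → I) (i : Fin n) : Set I :=
  {v | (u i ≤ v ∧ ∀ j, u j ≤ v → toLex (u j, j) ≤ toLex (u i, i)) ∨
       ((∀ j, v < u j) ∧ ∀ j, toLex (u j, j) ≤ toLex (u i, i))}

/-- `∑ᵢⱼ M i j 1_{s ∈ I_i} 1_{t ∈ I_j}`. -/
def inducedKernel {n : ℕ} (u : Fin n → I) (M : Fin n → Fin n → ℝ) : I → I → ℝ :=
  fun s t => ∑ i, ∑ j, M i j * (cell u i).indicator 1 s * (cell u j).indicator 1 t

/-- `∑ᵢ x i 1_{s ∈ I_i}`. -/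
def inducedSignal {n : ℕ} (u : Fin n → I) (x : Fin n → ℝ) : I → ℝ :=
  fun s => ∑ i, x i * (cell u i).indicator 1 s

/-! ### Action distributions -/

/-- The feature labels `0, 1/q, …, (q-1)/q`. -/
def featureLabel (q : ℕ) (i : Fin q) : I :=
  ⟨(i : ℝ) / q, by positivity,
    div_le_one_of_le₀ (by exact_mod_cast i.isLt.le) (by positivity)⟩

/-- `W_Δ`. -/
def featureKernel (Δ : Matrix (Fin q) (Fin q) ℝ) : I → I → ℝ :=
  inducedKernel (featureLabel q) Δ

/-- `χ(Y₁, Y₂) = ⟨Y₁, T_{W_Δ} Y₂⟩` at a pair of node labels `(u, v)`: the inner product in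
`L²([0, 1])` of the feature functions of `Y₁` at `u` and of `T_{W_Δ}` of that of `Y₂` at `v`.
It is the continuous counterpart of the entries of `V Δ Vᵀ`. -/
def actionKernel (Δ : Matrix (Fin q) (Fin q) ℝ) (Y₁ Y₂ : Fin q → I → ℝ) : I × I → ℝ :=
  fun z => ∫ x, inducedSignal (featureLabel q) (fun f => Y₁ f z.1) x *
    diffusion (featureKernel Δ) (inducedSignal (featureLabel q) (fun f => Y₂ f z.2)) x

/-- The continuous softmax `e^{χ} / ∫ e^{χ}` over `[0, 1]²`. -/
def softmax (χ : I × I → ℝ) : I × I → ℝ :=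
  fun z => Real.exp (χ z) / ∫ w, Real.exp (χ w)

/-- `χ` built from the outputs of `Ψ` on the graphon (or kernel) `W` for the inputs `X₁, X₂`. -/
def WRNN.chi (Ψ : WRNN L F p h q) (T : ℕ) (Δ : Matrix (Fin q) (Fin q) ℝ) (W : I → I → ℝ)
    (X₁ X₂ : Fin p → I → ℝ) : I × I → ℝ :=
  actionKernel Δ (Ψ.output T W X₁) (Ψ.output T W X₂)

/-! ### Graphs sampled from a graphon -/

/-- The randomness of a stochastic graph on `n` nodes, with its product Lebesgue measure `volume`:
independent uniform node labels `u i`, and independent uniform variables deciding the edges. -/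
abbrev Sample (n : ℕ) := (Fin n → I) × (Fin n × Fin n → I)

/-- The adjacency matrix: symmetric, and given the labels its entries with `i ≤ j` are independent
with `Ξ i j ∼ Bernoulli (W (u i) (u j))`. -/
def sampledAdj (W : Graphon) {n : ℕ} (s : Sample n) : Fin n → Fin n → ℝ :=
  fun i j => if (s.2 (min i j, max i j) : ℝ) < W.toFun (s.1 i) (s.1 j) then 1 else 0

/-- The graphon `W_{Ξ_n}` induced by the sampled graph. -/
def sampledGraphon (W : Graphon) {n : ℕ} (s : Sample n) : I → I → ℝ :=
  inducedKernel s.1 (sampledAdj W s)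

/-- The graphon signals `X_n` induced by the sampled graph signals `[x_n]_i = X (u i)`. -/
def sampledSignal {n : ℕ} (s : Sample n) (X : Fin p → I → ℝ) : Fin p → I → ℝ :=
  fun g => inducedSignal s.1 (fun i => X g (s.1 i))

end

/-! A deterministic stability statement is combined with a sampling statement; everything random is
confined to finitely many events that do not mention the network.

Stability (`exists_transfer`). On complex `L²` the diffusion of a symmetric kernel bounded by 1 is a
self-adjoint contraction, and a filter is a polynomial in it. Since `ω < Ω`, an admissible response
is bounded by 1 and `Ω`-Lipschitz on all of `[-1, 1]`. A scalar Lipschitz bound alone gives no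
operator Lipschitz bound, and the degrees are unbounded; but by Arzelà–Ascoli this class of
responses has a finite net in the sup norm, each polynomial of the net is Lipschitz in the operator,
and so all filters are uniformly continuous in the operator norm of the kernel
(`exists_norm_realAeval_sub_le`). Induction over layers and rounds then compares the outputs on two
nearby kernels and inputs in `L²`, uniformly over the networks.

The softmax also needs exponential moments. Writing `b(λ) = b(0) + λ b₁(λ)`, the first term does not
enlarge a signal and the second maps `L²` to bounded functions, so outputs are pointwise at most a
constant times an envelope of the input (`abs_graphonFilter_le`). The action kernel is bilinear in
the outputs, and `2xy ≤ x² + y²` reduces its exponential moments to those of the squared inputs.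
`eLpNorm_softmax_sub_le` turns these moments and `L²` closeness of the action kernels into `L²`
closeness of the distributions.

Sampling. The sum of squared cell lengths has mean at most `4 / n`. Hence most points are close to
the label of their cell, and replacing a function by its values at these labels changes it little in
`L²`; this is applied to the graphon, to the signals and to their Gaussian exponentials
(`whp_eLpNorm_cellLabel_sub_le`). The Bernoulli noise is not small in `L²`, only in operator norm:
the fourth power of that norm is at most the squared `L²` norm of the composed kernel, whose mean is
controlled by counting closed walks of length four (`integral_sum_sq_edgeNoise_le`). -/

noncomputable section

/-! ### Functional calculus of self-adjoint contractions, uniform over the responses. -/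

/-- Spectral responses bounded by `1` and `Ω`-Lipschitz on `[-1, 1]`. -/
def IsResponse (Ω : ℝ≥0) (b : ℝ[X]) : Prop :=
  (∀ x ∈ Set.Icc (-1 : ℝ) 1, |b.eval x| ≤ 1) ∧
    LipschitzOnWith Ω (fun x => b.eval x) (Set.Icc (-1) 1)

/-- Evaluation of a real polynomial at an element of a complex algebra. -/
abbrev realAeval {A : Type*} [Ring A] [Algebra ℂ A] (a : A) (b : ℝ[X]) : A :=
  Polynomial.aeval a (b.map (algebraMap ℝ ℂ))

/-- The norm of a function of a normal element is controlled on the spectrum, and a self-adjoint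
contraction has its spectrum in `[-1, 1]`. Complex scalars are there for the C⋆-algebra calculus. -/
theorem norm_realAeval_le {A : Type*} [CStarAlgebra A] {a : A} (ha : IsSelfAdjoint a)
    (h1 : ‖a‖ ≤ 1) (b : ℝ[X]) {c : ℝ} (hc : ∀ x ∈ Set.Icc (-1 : ℝ) 1, |b.eval x| ≤ c) :
    ‖realAeval a b‖ ≤ c := by
  have hc0 : 0 ≤ c := (abs_nonneg _).trans (hc 0 (by simp))
  have hn : IsStarNormal a := ha.isStarNormal
  rw [realAeval, ← cfc_polynomial (b.map (algebraMap ℝ ℂ)) a hn]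
  refine norm_cfc_le hc0 fun x hx => ?_
  have hre := ha.mem_spectrum_eq_re hx
  have hx1 : ‖x‖ ≤ 1 := by
    cases subsingleton_or_nontrivial A with
    | inl h => simp at hx
    | inr h => exact (spectrum.norm_le_norm_of_mem hx).trans h1
  have hxr : |x.re| ≤ 1 := (Complex.abs_re_le_norm x).trans hx1
  rw [hre]
  have : Polynomial.eval (x.re : ℂ) (b.map (algebraMap ℝ ℂ)) = ((b.eval x.re : ℝ) : ℂ) := by
    rw [Polynomial.eval_map_algebraMap]
    exact Polynomial.aeval_algebraMap_apply_eq_algebraMap_eval x.re b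
  rw [this, Complex.norm_real]
  exact hc _ (abs_le.1 hxr)

theorem norm_pow_sub_pow_le {A : Type*} [NormedRing A] [NormOneClass A] {a a' : A}
    (h : ‖a‖ ≤ 1) (h' : ‖a'‖ ≤ 1) (k : ℕ) : ‖a ^ k - a' ^ k‖ ≤ k * ‖a - a'‖ := by
  induction k with
  | zero => simp
  | succ k ih =>
    have : a ^ (k + 1) - a' ^ (k + 1) = a ^ k * (a - a') + (a ^ k - a' ^ k) * a' := by
      rw [pow_succ, pow_succ]; noncomm_ring
    rw [this]
    have e1 : ‖a ^ k * (a - a')‖ ≤ 1 * ‖a - a'‖ :=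
      (norm_mul_le _ _).trans (mul_le_mul_of_nonneg_right
        ((norm_pow_le _ _).trans (pow_le_one₀ (norm_nonneg _) h)) (norm_nonneg _))
    have e2 : ‖(a ^ k - a' ^ k) * a'‖ ≤ (k * ‖a - a'‖) * 1 :=
      (norm_mul_le _ _).trans (mul_le_mul ih h' (norm_nonneg _) (by positivity))
    refine (norm_add_le _ _).trans ((add_le_add e1 e2).trans (le_of_eq ?_))
    push_cast; ring

/-- Powers of contractions telescope. The constant `∑ k |b_k|` depends on the taps and is unbounded
over admissible filters, so this serves only on a finite net. -/
theorem exists_norm_aeval_sub_le (b : ℂ[X]) : ∃ C : ℝ, 0 ≤ C ∧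
    ∀ {A : Type} [CStarAlgebra A] [NormOneClass A] (a a' : A), ‖a‖ ≤ 1 → ‖a'‖ ≤ 1 →
      ‖Polynomial.aeval a b - Polynomial.aeval a' b‖ ≤ C * ‖a - a'‖ := by
  refine ⟨b.sum fun k c => ‖c‖ * k, Finset.sum_nonneg fun _ _ => by positivity, ?_⟩
  intro A _ _ a a' h h'
  rw [Polynomial.aeval_eq_sum_range, Polynomial.aeval_eq_sum_range, ← Finset.sum_sub_distrib,
    Polynomial.sum_over_range _ (by simp), Finset.sum_mul]
  refine norm_sum_le_of_le _ fun k _ => ?_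
  rw [← smul_sub, mul_assoc]
  exact (norm_smul_le _ _).trans (mul_le_mul_of_nonneg_left (norm_pow_sub_pow_le h h' k)
    (norm_nonneg _))

/-- Uniform boundedness and the common Lipschitz constant give a relatively compact set by
Arzelà–Ascoli. The class of polynomials is not closed, but total boundedness suffices and keeps the
net inside the class. -/
theorem exists_finite_net_isResponse (Ω : ℝ≥0) {τ : ℝ} (hτ : 0 < τ) :
    ∃ t : Set ℝ[X], t.Finite ∧ t ⊆ {b | IsResponse Ω b} ∧ ∀ b, IsResponse Ω b →
      ∃ b' ∈ t, ∀ x ∈ Set.Icc (-1 : ℝ) 1, |(b - b').eval x| ≤ τ := by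
  let Φ : ℝ[X] → BoundedContinuousFunction (Set.Icc (-1 : ℝ) 1) ℝ := fun b =>
    BoundedContinuousFunction.mkOfCompact ⟨fun x => b.eval (x : ℝ), by fun_prop⟩
  have hcpt : IsCompact (closure (Φ '' {b | IsResponse Ω b})) := by
    refine BoundedContinuousFunction.arzela_ascoli (Set.Icc (-1) 1) isCompact_Icc _ ?_ ?_
    · rintro _ x ⟨b, hb, rfl⟩
      exact abs_le.1 (hb.1 x x.2)
    · refine UniformEquicontinuous.equicontinuous ?_
      refine LipschitzWith.uniformEquicontinuous _ Ω ?_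
      rintro ⟨_, b, hb, rfl⟩
      exact (lipschitzOnWith_iff_restrict.1 hb.2)
  obtain ⟨T, hTs, hTf, hcov⟩ := Metric.finite_approx_of_totallyBounded
    (hcpt.totallyBounded.subset subset_closure) τ hτ
  obtain ⟨t, hts, htf, rfl⟩ := Set.exists_subset_image_finite_and.1 ⟨T, hTs, hTf, rfl⟩
  refine ⟨t, htf, hts, fun b hb => ?_⟩
  obtain ⟨_, ⟨b', hb', rfl⟩, hd⟩ := Set.mem_iUnion₂.1 (hcov ⟨b, hb, rfl⟩) |>.imp
    fun y ⟨h1, h2⟩ => And.intro h1 h2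
  refine ⟨b', hb', fun x hx => ?_⟩
  have := (BoundedContinuousFunction.dist_coe_le_dist (f := Φ b) (g := Φ b') ⟨x, hx⟩).trans
    (Metric.mem_ball.1 hd).le
  simpa [Φ, Real.dist_eq] using this

/-- A three-term estimate: move `b` to a net element at cost `τ / 3` for each operator, then compare
the operators on that element. The sum `M` dominates the constants of the whole finite net, so `κ`
is independent of `b`. -/
theorem exists_norm_realAeval_sub_le (A : Type) [CStarAlgebra A] [NormOneClass A] (Ω : ℝ≥0)
    {τ : ℝ} (hτ : 0 < τ) : ∃ κ : ℝ, 0 < κ ∧ ∀ a a' : A, IsSelfAdjoint a → IsSelfAdjoint a' →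
      ‖a‖ ≤ 1 → ‖a'‖ ≤ 1 → ‖a - a'‖ ≤ κ → ∀ b, IsResponse Ω b →
        ‖realAeval a b - realAeval a' b‖ ≤ τ := by
  obtain ⟨t, htf, -, ht⟩ := exists_finite_net_isResponse Ω (τ := τ / 3) (by positivity)
  choose C hC0 hC using fun b : ℝ[X] => exists_norm_aeval_sub_le (b.map (algebraMap ℝ ℂ))
  set M := ∑ b ∈ htf.toFinset, C b with hM
  have hM0 : 0 ≤ M := Finset.sum_nonneg fun b _ => hC0 b
  refine ⟨τ / 3 / (M + 1), by positivity, fun a a' ha ha' h h' hd b hb => ?_⟩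
  obtain ⟨b', hb', hbb⟩ := ht b hb
  have e1 := norm_realAeval_le ha h _ hbb
  have e2 := norm_realAeval_le ha' h' _ hbb
  have e3 := hC b' a a' h h'
  have e4 : C b' ≤ M := Finset.single_le_sum (f := C) (fun b _ => hC0 b) (by simpa using hb')
  have e5 : C b' * ‖a - a'‖ ≤ τ / 3 := calc
    _ ≤ (M + 1) * (τ / 3 / (M + 1)) :=
        mul_le_mul (by linarith) hd (norm_nonneg _) (by positivity)
    _ = τ / 3 := by field_simp
  have e6 : realAeval a b - realAeval a' b = realAeval a (b - b') - realAeval a' (b - b') +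
      (realAeval a b' - realAeval a' b') := by
    simp only [realAeval, Polynomial.map_sub, map_sub]; abel
  rw [e6]
  refine (norm_add_le _ _).trans ((add_le_add (norm_sub_le _ _) le_rfl).trans ?_)
  simp only [realAeval] at *
  linarith

/-- The constant does not grow because the two distances to an intermediate point `b` add up exactly
on the line. -/
theorem LipschitzOnWith.union_Icc {f : ℝ → ℝ} {C : ℝ≥0} {a b c : ℝ}
    (h1 : LipschitzOnWith C f (Set.Icc a b)) (h2 : LipschitzOnWith C f (Set.Icc b c)) :
    LipschitzOnWith C f (Set.Icc a c) := by
  have key : ∀ x ∈ Set.Icc a c, ∀ y ∈ Set.Icc a c, x ≤ y → dist (f x) (f y) ≤ C * dist x y := by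
    intro x hx y hy hxy
    rcases le_total y b with hyb | hyb
    · exact h1.dist_le_mul x ⟨hx.1, hxy.trans hyb⟩ y ⟨hy.1, hyb⟩
    rcases le_total x b with hxb | hxb
    · have e1 := h1.dist_le_mul x ⟨hx.1, hxb⟩ b ⟨hx.1.trans hxb, le_rfl⟩
      have e2 := h2.dist_le_mul b ⟨le_rfl, hyb.trans hy.2⟩ y ⟨hyb, hy.2⟩
      refine (dist_triangle _ (f b) _).trans ((add_le_add e1 e2).trans (le_of_eq ?_))
      rw [← mul_add, Real.dist_eq, Real.dist_eq, Real.dist_eq, abs_of_nonpos (by linarith),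
        abs_of_nonpos (by linarith), abs_of_nonpos (by linarith)]
      ring
    · exact h2.dist_le_mul x ⟨hxb, hx.2⟩ y ⟨hyb, hy.2⟩
  refine LipschitzOnWith.of_dist_le_mul fun x hx y hy => ?_
  rcases le_total x y with h | h
  · exact key x hx y hy h
  · rw [dist_comm, dist_comm x]; exact key y hy x hx h

/-- The weaker constant near zero is at most the outer one, and the closed middle interval is
reached by continuity, so the three pieces glue to a bound on `[-1, 1]` that no longer involves `ε`.
-/
theorem FilterLipschitz.isResponse {Ω ω Ω' : ℝ≥0} {ε : ℝ} {b : ℝ[X]} (hε : 0 < ε)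
    (hb : FilterLipschitz Ω ω ε b) (hΩ : Ω ≤ Ω') : IsResponse Ω' b := by
  obtain ⟨h1, h2, h3, h4⟩ := hb
  refine ⟨fun x hx => (h4 x hx).le, ?_⟩
  have hmid : LipschitzOnWith Ω' (fun x => b.eval x) (Set.Icc (-ε) ε) := by
    rw [← closure_Ioo (by linarith)]
    exact LipschitzOnWith.closure (by fun_prop) (h2.weaken (h3.le.trans hΩ))
  exact (((h1.mono Set.subset_union_left).weaken hΩ).union_Icc hmid).union_Icc
    ((h1.mono Set.subset_union_right).weaken hΩ)

/-- Away from zero `b.divX` is the difference quotient of `b` at zero; the value at zero follows by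
continuity. -/
theorem IsResponse.abs_eval_divX_le {Ω : ℝ≥0} {b : ℝ[X]} (hb : IsResponse Ω b) :
    ∀ x ∈ Set.Icc (-1 : ℝ) 1, |b.divX.eval x| ≤ Ω := by
  have key : ∀ x ∈ Set.Icc (-1 : ℝ) 1, x ≠ 0 → |b.divX.eval x| ≤ Ω := by
    intro x hx hx0
    have h1 := hb.2.dist_le_mul x hx 0 (by simp)
    have h2 : b.eval x - b.eval 0 = b.divX.eval x * x := by
      conv_lhs => rw [← b.divX_mul_X_add]
      simp
    simp only [Real.dist_eq, sub_zero] at h1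
    rw [h2, abs_mul] at h1
    exact le_of_mul_le_mul_right h1 (abs_pos.2 hx0)
  intro x hx
  rcases eq_or_ne x 0 with rfl | hx0
  · refine le_of_tendsto (f := fun y : ℝ => |b.divX.eval y|) (x := nhdsWithin 0 {0}ᶜ)
      (((by fun_prop : Continuous fun y : ℝ => |b.divX.eval y|).tendsto 0).mono_left
        nhdsWithin_le_nhds) ?_
    filter_upwards [self_mem_nhdsWithin,
      mem_nhdsWithin_of_mem_nhds (Icc_mem_nhds (by norm_num : (-1 : ℝ) < 0) one_pos)]
      with y hy hy'
    exact key y hy' hy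
  · exact key x hx hx0

/-! ### Kernels as operators on complex `L²`. -/

/-- A measurable kernel with values in `[-1, 1]`. -/
structure IsKernel (K : I → I → ℝ) : Prop where
  measurable : Measurable (Function.uncurry K)
  abs_le : ∀ u v, |K u v| ≤ 1

theorem Graphon.isKernel (W : Graphon) : IsKernel W.toFun :=
  ⟨W.measurable', fun u v => abs_le.2 ⟨by linarith [(W.mem_Icc' u v).1], (W.mem_Icc' u v).2⟩⟩

theorem sq_lintegral_mul_le {α : Type*} [MeasurableSpace α] {μ : Measure α} {f g : α → ℝ≥0∞}
    (hf : AEMeasurable f μ) (hg : AEMeasurable g μ) :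
    (∫⁻ a, f a * g a ∂μ) ^ 2 ≤ (∫⁻ a, f a ^ 2 ∂μ) * ∫⁻ a, g a ^ 2 ∂μ := by
  have h := ENNReal.lintegral_mul_le_Lp_mul_Lq μ (p := 2) (q := 2)
    (by rw [Real.holderConjugate_iff]; norm_num) hf hg
  have h2 := pow_le_pow_left' h 2
  rw [mul_pow, ← ENNReal.rpow_natCast, ← ENNReal.rpow_natCast, ← ENNReal.rpow_natCast,
    ← ENNReal.rpow_mul, ← ENNReal.rpow_mul] at h2
  simpa using h2

theorem eLpNorm_two_sq {α E : Type*} [MeasurableSpace α] {μ : Measure α} [NormedAddCommGroup E]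
    (f : α → E) : eLpNorm f 2 μ ^ 2 = ∫⁻ a, ‖f a‖ₑ ^ 2 ∂μ := by
  have := eLpNorm_nnreal_pow_eq_lintegral (μ := μ) (f := f) (p := 2) (by norm_num)
  simpa using this

section Complex

variable {K : I → I → ℝ}

/-- The integral operator of a real kernel on complex functions. -/
def complexDiffusion (K : I → I → ℝ) (f : I → ℂ) : I → ℂ := fun v => ∫ u, (K u v : ℂ) * f u

theorem complexDiffusion_congr {f g : I → ℂ} (h : f =ᵐ[volume] g) :
    complexDiffusion K f = complexDiffusion K g := by
  funext v
  exact integral_congr_ae (h.mono fun u hu => by simp only [hu])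

theorem complexDiffusion_ofReal (X : I → ℝ) :
    complexDiffusion K (fun u => (X u : ℂ)) = fun v => ((diffusion K X v : ℝ) : ℂ) := by
  funext v
  simp only [complexDiffusion, diffusion, ← Complex.ofReal_mul]
  exact integral_ofReal

theorem IsKernel.measurable_left (hK : IsKernel K) (v : I) : Measurable fun u => K u v :=
  hK.measurable.comp (measurable_id.prodMk measurable_const)

theorem IsKernel.integrable_mul (hK : IsKernel K) {f : I → ℂ} (hf : Integrable f) (v : I) :
    Integrable fun u => (K u v : ℂ) * f u := by
  refine hf.bdd_mul (c := 1)
    (Complex.measurable_ofReal.comp (hK.measurable_left v)).aestronglyMeasurable ?_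
  exact Filter.Eventually.of_forall fun u => by simpa using hK.abs_le u v

theorem IsKernel.aestronglyMeasurable_complexDiffusion (hK : IsKernel K) {f : I → ℂ}
    (hf : AEStronglyMeasurable f) : AEStronglyMeasurable (complexDiffusion K f) := by
  rw [complexDiffusion_congr hf.ae_eq_mk]
  refine StronglyMeasurable.aestronglyMeasurable ?_
  refine StronglyMeasurable.integral_prod_left (f := fun u v => (K u v : ℂ) * hf.mk f u) ?_
  exact (Complex.measurable_ofReal.comp hK.measurable).stronglyMeasurable.mul
    (hf.stronglyMeasurable_mk.comp_measurable measurable_fst)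

/-- The Hilbert–Schmidt bound: Cauchy–Schwarz for each `v`, then Tonelli. -/
theorem IsKernel.eLpNorm_complexDiffusion_le (hK : IsKernel K) {f : I → ℂ}
    (hf : AEStronglyMeasurable f) : eLpNorm (complexDiffusion K f) 2 volume ≤
      eLpNorm (Function.uncurry K) 2 volume * eLpNorm f 2 volume := by
  have hpt : ∀ v, ‖complexDiffusion K f v‖ₑ ^ 2 ≤
      (∫⁻ u, ‖K u v‖ₑ ^ 2) * eLpNorm f 2 volume ^ 2 := by
    intro v
    rw [eLpNorm_two_sq]
    refine le_trans (pow_le_pow_left' (enorm_integral_le_lintegral_enorm _) 2) ?_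
    have : ∀ u, ‖(K u v : ℂ) * f u‖ₑ = ‖K u v‖ₑ * ‖f u‖ₑ := fun u => by
      rw [enorm_mul]; congr 1; simp [enorm_eq_nnnorm]
    simp only [this]
    exact sq_lintegral_mul_le (hK.measurable_left v).enorm.aemeasurable hf.enorm
  refine (ENNReal.pow_le_pow_left_iff two_ne_zero).1 ?_
  rw [mul_pow, eLpNorm_two_sq, eLpNorm_two_sq (Function.uncurry K), Measure.volume_eq_prod,
    lintegral_prod_symm _ (hK.measurable.enorm.pow_const 2).aemeasurable,
    ← lintegral_mul_const'' _ (Measurable.lintegral_prod_left'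
      (hK.measurable.enorm.pow_const 2)).aemeasurable]
  exact lintegral_mono hpt

theorem IsKernel.eLpNorm_le_one (hK : IsKernel K) : eLpNorm (Function.uncurry K) 2 volume ≤ 1 := by
  refine (eLpNorm_le_of_ae_bound (C := 1) (Filter.Eventually.of_forall fun z => ?_)).trans ?_
  · exact hK.abs_le z.1 z.2
  · simp

theorem IsKernel.memLp_complexDiffusion (hK : IsKernel K) {f : I → ℂ} (hf : MemLp f 2) :
    MemLp (complexDiffusion K f) 2 :=
  ⟨hK.aestronglyMeasurable_complexDiffusion hf.1, (hK.eLpNorm_complexDiffusion_le hf.1).trans_lt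
    (ENNReal.mul_lt_top (hK.eLpNorm_le_one.trans_lt ENNReal.one_lt_top) hf.2)⟩

/-- The integral operator of a kernel on complex `L²`. -/
def kernelOp (hK : IsKernel K) : Lp ℂ 2 (volume : Measure I) →L[ℂ] Lp ℂ 2 (volume : Measure I) :=
  LinearMap.mkContinuous
    { toFun := fun f => (hK.memLp_complexDiffusion (Lp.memLp f)).toLp
      map_add' := fun f g => by
        rw [← MemLp.toLp_add]
        refine (MemLp.toLp_eq_toLp_iff _ _).2 (Filter.Eventually.of_forall fun v => ?_)
        rw [complexDiffusion_congr (Lp.coeFn_add f g)]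
        simp only [complexDiffusion, Pi.add_apply, mul_add]
        exact integral_add (hK.integrable_mul ((Lp.memLp f).integrable one_le_two) v)
          (hK.integrable_mul ((Lp.memLp g).integrable one_le_two) v)
      map_smul' := fun c f => by
        rw [← MemLp.toLp_const_smul]
        refine (MemLp.toLp_eq_toLp_iff _ _).2 (Filter.Eventually.of_forall fun v => ?_)
        rw [complexDiffusion_congr (Lp.coeFn_smul c f)]
        simp only [complexDiffusion, Pi.smul_apply, smul_eq_mul, RingHom.id_apply,
          ← integral_const_mul, mul_left_comm] }
    (eLpNorm (Function.uncurry K) 2 volume).toReal fun f => by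
      simp only [LinearMap.coe_mk, AddHom.coe_mk, Lp.norm_toLp]
      rw [Lp.norm_def, ← ENNReal.toReal_mul]
      exact ENNReal.toReal_mono (ENNReal.mul_ne_top
        (hK.eLpNorm_le_one.trans_lt ENNReal.one_lt_top).ne (Lp.memLp f).2.ne)
        (hK.eLpNorm_complexDiffusion_le (Lp.memLp f).1)

theorem norm_kernelOp_le (hK : IsKernel K) :
    ‖kernelOp hK‖ ≤ (eLpNorm (Function.uncurry K) 2 volume).toReal :=
  LinearMap.mkContinuous_norm_le _ ENNReal.toReal_nonneg _

theorem norm_kernelOp_le_one (hK : IsKernel K) : ‖kernelOp hK‖ ≤ 1 :=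
  (norm_kernelOp_le hK).trans (ENNReal.toReal_mono ENNReal.one_ne_top hK.eLpNorm_le_one)

theorem coeFn_kernelOp (hK : IsKernel K) (f : Lp ℂ 2 (volume : Measure I)) :
    kernelOp hK f =ᵐ[volume] complexDiffusion K f :=
  MemLp.coeFn_toLp (hK.memLp_complexDiffusion (Lp.memLp f))

theorem integrable_kernel_mul_mul (hK : IsKernel K) {f g : I → ℂ} (hf : Integrable f)
    (hg : Integrable g) :
    Integrable (fun z : I × I => (K z.1 z.2 : ℂ) * (f z.1 * g z.2)) (volume.prod volume) := by
  refine (hf.mul_prod hg).bdd_mul (c := 1)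
    (Complex.measurable_ofReal.comp hK.measurable).aestronglyMeasurable ?_
  exact Filter.Eventually.of_forall fun u => by simpa using hK.abs_le u.1 u.2

theorem isSelfAdjoint_kernelOp (hK : IsKernel K) (hs : ∀ u v, K u v = K v u) :
    IsSelfAdjoint (kernelOp hK) := by
  rw [ContinuousLinearMap.isSelfAdjoint_iff_isSymmetric]
  intro f g
  have hf := (Lp.memLp f).integrable one_le_two
  have hg := (Lp.memLp g).integrable one_le_two
  have hfc : Integrable (fun u => (starRingEnd ℂ) (f u)) := by
    simpa using (Complex.conjLIE.toContinuousLinearEquiv.toContinuousLinearMap.integrable_comp hf)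
  simp only [ContinuousLinearMap.coe_coe, L2.inner_def]
  have e1 : ∫ v, inner ℂ ((kernelOp hK f) v) (g v) =
      ∫ v, ∫ u, (K u v : ℂ) * ((starRingEnd ℂ) (f u) * g v) := by
    refine integral_congr_ae ((coeFn_kernelOp hK f).mono fun v hv => ?_)
    simp only [hv, complexDiffusion, RCLike.inner_apply]
    rw [← integral_conj, mul_comm, ← integral_mul_const]
    simp [mul_assoc]
  have e2 : ∫ v, inner ℂ (f v) ((kernelOp hK g) v) =
      ∫ v, ∫ u, (K u v : ℂ) * ((starRingEnd ℂ) (f v) * g u) := by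
    refine integral_congr_ae ((coeFn_kernelOp hK g).mono fun v hv => ?_)
    simp only [hv, complexDiffusion, RCLike.inner_apply]
    rw [← integral_mul_const]
    refine integral_congr_ae (Filter.Eventually.of_forall fun u => ?_)
    simp only; ring
  rw [e1, e2, integral_integral_swap]
  · refine integral_congr_ae (Filter.Eventually.of_forall fun u => ?_)
    refine integral_congr_ae (Filter.Eventually.of_forall fun v => ?_)
    simp only [hs u v]
  · exact (integrable_kernel_mul_mul hK hfc hg).swap

theorem kernelOp_sub {K' K'' : I → I → ℝ} (hK : IsKernel K) (hK' : IsKernel K')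
    (hK'' : IsKernel K'') (h : ∀ u v, K'' u v = K u v - K' u v) :
    kernelOp hK'' = kernelOp hK - kernelOp hK' := by
  refine ContinuousLinearMap.ext fun f => Lp.ext ?_
  have hf := (Lp.memLp f).integrable one_le_two
  rw [sub_apply]
  filter_upwards [coeFn_kernelOp hK f, coeFn_kernelOp hK' f, coeFn_kernelOp hK'' f,
    Lp.coeFn_sub (kernelOp hK f) (kernelOp hK' f)] with v h1 h2 h3 h4
  rw [h4, Pi.sub_apply, h1, h2, h3]
  simp only [complexDiffusion, h, Complex.ofReal_sub, sub_mul]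
  exact integral_sub (hK.integrable_mul hf v) (hK'.integrable_mul hf v)

/-- The composition of the kernel `K` with itself. -/
def kernelSq (K : I → I → ℝ) : I → I → ℝ := fun s t => ∫ r, K s r * K r t

theorem IsKernel.kernelSq (hK : IsKernel K) : IsKernel (kernelSq K) where
  measurable := by
    have : StronglyMeasurable fun z : I × I => ∫ r, K z.1 r * K r z.2 := by
      refine StronglyMeasurable.integral_prod_right
        (f := fun z : I × I => fun r => K z.1 r * K r z.2) ?_
      exact ((hK.measurable.comp ((measurable_fst.comp measurable_fst).prodMk measurable_snd)).mul
        (hK.measurable.comp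
          (measurable_snd.prodMk (measurable_snd.comp measurable_fst)))).stronglyMeasurable
    exact this.measurable
  abs_le u v := by
    rw [← Real.norm_eq_abs]
    refine (norm_integral_le_of_norm_le_const (C := 1) (Filter.Eventually.of_forall fun r => ?_)).trans ?_
    · rw [norm_mul]
      exact mul_le_one₀ (hK.abs_le _ _) (norm_nonneg _) (hK.abs_le _ _)
    · simp

theorem kernelOp_kernelSq (hK : IsKernel K) :
    kernelOp hK.kernelSq = kernelOp hK * kernelOp hK := by
  refine ContinuousLinearMap.ext fun f => Lp.ext ?_
  have hf := (Lp.memLp f).integrable one_le_two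
  rw [mul_apply_eq_comp]
  filter_upwards [coeFn_kernelOp hK.kernelSq f, coeFn_kernelOp hK (kernelOp hK f)] with t h1 h2
  rw [h1, h2, complexDiffusion_congr (coeFn_kernelOp hK f)]
  simp only [complexDiffusion, ← integral_const_mul]
  rw [integral_integral_swap]
  · refine integral_congr_ae (Filter.Eventually.of_forall fun u => ?_)
    simp only [_root_.kernelSq]
    rw [← integral_complex_ofReal, ← integral_mul_const]
    refine integral_congr_ae (Filter.Eventually.of_forall fun r => ?_)
    simp only [Complex.ofReal_mul]; ring
  · have := integrable_kernel_mul_mul hK hf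
      ((integrable_const (1 : ℂ)).bdd_mul (c := 1) (f := fun r => (K r t : ℂ))
      (Complex.measurable_ofReal.comp (hK.measurable_left t)).aestronglyMeasurable
      (Filter.Eventually.of_forall fun u => by simpa using hK.abs_le u t))
    refine this.swap.congr (Filter.Eventually.of_forall fun z => ?_)
    simp only [Function.comp, Prod.fst_swap, Prod.snd_swap, Function.uncurry]
    ring

/-- For self-adjoint `T` one has `‖T²‖ = ‖T‖²`, and `‖T²‖` is at most the Hilbert–Schmidt norm of
the composed kernel. Composing first matters for noise: the composition averages out cancellations
that the kernel's own `L²` norm cannot see. -/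
theorem norm_kernelOp_pow_four_le (hK : IsKernel K) (hs : ∀ u v, K u v = K v u) :
    ENNReal.ofReal (‖kernelOp hK‖ ^ 4) ≤ ∫⁻ z : I × I, ‖kernelSq K z.1 z.2‖ₑ ^ 2 := by
  have h1 : ‖kernelOp hK * kernelOp hK‖ = ‖kernelOp hK‖ ^ 2 := by
    rw [sq, ← ContinuousLinearMap.norm_adjoint_comp_self,
      (isSelfAdjoint_kernelOp hK hs).adjoint_eq]
    rfl
  rw [← kernelOp_kernelSq hK] at h1
  have h2 := norm_kernelOp_le hK.kernelSq
  rw [h1] at h2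
  have h3 : ‖kernelOp hK‖ ^ 4 = (‖kernelOp hK‖ ^ 2) ^ 2 := by ring
  have h4 := eLpNorm_two_sq (μ := (volume : Measure (I × I))) (Function.uncurry (kernelSq K))
  simp only [Function.uncurry] at h4
  rw [h3, ← h4, ENNReal.ofReal_pow (by positivity)]
  exact pow_le_pow_left' (ENNReal.ofReal_le_of_le_toReal h2) 2

/-- `f` represents the complexification of the real function `X`. -/
def Represents (f : Lp ℂ 2 (volume : Measure I)) (X : I → ℝ) : Prop :=
  f =ᵐ[volume] fun u => (X u : ℂ)

theorem exists_represents {X : I → ℝ} (hX : MemLp X 2) : ∃ f, Represents f X :=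
  ⟨hX.ofReal.toLp, MemLp.coeFn_toLp _⟩

theorem Represents.eLpNorm_eq {f : Lp ℂ 2 (volume : Measure I)} {X : I → ℝ}
    (h : Represents f X) : eLpNorm X 2 volume = ENNReal.ofReal ‖f‖ := by
  rw [Lp.norm_def, ENNReal.ofReal_toReal (Lp.memLp f).2.ne, eLpNorm_congr_ae h]
  exact eLpNorm_congr_enorm_ae (Filter.Eventually.of_forall fun u => by simp [enorm_eq_nnnorm])

theorem Represents.sub {f g : Lp ℂ 2 (volume : Measure I)} {X Y : I → ℝ}
    (h : Represents f X) (h' : Represents g Y) : Represents (f - g) (fun u => X u - Y u) := by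
  filter_upwards [Lp.coeFn_sub f g, h, h'] with u h1 h2 h3
  rw [h1, Pi.sub_apply, h2, h3, Complex.ofReal_sub]

theorem Represents.diffusion_iterate (hK : IsKernel K) {f : Lp ℂ 2 (volume : Measure I)}
    {X : I → ℝ} (h : Represents f X) (k : ℕ) :
    Represents ((kernelOp hK ^ k) f) ((diffusion K)^[k] X) := by
  induction k with
  | zero => simpa using h
  | succ k ih =>
    rw [pow_succ', mul_apply_eq_comp, Function.iterate_succ_apply']
    refine (coeFn_kernelOp hK _).trans ?_
    rw [complexDiffusion_congr ih, complexDiffusion_ofReal]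

/-- The bridge from filters acting on honest real functions to the functional calculus acting on
classes in complex `L²`; norm bounds proved there transfer back through `Represents.eLpNorm_eq`. -/
theorem Represents.graphonFilter (hK : IsKernel K) {f : Lp ℂ 2 (volume : Measure I)}
    {X : I → ℝ} (h : Represents f X) (b : ℝ[X]) :
    Represents (realAeval (kernelOp hK) b f) (graphonFilter b K X) := by
  have h1 : realAeval (kernelOp hK) b f =
      ∑ k ∈ b.support, (b.coeff k : ℂ) • (kernelOp hK ^ k) f := by
    rw [realAeval, Polynomial.aeval_def, Polynomial.eval₂_map, Polynomial.eval₂_eq_sum,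
      Polynomial.sum_def, sum_apply]
    refine Finset.sum_congr rfl fun k _ => ?_
    rw [mul_apply_eq_comp, RingHom.comp_apply, Algebra.algebraMap_eq_smul_one]
    rfl
  rw [h1]
  have h2 : ∀ s : Finset ℕ, Represents (∑ k ∈ s, (b.coeff k : ℂ) • (kernelOp hK ^ k) f)
      (fun v => ∑ k ∈ s, b.coeff k * (diffusion K)^[k] X v) := by
    intro s
    induction s using Finset.induction_on with
    | empty =>
      filter_upwards with u
      simp
    | insert k s hk ih =>
      rw [Finset.sum_insert hk]
      simp only [Finset.sum_insert hk]
      filter_upwards [Lp.coeFn_add ((b.coeff k : ℂ) • (kernelOp hK ^ k) f)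
        (∑ k ∈ s, (b.coeff k : ℂ) • (kernelOp hK ^ k) f),
        Lp.coeFn_smul (b.coeff k : ℂ) ((kernelOp hK ^ k) f), ih,
        h.diffusion_iterate hK k] with u e1 e2 e3 e4
      rw [e1, Pi.add_apply, e2, Pi.smul_apply, e3, e4]
      simp
  exact h2 b.support

theorem measurable_diffusion (hK : IsKernel K) {X : I → ℝ} (hX : Measurable X) :
    Measurable (diffusion K X) :=
  (StronglyMeasurable.integral_prod_left (f := fun u v => K u v * X u)
    (hK.measurable.mul (hX.comp measurable_fst)).stronglyMeasurable).measurable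

theorem measurable_graphonFilter (hK : IsKernel K) {X : I → ℝ} (hX : Measurable X) (b : ℝ[X]) :
    Measurable (graphonFilter b K X) := by
  have : ∀ k, Measurable ((diffusion K)^[k] X) := fun k => by
    induction k with
    | zero => exact hX
    | succ k ih => rw [Function.iterate_succ_apply']; exact measurable_diffusion hK ih
  unfold graphonFilter
  simp only [Polynomial.sum_def]
  exact Finset.measurable_sum _ fun k _ => (this k).const_mul _

theorem eLpNorm_graphonFilter_le (hK : IsKernel K) (hs : ∀ u v, K u v = K v u) {X : I → ℝ}
    (hX : MemLp X 2) {b : ℝ[X]} {c : ℝ} (hb : ∀ x ∈ Set.Icc (-1 : ℝ) 1, |b.eval x| ≤ c) :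
    eLpNorm (graphonFilter b K X) 2 volume ≤ ENNReal.ofReal c * eLpNorm X 2 volume := by
  obtain ⟨f, hf⟩ := exists_represents hX
  have hn := norm_realAeval_le (A := Lp ℂ 2 (volume : Measure I) →L[ℂ] Lp ℂ 2 volume)
    (isSelfAdjoint_kernelOp hK hs) (norm_kernelOp_le_one hK) b hb
  rw [(hf.graphonFilter hK b).eLpNorm_eq, hf.eLpNorm_eq,
    ← ENNReal.ofReal_mul ((norm_nonneg _).trans hn)]
  exact ENNReal.ofReal_le_ofReal ((ContinuousLinearMap.le_opNorm _ _).trans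
    (mul_le_mul_of_nonneg_right hn (norm_nonneg _)))

/-- Filters with a common Lipschitz constant are uniformly continuous in the graphon. -/
theorem exists_eLpNorm_graphonFilter_sub_le (Ω : ℝ≥0) {τ : ℝ} (hτ : 0 < τ) :
    ∃ κ : ℝ, 0 < κ ∧ ∀ {K K' : I → I → ℝ} (hK : IsKernel K) (hK' : IsKernel K'),
      (∀ u v, K u v = K v u) → (∀ u v, K' u v = K' v u) → ‖kernelOp hK - kernelOp hK'‖ ≤ κ →
      ∀ b, IsResponse Ω b → ∀ X : I → ℝ, MemLp X 2 →
        eLpNorm (fun v => graphonFilter b K X v - graphonFilter b K' X v) 2 volume ≤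
          ENNReal.ofReal τ * eLpNorm X 2 volume := by
  -- Nontriviality makes the identity operator have norm 1, as the functional calculus estimate
  -- requires of the algebra.
  have : Nontrivial (Lp ℂ 2 (volume : Measure I)) :=
    ⟨indicatorConstLp 2 MeasurableSet.univ (by simp) 1, 0, fun h => by
      have := congrArg norm h
      rw [norm_indicatorConstLp (by norm_num) (by norm_num)] at this
      simp at this⟩
  obtain ⟨κ, hκ, h⟩ := exists_norm_realAeval_sub_le
    (Lp ℂ 2 (volume : Measure I) →L[ℂ] Lp ℂ 2 (volume : Measure I)) Ω hτ
  refine ⟨κ, hκ, fun {K K'} hK hK' hs hs' hd b hb X hX => ?_⟩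
  have hn := h _ _ (isSelfAdjoint_kernelOp hK hs) (isSelfAdjoint_kernelOp hK' hs')
    (norm_kernelOp_le_one hK) (norm_kernelOp_le_one hK') hd b hb
  obtain ⟨f, hf⟩ := exists_represents hX
  rw [((hf.graphonFilter hK b).sub (hf.graphonFilter hK' b)).eLpNorm_eq, hf.eLpNorm_eq,
    ← ENNReal.ofReal_mul hτ.le, ← sub_apply]
  exact ENNReal.ofReal_le_ofReal ((ContinuousLinearMap.le_opNorm _ _).trans
    (mul_le_mul_of_nonneg_right hn (norm_nonneg _)))

end Complex

/-! ### Pointwise control of filtered signals. -/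

section Filter

variable {K : I → I → ℝ}

theorem memLp_diffusion_iterate (hK : IsKernel K) {X : I → ℝ} (hX : MemLp X 2)
    (hm : Measurable X) (k : ℕ) :
    Measurable ((diffusion K)^[k] X) ∧ MemLp ((diffusion K)^[k] X) 2 := by
  have hmk : Measurable ((diffusion K)^[k] X) := by
    induction k with
    | zero => exact hm
    | succ k ih => rw [Function.iterate_succ_apply']; exact measurable_diffusion hK ih
  obtain ⟨f, hf⟩ := exists_represents hX
  refine ⟨hmk, hmk.aestronglyMeasurable, ?_⟩
  rw [(hf.diffusion_iterate hK k).eLpNorm_eq]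
  exact ENNReal.ofReal_lt_top

theorem graphonFilter_eq_sum_range (b : ℝ[X]) (K : I → I → ℝ) (X : I → ℝ) (v : I) {n : ℕ}
    (hn : b.natDegree < n) :
    graphonFilter b K X v = ∑ k ∈ Finset.range n, b.coeff k * ((diffusion K)^[k] X) v :=
  Polynomial.sum_over_range' b (f := fun k c => c * ((diffusion K)^[k] X) v) (by simp) n hn

/-- This is `b(λ) = b(0) + λ b₁(λ)` with one diffusion pulled outside. It holds at every point, not
only almost everywhere, which pointwise envelopes need. -/
theorem graphonFilter_eq_add_diffusion (hK : IsKernel K) {X : I → ℝ} (hX : MemLp X 2)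
    (hm : Measurable X) (b : ℝ[X]) (v : I) :
    graphonFilter b K X v = b.coeff 0 * X v + diffusion K (graphonFilter b.divX K X) v := by
  have hd : b.divX.natDegree < b.natDegree + 1 := by
    rw [Polynomial.natDegree_divX_eq_natDegree_tsub_one]; omega
  have e : diffusion K (graphonFilter b.divX K X) v =
      ∑ k ∈ Finset.range (b.natDegree + 1), b.coeff (k + 1) * ((diffusion K)^[k + 1] X) v := by
    conv_lhs => unfold diffusion
    simp only [graphonFilter_eq_sum_range b.divX K X _ hd, Finset.mul_sum, Polynomial.coeff_divX]
    rw [integral_finsetSum]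
    · refine Finset.sum_congr rfl fun k _ => ?_
      rw [Function.iterate_succ_apply']
      conv_rhs => rw [diffusion, ← integral_const_mul]
      refine integral_congr_ae (Filter.Eventually.of_forall fun u => ?_)
      simp only; ring
    · intro k _
      refine (((memLp_diffusion_iterate hK hX hm k).2.integrable one_le_two).const_mul
        (b.coeff (k + 1))).bdd_mul (c := 1) (hK.measurable_left v).aestronglyMeasurable ?_
      exact Filter.Eventually.of_forall fun u => hK.abs_le u v
  rw [e, graphonFilter_eq_sum_range b K X v (n := b.natDegree + 1 + 1) (by omega), Finset.sum_range_succ', add_comm]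
  simp

/-- A kernel bounded by 1 maps `L¹` to bounded functions, and `L¹` norms are at most `L²` norms on a
probability space. -/
theorem abs_diffusion_le (hK : IsKernel K) {X : I → ℝ} (hm : Measurable X) {R : ℝ} (hR : 0 ≤ R)
    (hX : eLpNorm X 2 volume ≤ ENNReal.ofReal R) (v : I) : |diffusion K X v| ≤ R := by
  have h1 : ‖diffusion K X v‖ₑ ≤ eLpNorm X 1 volume := by
    rw [eLpNorm_one_eq_lintegral_enorm]
    refine (enorm_integral_le_lintegral_enorm _).trans (lintegral_mono fun u => ?_)
    rw [enorm_mul]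
    refine mul_le_of_le_one_left' ?_
    rw [← ofReal_norm, ENNReal.ofReal_le_one]
    exact hK.abs_le u v
  have h2 := h1.trans ((eLpNorm_le_eLpNorm_of_exponent_le one_le_two
    hm.aestronglyMeasurable).trans hX)
  rw [← ofReal_norm] at h2
  exact (ENNReal.ofReal_le_ofReal_iff hR).1 h2

/-- The tap `b(0)` contributes at most `|X v|`; the rest is one diffusion of a signal of `L²` norm
at most `Ω R`, hence bounded. This is what lets exponential moments of the input survive all layers.
-/
theorem abs_graphonFilter_le (hK : IsKernel K) (hs : ∀ u v, K u v = K v u) {Ω : ℝ≥0} {b : ℝ[X]}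
    (hb : IsResponse Ω b) {X : I → ℝ} (hm : Measurable X) {R : ℝ} (hR : 0 ≤ R)
    (hX : eLpNorm X 2 volume ≤ ENNReal.ofReal R) (v : I) :
    |graphonFilter b K X v| ≤ |X v| + Ω * R := by
  have hL : MemLp X 2 := ⟨hm.aestronglyMeasurable, hX.trans_lt ENNReal.ofReal_lt_top⟩
  rw [graphonFilter_eq_add_diffusion hK hL hm]
  have h1 : |b.coeff 0| ≤ 1 := by
    rw [Polynomial.coeff_zero_eq_eval_zero]; exact hb.1 0 (by simp)
  have h2 := abs_diffusion_le hK (measurable_graphonFilter hK hm b.divX)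
    (R := Ω * R) (by positivity) ((eLpNorm_graphonFilter_le hK hs hL hb.abs_eval_divX_le).trans
      (by rw [ENNReal.ofReal_mul (by positivity)]; gcongr)) v
  refine (abs_add_le _ _).trans (add_le_add ?_ h2)
  rw [abs_mul]
  exact mul_le_of_le_one_left (abs_nonneg _) h1

theorem eLpNorm_graphonFilter_sub_graphonFilter_le (hK : IsKernel K)
    (hs : ∀ u v, K u v = K v u) {b : ℝ[X]} (hb : ∀ x ∈ Set.Icc (-1 : ℝ) 1, |b.eval x| ≤ 1)
    {X Y : I → ℝ} (hX : MemLp X 2) (hY : MemLp Y 2) :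
    eLpNorm (fun v => graphonFilter b K X v - graphonFilter b K Y v) 2 volume ≤
      eLpNorm (fun v => X v - Y v) 2 volume := by
  obtain ⟨f, hf⟩ := exists_represents hX
  obtain ⟨g, hg⟩ := exists_represents hY
  have hn := norm_realAeval_le (A := Lp ℂ 2 (volume : Measure I) →L[ℂ] Lp ℂ 2 volume)
    (isSelfAdjoint_kernelOp hK hs) (norm_kernelOp_le_one hK) b hb
  rw [((hf.graphonFilter hK b).sub (hg.graphonFilter hK b)).eLpNorm_eq, (hf.sub hg).eLpNorm_eq,
    ← map_sub]
  exact ENNReal.ofReal_le_ofReal (((ContinuousLinearMap.le_opNorm _ _).trans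
    (mul_le_mul_of_nonneg_right hn (norm_nonneg _))).trans_eq (one_mul _))

end Filter

/-! ### Stability of networks -/

/-- `f` and `f'` have size `R` in `L²` and, relative to the envelopes `w` and `w'`, pointwise;
their `L²` distance is at most `κ R`. -/
structure CloseSignals (κ : ℝ) (w w' : I → ℝ) (R : ℝ) (f f' : I → ℝ) : Prop where
  measurable : Measurable f
  measurable' : Measurable f'
  norm_le : eLpNorm f 2 volume ≤ ENNReal.ofReal R
  norm_le' : eLpNorm f' 2 volume ≤ ENNReal.ofReal R
  norm_sub_le : eLpNorm (fun v => f v - f' v) 2 volume ≤ ENNReal.ofReal (κ * R)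
  abs_le : ∀ v, |f v| ≤ R * w v
  abs_le' : ∀ v, |f' v| ≤ R * w' v

/-- Symmetric kernels on which all filters with responses in the class `IsResponse Ω` are within
`κ` of each other. -/
structure CloseKernels (κ : ℝ) (Ω : ℝ≥0) (K K' : I → I → ℝ) : Prop where
  isKernel : IsKernel K
  isKernel' : IsKernel K'
  symm : ∀ u v, K u v = K v u
  symm' : ∀ u v, K' u v = K' v u
  filter_sub_le : ∀ b, IsResponse Ω b → ∀ X : I → ℝ, MemLp X 2 →
    eLpNorm (fun v => graphonFilter b K X v - graphonFilter b K' X v) 2 volume ≤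
      ENNReal.ofReal κ * eLpNorm X 2 volume

section Stability

variable {κ : ℝ} {w w' : I → ℝ} {Ω : ℝ≥0} {K K' : I → I → ℝ} {R R' : ℝ}

theorem CloseSignals.zero : CloseSignals κ w w' 0 (fun _ => 0) (fun _ => 0) where
  measurable := measurable_const
  measurable' := measurable_const
  norm_le := by simp
  norm_le' := by simp
  norm_sub_le := by simp
  abs_le := by simp
  abs_le' := by simp

theorem CloseSignals.add (hκ : 0 ≤ κ) (hR : 0 ≤ R) (hR' : 0 ≤ R') {f f' g g' : I → ℝ}
    (hf : CloseSignals κ w w' R f f') (hg : CloseSignals κ w w' R' g g') :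
    CloseSignals κ w w' (R + R') (fun v => f v + g v) (fun v => f' v + g' v) where
  measurable := hf.measurable.add hg.measurable
  measurable' := hf.measurable'.add hg.measurable'
  norm_le := by
    rw [ENNReal.ofReal_add hR hR']
    exact (eLpNorm_add_le hf.measurable.aestronglyMeasurable hg.measurable.aestronglyMeasurable
      one_le_two).trans (add_le_add hf.norm_le hg.norm_le)
  norm_le' := by
    rw [ENNReal.ofReal_add hR hR']
    exact (eLpNorm_add_le hf.measurable'.aestronglyMeasurable
      hg.measurable'.aestronglyMeasurable one_le_two).trans (add_le_add hf.norm_le' hg.norm_le')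
  norm_sub_le := by
    rw [mul_add, ENNReal.ofReal_add (by positivity) (by positivity)]
    simp only [add_sub_add_comm]
    exact (eLpNorm_add_le (hf.measurable.sub hf.measurable').aestronglyMeasurable
      (hg.measurable.sub hg.measurable').aestronglyMeasurable one_le_two).trans
      (add_le_add hf.norm_sub_le hg.norm_sub_le)
  abs_le v := by
    rw [add_mul]; exact (abs_add_le _ _).trans (add_le_add (hf.abs_le v) (hg.abs_le v))
  abs_le' v := by
    rw [add_mul]; exact (abs_add_le _ _).trans (add_le_add (hf.abs_le' v) (hg.abs_le' v))

theorem CloseSignals.mono (hκ : 0 ≤ κ) (hw : ∀ v, 1 ≤ w v) (hw' : ∀ v, 1 ≤ w' v) (h : R ≤ R')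
    {f f' : I → ℝ} (hf : CloseSignals κ w w' R f f') : CloseSignals κ w w' R' f f' where
  measurable := hf.measurable
  measurable' := hf.measurable'
  norm_le := hf.norm_le.trans (ENNReal.ofReal_le_ofReal h)
  norm_le' := hf.norm_le'.trans (ENNReal.ofReal_le_ofReal h)
  norm_sub_le := hf.norm_sub_le.trans
    (ENNReal.ofReal_le_ofReal (mul_le_mul_of_nonneg_left h hκ))
  abs_le v := (hf.abs_le v).trans (mul_le_mul_of_nonneg_right h (by linarith [hw v]))
  abs_le' v := (hf.abs_le' v).trans (mul_le_mul_of_nonneg_right h (by linarith [hw' v]))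

theorem CloseSignals.sum (hκ : 0 ≤ κ) (hR : 0 ≤ R) {p : ℕ} {f f' : Fin p → I → ℝ}
    (h : ∀ g, CloseSignals κ w w' R (f g) (f' g)) :
    CloseSignals κ w w' (p * R) (fun v => ∑ g, f g v) (fun v => ∑ g, f' g v) := by
  induction p with
  | zero => simpa using CloseSignals.zero
  | succ p ih =>
    simp only [Fin.sum_univ_castSucc]
    have := (ih fun g => h g.castSucc).add hκ (by positivity) hR (h (Fin.last p))
    convert this using 1
    push_cast; ring

theorem NormalizedLipschitz.abs_le {ρ : ℝ → ℝ} (h : NormalizedLipschitz ρ) (x : ℝ) :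
    |ρ x| ≤ |x| := by
  simpa [h.2] using h.1 x 0

theorem NormalizedLipschitz.continuous {ρ : ℝ → ℝ} (h : NormalizedLipschitz ρ) :
    Continuous ρ :=
  (LipschitzWith.of_dist_le_mul (K := 1) fun x y => by
    simpa [Real.dist_eq] using h.1 x y).continuous

theorem CloseSignals.comp {ρ : ℝ → ℝ} (h : NormalizedLipschitz ρ) {f f' : I → ℝ}
    (hf : CloseSignals κ w w' R f f') :
    CloseSignals κ w w' R (fun v => ρ (f v)) (fun v => ρ (f' v)) where
  measurable := h.continuous.measurable.comp hf.measurable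
  measurable' := h.continuous.measurable.comp hf.measurable'
  norm_le := (eLpNorm_mono fun _ => h.abs_le _).trans hf.norm_le
  norm_le' := (eLpNorm_mono fun _ => h.abs_le _).trans hf.norm_le'
  norm_sub_le := (eLpNorm_mono fun _ => h.1 _ _).trans hf.norm_sub_le
  abs_le v := (h.abs_le _).trans (hf.abs_le v)
  abs_le' v := (h.abs_le _).trans (hf.abs_le' v)

/-- The factor `2 + Ω` serves all the bounds: the norms do not grow, the distance gains one `κ R`
from changing the kernel and one from changing the signal, and the pointwise bound grows by `1 + Ω`
because the envelopes are at least 1. -/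
theorem CloseSignals.filter (hκ : 0 ≤ κ) (hw : ∀ v, 1 ≤ w v) (hw' : ∀ v, 1 ≤ w' v) (hR : 0 ≤ R)
    (hK : CloseKernels κ Ω K K') {b : ℝ[X]} (hb : IsResponse Ω b) {f f' : I → ℝ}
    (hf : CloseSignals κ w w' R f f') :
    CloseSignals κ w w' ((2 + Ω) * R) (graphonFilter b K f) (graphonFilter b K' f') := by
  have hL : MemLp f 2 := ⟨hf.measurable.aestronglyMeasurable,
    hf.norm_le.trans_lt ENNReal.ofReal_lt_top⟩
  have hL' : MemLp f' 2 := ⟨hf.measurable'.aestronglyMeasurable,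
    hf.norm_le'.trans_lt ENNReal.ofReal_lt_top⟩
  have hΩ : (0 : ℝ) ≤ Ω := Ω.2
  have hRle : R ≤ (2 + Ω) * R := by nlinarith
  have hm := measurable_graphonFilter hK.isKernel hf.measurable b
  have hm' := measurable_graphonFilter hK.isKernel' hf.measurable' b
  have hm'' := measurable_graphonFilter hK.isKernel' hf.measurable b
  refine ⟨hm, hm', ?_, ?_, ?_, fun v => ?_, fun v => ?_⟩
  · refine (eLpNorm_graphonFilter_le hK.isKernel hK.symm hL hb.1).trans ?_
    rw [ENNReal.ofReal_one, one_mul]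
    exact hf.norm_le.trans (ENNReal.ofReal_le_ofReal hRle)
  · refine (eLpNorm_graphonFilter_le hK.isKernel' hK.symm' hL' hb.1).trans ?_
    rw [ENNReal.ofReal_one, one_mul]
    exact hf.norm_le'.trans (ENNReal.ofReal_le_ofReal hRle)
  · have e1 := (hK.filter_sub_le b hb f hL).trans (mul_le_mul' le_rfl hf.norm_le)
    have e2 := (eLpNorm_graphonFilter_sub_graphonFilter_le hK.isKernel' hK.symm' hb.1 hL hL').trans
      hf.norm_sub_le
    have e3 := (eLpNorm_add_le (μ := volume) (p := 2) (hm.sub hm'').aestronglyMeasurable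
      (hm''.sub hm').aestronglyMeasurable one_le_two).trans (add_le_add e1 e2)
    rw [← ENNReal.ofReal_mul hκ, ← ENNReal.ofReal_add (by positivity) (by positivity)] at e3
    refine le_trans (le_of_eq ?_) (e3.trans (ENNReal.ofReal_le_ofReal ?_))
    · congr 1; funext v; simp
    · nlinarith [mul_nonneg hΩ (mul_nonneg hκ hR)]
  · refine (abs_graphonFilter_le hK.isKernel hK.symm hb hf.measurable hR hf.norm_le v).trans ?_
    nlinarith [hf.abs_le v, hw v, mul_nonneg hΩ hR, mul_nonneg (mul_nonneg hΩ hR)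
      (sub_nonneg.2 (hw v)), mul_nonneg hR (sub_nonneg.2 (hw v))]
  · refine (abs_graphonFilter_le hK.isKernel' hK.symm' hb hf.measurable' hR hf.norm_le' v).trans ?_
    nlinarith [hf.abs_le' v, hw' v, mul_nonneg hΩ hR, mul_nonneg (mul_nonneg hΩ hR)
      (sub_nonneg.2 (hw' v)), mul_nonneg hR (sub_nonneg.2 (hw' v))]

theorem CloseSignals.layerMap (hκ : 0 ≤ κ) (hw : ∀ v, 1 ≤ w v) (hw' : ∀ v, 1 ≤ w' v)
    (hR : 0 ≤ R) (hK : CloseKernels κ Ω K K') {m p q : ℕ} (hp : p ≤ m) {ρ : ℝ → ℝ}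
    (hρ : NormalizedLipschitz ρ) {B : Fin q → Fin p → ℝ[X]} (hB : ∀ f g, IsResponse Ω (B f g))
    {X X' : Fin p → I → ℝ} (hX : ∀ g, CloseSignals κ w w' R (X g) (X' g)) (f : Fin q) :
    CloseSignals κ w w' (m * (2 + Ω) * R) (layerMap ρ B K X f) (layerMap ρ B K' X' f) := by
  have hΩ : (0 : ℝ) ≤ Ω := Ω.2
  have h1 := CloseSignals.sum hκ (by positivity)
    fun g => (hX g).filter hκ hw hw' hR hK (hB f g)
  refine (h1.mono hκ hw hw' ?_).comp hρ
  have : (p : ℝ) ≤ m := by exact_mod_cast hp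
  rw [mul_assoc]
  exact mul_le_mul_of_nonneg_right this (by positivity)

theorem WNN.AllFilters.mono {F : ℕ} {P Q : ℝ[X] → Prop} (h : ∀ b, P b → Q b) {L p q : ℕ}
    {Φ : WNN F L p q} (hΦ : Φ.AllFilters P) : Φ.AllFilters Q := by
  induction Φ with
  | last ρ B => exact fun f g => h _ (hΦ f g)
  | layer ρ B rest ih => exact ⟨fun f g => h _ (hΦ.1 f g), ih hΦ.2⟩

theorem CloseSignals.eval (hκ : 0 ≤ κ) (hw : ∀ v, 1 ≤ w v) (hw' : ∀ v, 1 ≤ w' v)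
    (hK : CloseKernels κ Ω K K') {m F L p q : ℕ} (Φ : WNN F L p q)
    (hF : F ≤ m) (hp : p ≤ m) (hΦ : Φ.AllFilters (IsResponse Ω))
    (hΦ' : Φ.AllActivations NormalizedLipschitz) (hR : 0 ≤ R) {X X' : Fin p → I → ℝ}
    (hX : ∀ g, CloseSignals κ w w' R (X g) (X' g)) (f : Fin q) :
    CloseSignals κ w w' ((m * (2 + Ω)) ^ L * R) (Φ.eval K X f) (Φ.eval K' X' f) := by
  induction Φ generalizing R with
  | last ρ B =>
    rw [pow_one]
    exact CloseSignals.layerMap hκ hw hw' hR hK hp hΦ' hΦ hX f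
  | layer ρ B rest ih =>
    have hΩ : (0 : ℝ) ≤ Ω := Ω.2
    rw [pow_succ, mul_assoc]
    exact ih hF hΦ.2 hΦ'.2 (by positivity)
      (CloseSignals.layerMap hκ hw hw' hR hK hp hΦ'.1 hΦ.1 hX) f

/-- Growth of the size of the hidden states when every constituent network multiplies sizes
by `c`. -/
def hiddenRadius (c R : ℝ) : ℕ → ℝ
  | 0 => 0
  | t + 1 => c * R + c * hiddenRadius c R t

theorem hiddenRadius_nonneg {c R : ℝ} (hc : 0 ≤ c) (hR : 0 ≤ R) (t : ℕ) :
    0 ≤ hiddenRadius c R t := by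
  induction t with
  | zero => exact le_rfl
  | succ t ih => unfold hiddenRadius; positivity

/-- Size of the outputs of a recurrent network on inputs of size `R`. -/
def outputRadius (m L T : ℕ) (Ω : ℝ≥0) (R : ℝ) : ℝ :=
  (m * (2 + Ω)) ^ L * hiddenRadius ((m * (2 + Ω)) ^ L) R T

theorem outputRadius_nonneg {m L T : ℕ} (hR : 0 ≤ R) : 0 ≤ outputRadius m L T Ω R :=
  mul_nonneg (by positivity) (hiddenRadius_nonneg (by positivity) hR T)

/-- Each layer multiplies sizes by at most `m * (2 + Ω)`, where `m = p + F + h` dominates every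
number of input features. The resulting radius depends on the architecture and `Ω`, not on the
filters or activations. -/
theorem CloseSignals.output (hκ : 0 ≤ κ) (hw : ∀ v, 1 ≤ w v) (hw' : ∀ v, 1 ≤ w' v)
    {L F p h q : ℕ} {Ω₀ ω₀ : Fin 3 → ℝ≥0} {ε : ℝ} (hε : 0 < ε) (hΩ : ∀ i, Ω₀ i ≤ Ω)
    (hK : CloseKernels κ Ω K K') {Ψ : WRNN L F p h q}
    (hΨ : Ψ.Admissible Ω₀ ω₀ ε) (hR : 0 ≤ R) {X X' : Fin p → I → ℝ}
    (hX : ∀ g, CloseSignals κ w w' R (X g) (X' g)) (T : ℕ) (f : Fin q) :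
    CloseSignals κ w w' (outputRadius (p + F + h) L T Ω R)
      (Ψ.output T K X f) (Ψ.output T K' X' f) := by
  have h1 := hΨ.filters₁.mono fun b hb => hb.isResponse hε (hΩ 0)
  have h2 := hΨ.filters₂.mono fun b hb => hb.isResponse hε (hΩ 1)
  have h3 := hΨ.filters₃.mono fun b hb => hb.isResponse hε (hΩ 2)
  set c : ℝ := (((p + F + h : ℕ) : ℝ) * (2 + Ω)) ^ L with hc
  have hc0 : 0 ≤ c := by positivity
  have hhid : ∀ t g, CloseSignals κ w w' (hiddenRadius c R t)
      (Ψ.hidden K X t g) (Ψ.hidden K' X' t g) := by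
    intro t
    induction t with
    | zero => exact fun g => CloseSignals.zero
    | succ t ih =>
      have hr := hiddenRadius_nonneg hc0 hR t
      exact fun g => ((CloseSignals.eval hκ hw hw' hK Ψ.B₁ (by omega) (by omega) h1 hΨ.act₁ hR hX
        g).add hκ (by positivity) (by positivity) (CloseSignals.eval hκ hw hw' hK Ψ.B₂ (by omega)
          (by omega) h2 hΨ.act₂ hr ih g)).comp hΨ.rho₁
  exact (CloseSignals.eval hκ hw hw' hK Ψ.B₃ (by omega) (by omega) h3 hΨ.act₃
    (hiddenRadius_nonneg hc0 hR T) (hhid T) f).comp hΨ.rho₂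

end Stability

/-! ### Cells -/

/-- Measurability is needed jointly in the labels and the point, so that cell lengths are random
variables and integrals over labels and points can be exchanged. -/
theorem measurableSet_mem_cell {n : ℕ} (i : Fin n) :
    MeasurableSet {z : (Fin n → I) × I | z.2 ∈ cell z.1 i} := by
  have hu : ∀ j : Fin n, Measurable fun z : (Fin n → I) × I => z.1 j := fun j =>
    (measurable_pi_apply j).comp measurable_fst
  have hle : ∀ j, MeasurableSet {z : (Fin n → I) × I | z.1 j ≤ z.2} := fun j =>
    measurableSet_le (hu j) measurable_snd
  have hlex : ∀ j, MeasurableSet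
      {z : (Fin n → I) × I | toLex (z.1 j, j) ≤ toLex (z.1 i, i)} := fun j => by
    simp only [Prod.Lex.toLex_le_toLex]
    exact (measurableSet_lt (hu j) (hu i)).union
      ((measurableSet_eq_fun (hu j) (hu i)).inter (MeasurableSet.const _))
  refine MeasurableSet.union (MeasurableSet.inter (hle i) ?_) (MeasurableSet.inter ?_ ?_)
  · have : {z : (Fin n → I) × I | ∀ j, z.1 j ≤ z.2 → toLex (z.1 j, j) ≤ toLex (z.1 i, i)} =
        ⋂ j, ({z : (Fin n → I) × I | z.1 j ≤ z.2}ᶜ ∪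
          {z : (Fin n → I) × I | toLex (z.1 j, j) ≤ toLex (z.1 i, i)}) := by
      ext z; simp [imp_iff_not_or]
    exact (congrArg MeasurableSet this).mpr <|
      MeasurableSet.iInter fun j => (hle j).compl.union (hlex j)
  · have : {z : (Fin n → I) × I | ∀ j, z.2 < z.1 j} =
        ⋂ j, {z : (Fin n → I) × I | z.2 < z.1 j} := by ext z; simp
    exact (congrArg MeasurableSet this).mpr <| MeasurableSet.iInter fun j => measurableSet_lt measurable_snd (hu j)
  · have : {z : (Fin n → I) × I | ∀ j, toLex (z.1 j, j) ≤ toLex (z.1 i, i)} =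
        ⋂ j, {z : (Fin n → I) × I | toLex (z.1 j, j) ≤ toLex (z.1 i, i)} := by ext z; simp
    exact (congrArg MeasurableSet this).mpr <| MeasurableSet.iInter hlex

theorem measurableSet_cell {n : ℕ} (u : Fin n → I) (i : Fin n) : MeasurableSet (cell u i) :=
  (measurableSet_mem_cell i).preimage (measurable_const.prodMk measurable_id)

/-! ### The action kernel is a bilinear form in the features -/

theorem integrable_cell_indicator {n : ℕ} (u : Fin n → I) (i : Fin n) :
    Integrable ((cell u i).indicator (1 : I → ℝ)) :=
  (integrable_const (1 : ℝ)).indicator (measurableSet_cell u i)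

theorem measurable_inducedKernel {n : ℕ} (u : Fin n → I) (M : Fin n → Fin n → ℝ) :
    Measurable (Function.uncurry (inducedKernel u M)) := by
  change Measurable fun z : I × I => ∑ i, ∑ j,
    M i j * (cell u i).indicator 1 z.1 * (cell u j).indicator 1 z.2
  refine Finset.measurable_sum _ fun i _ => Finset.measurable_sum _ fun j _ => ?_
  have hm : ∀ i, Measurable ((cell u i).indicator (1 : I → ℝ)) := fun i =>
    measurable_one.indicator (measurableSet_cell u i)
  exact (((hm i).comp measurable_fst).const_mul _).mul ((hm j).comp measurable_snd)

theorem abs_inducedKernel_le {n : ℕ} (u : Fin n → I) (M : Fin n → Fin n → ℝ) (s t : I) :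
    |inducedKernel u M s t| ≤ ∑ i, ∑ j, |M i j| := by
  refine (Finset.abs_sum_le_sum_abs _ _).trans (Finset.sum_le_sum fun i _ =>
    (Finset.abs_sum_le_sum_abs _ _).trans (Finset.sum_le_sum fun j _ => ?_))
  have hi : ∀ (i : Fin n) (x : I), |(cell u i).indicator (1 : I → ℝ) x| ≤ 1 := fun i x => by
    by_cases h : x ∈ cell u i <;> simp [h]
  rw [abs_mul, abs_mul, mul_assoc]
  exact mul_le_of_le_one_right (abs_nonneg _)
    (mul_le_one₀ (hi i s) (abs_nonneg _) (hi j t))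

theorem integrable_inducedKernel_mul {n : ℕ} (u : Fin n → I) (M : Fin n → Fin n → ℝ) (x : I)
    {f : I → ℝ} (hf : Integrable f) : Integrable fun y => inducedKernel u M y x * f y :=
  hf.bdd_mul (c := ∑ i, ∑ j, |M i j|)
    ((measurable_inducedKernel u M).comp
      (measurable_id.prodMk measurable_const)).aestronglyMeasurable
    (Filter.Eventually.of_forall fun y => abs_inducedKernel_le u M y x)

/-- The matrix of the bilinear form `actionKernel Δ`. -/
def actionMatrix {q : ℕ} (Δ : Matrix (Fin q) (Fin q) ℝ) (i j : Fin q) : ℝ :=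
  ∫ x, (cell (featureLabel q) i).indicator (1 : I → ℝ) x *
    diffusion (featureKernel Δ) ((cell (featureLabel q) j).indicator 1) x

/-- The feature functions are finite combinations of cell indicators, so the inner product expands.
Later estimates use only that the coefficients depend on `Δ` alone. -/
theorem actionKernel_eq_sum {q : ℕ} (Δ : Matrix (Fin q) (Fin q) ℝ) (Y₁ Y₂ : Fin q → I → ℝ)
    (z : I × I) : actionKernel Δ Y₁ Y₂ z =
      ∑ i, ∑ j, actionMatrix Δ i j * (Y₁ i z.1 * Y₂ j z.2) := by
  have hdiff : ∀ x, diffusion (featureKernel Δ)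
      (inducedSignal (featureLabel q) fun f => Y₂ f z.2) x = ∑ j, Y₂ j z.2 *
        diffusion (featureKernel Δ) ((cell (featureLabel q) j).indicator 1) x := by
    intro x
    simp only [diffusion, inducedSignal, ← integral_const_mul, Finset.mul_sum]
    rw [integral_finsetSum]
    · refine Finset.sum_congr rfl fun j _ => integral_congr_ae
        (Filter.Eventually.of_forall fun y => ?_)
      simp only; ring
    · intro j _
      exact integrable_inducedKernel_mul _ _ x ((integrable_cell_indicator _ j).const_mul _)
  have hmeas : ∀ j, Measurable (diffusion (featureKernel Δ)
      ((cell (featureLabel q) j).indicator 1)) := fun j =>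
    (StronglyMeasurable.integral_prod_left (f := fun y x => featureKernel Δ y x *
      (cell (featureLabel q) j).indicator 1 y) ((measurable_inducedKernel _ _).mul
      ((measurable_one.indicator (measurableSet_cell _ j)).comp
        measurable_fst)).stronglyMeasurable).measurable
  have hint : ∀ i j, Integrable fun x => (cell (featureLabel q) i).indicator (1 : I → ℝ) x *
      diffusion (featureKernel Δ) ((cell (featureLabel q) j).indicator 1) x := by
    intro i j
    refine (integrable_cell_indicator _ i).mul_bdd (c := ∑ i, ∑ j, |Δ i j|)
      (hmeas j).aestronglyMeasurable (Filter.Eventually.of_forall fun x => ?_)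
    refine (norm_integral_le_of_norm_le_const (C := ∑ i, ∑ j, |Δ i j|)
      (Filter.Eventually.of_forall fun y => ?_)).trans (by simp)
    rw [norm_mul]
    refine (mul_le_of_le_one_right (norm_nonneg _) ?_).trans (abs_inducedKernel_le _ _ y x)
    by_cases h : y ∈ cell (featureLabel q) j <;> simp [h]
  simp only [actionKernel, hdiff, inducedSignal, Finset.sum_mul, Finset.mul_sum]
  have e : ∀ (i j : Fin q) (x : I), Y₁ i z.1 * (cell (featureLabel q) i).indicator 1 x *
      (Y₂ j z.2 * diffusion (featureKernel Δ) ((cell (featureLabel q) j).indicator 1) x) =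
      (Y₁ i z.1 * Y₂ j z.2) * ((cell (featureLabel q) i).indicator (1 : I → ℝ) x *
      diffusion (featureKernel Δ) ((cell (featureLabel q) j).indicator 1) x) := by
    intro i j x; ring
  simp only [e]
  rw [Finset.sum_comm, integral_finsetSum]
  · refine Finset.sum_congr rfl fun j _ => ?_
    rw [integral_finsetSum]
    · refine Finset.sum_congr rfl fun i _ => ?_
      rw [integral_const_mul, mul_comm]; rfl
    · exact fun i _ => (hint i j).const_mul _
  · exact fun j _ => integrable_finsetSum _ fun i _ => (hint i j).const_mul _

/-! ### Stability of the softmax -/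

theorem abs_exp_sub_exp_le (x y : ℝ) :
    |Real.exp x - Real.exp y| ≤ |x - y| * (Real.exp x + Real.exp y) := by
  have key : ∀ x y : ℝ, y ≤ x → |Real.exp x - Real.exp y| ≤ |x - y| * (Real.exp x + Real.exp y) := by
    intro x y h
    have h1 := Real.add_one_le_exp (y - x)
    have h2 : Real.exp y = Real.exp x * Real.exp (y - x) := by rw [← Real.exp_add]; congr 1; ring
    have h3 := Real.exp_pos x
    have h4 := Real.exp_pos y
    rw [abs_of_nonneg (sub_nonneg.2 (Real.exp_le_exp.2 h)), abs_of_nonneg (sub_nonneg.2 h)]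
    nlinarith [mul_nonneg (sub_nonneg.2 h) h4.le]
  rcases le_total y x with h | h
  · exact key x y h
  · rw [abs_sub_comm, abs_sub_comm x, add_comm]; exact key y x h

/-- One factor of the square takes the Lipschitz bound, the other the trivial bound. Keeping only
the first power of `|x - y|` means that Cauchy–Schwarz needs `x - y` in `L²` and not in `L⁴`. -/
theorem sq_abs_exp_sub_exp_le (x y : ℝ) :
    |Real.exp x - Real.exp y| ^ 2 ≤ |x - y| * (Real.exp x + Real.exp y) ^ 2 := by
  have h1 := abs_exp_sub_exp_le x y
  have h2 : |Real.exp x - Real.exp y| ≤ Real.exp x + Real.exp y :=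
    abs_le.2 ⟨by linarith [Real.exp_pos x, Real.exp_pos y],
      by linarith [Real.exp_pos x, Real.exp_pos y]⟩
  calc _ = |Real.exp x - Real.exp y| * |Real.exp x - Real.exp y| := sq _
    _ ≤ (|x - y| * (Real.exp x + Real.exp y)) * (Real.exp x + Real.exp y) :=
        mul_le_mul h1 h2 (abs_nonneg _) (by positivity)
    _ = _ := by ring

section Softmax

variable {χ χ' : I × I → ℝ} {E d : ℝ}

theorem integrable_exp_mul_of_lintegral_le (hχ : Measurable χ)
    (hE : ∫⁻ z, ENNReal.ofReal (Real.exp (4 * |χ z|)) ≤ ENNReal.ofReal E) {a : ℝ}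
    (ha : |a| ≤ 4) : Integrable fun z => Real.exp (a * χ z) := by
  have hi : Integrable fun z => Real.exp (4 * |χ z|) :=
    ⟨by fun_prop, by
      rw [hasFiniteIntegral_iff_ofReal (Filter.Eventually.of_forall fun z => by positivity)]
      exact hE.trans_lt ENNReal.ofReal_lt_top⟩
  refine hi.mono' (by fun_prop) (Filter.Eventually.of_forall fun z => ?_)
  rw [Real.norm_eq_abs, Real.abs_exp, Real.exp_le_exp]
  refine (le_abs_self _).trans ?_
  rw [abs_mul]
  exact mul_le_mul_of_nonneg_right ha (abs_nonneg _)

theorem integral_exp_mul_le (hχ : Measurable χ)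
    (hE : ∫⁻ z, ENNReal.ofReal (Real.exp (4 * |χ z|)) ≤ ENNReal.ofReal E) (hE1 : 1 ≤ E) {a : ℝ}
    (ha : |a| ≤ 4) : ∫ z, Real.exp (a * χ z) ≤ E := by
  refine (ENNReal.ofReal_le_ofReal_iff (by linarith)).1 (le_trans ?_ hE)
  rw [ofReal_integral_eq_lintegral_ofReal (integrable_exp_mul_of_lintegral_le hχ hE ha)
    (Filter.Eventually.of_forall fun z => by positivity)]
  refine lintegral_mono fun z => ENNReal.ofReal_le_ofReal (Real.exp_le_exp.2 ?_)
  refine (le_abs_self _).trans ?_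
  rw [abs_mul]
  exact mul_le_mul_of_nonneg_right ha (abs_nonneg _)

/-- Integrating `2 ≤ E e^χ + E⁻¹ e^{-χ}` and using that `e^{-χ}` has integral at most `E` leaves at
least 1 for the first term. This keeps the softmax denominator away from zero. -/
theorem one_le_mul_integral_exp (hχ : Measurable χ)
    (hE : ∫⁻ z, ENNReal.ofReal (Real.exp (4 * |χ z|)) ≤ ENNReal.ofReal E) (hE1 : 1 ≤ E) :
    1 ≤ E * ∫ z, Real.exp (χ z) := by
  have i1 : Integrable fun z => Real.exp (χ z) := by
    simpa using integrable_exp_mul_of_lintegral_le hχ hE (a := 1) (by norm_num)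
  have i2 : Integrable fun z => Real.exp (-χ z) := by
    simpa using integrable_exp_mul_of_lintegral_le hχ hE (a := -1) (by norm_num)
  have h2 : ∫ z, Real.exp (-χ z) ≤ E := by
    simpa using integral_exp_mul_le hχ hE hE1 (a := -1) (by norm_num)
  have hE0 : 0 < E := by linarith
  have hpt : ∀ z, (2 : ℝ) ≤ E * Real.exp (χ z) + E⁻¹ * Real.exp (-χ z) := fun z => by
    rw [Real.exp_neg, ← mul_inv]
    have hx : 0 < E * Real.exp (χ z) := by positivity
    generalize E * Real.exp (χ z) = x at hx
    have : x + x⁻¹ - 2 = (x - 1) ^ 2 / x := by field_simp; ring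
    have h3 : 0 ≤ (x - 1) ^ 2 / x := by positivity
    linarith
  have h3 := integral_mono (integrable_const (2 : ℝ)) ((i1.const_mul E).add (i2.const_mul E⁻¹)) hpt
  simp only [Pi.add_apply] at h3
  rw [integral_add (i1.const_mul E) (i2.const_mul E⁻¹), integral_const_mul,
    integral_const_mul] at h3
  have h4 : E⁻¹ * ∫ z, Real.exp (-χ z) ≤ 1 := by
    rw [inv_mul_le_iff₀ hE0]; simpa using h2
  simp at h3
  linarith

theorem eLpNorm_exp_sub_exp_le (hχ : Measurable χ) (hχ' : Measurable χ')
    (hE : ∫⁻ z, ENNReal.ofReal (Real.exp (4 * |χ z|)) ≤ ENNReal.ofReal E)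
    (hE' : ∫⁻ z, ENNReal.ofReal (Real.exp (4 * |χ' z|)) ≤ ENNReal.ofReal E) (hE1 : 1 ≤ E)
    (hd0 : 0 ≤ d) (hd : eLpNorm (fun z => χ z - χ' z) 2 volume ≤ ENNReal.ofReal d) :
    eLpNorm (fun z => Real.exp (χ z) - Real.exp (χ' z)) 2 volume ≤
      ENNReal.ofReal (Real.sqrt (4 * E * d)) := by
  -- Convexity of the fourth power; with the two moment bounds it gives `16 E`, and Cauchy–Schwarz
  -- then gives `√(16 E) d ≤ 4 E d` for the squared norm.
  have h4 : ∀ x y : ℝ, ((Real.exp x + Real.exp y) ^ 2) ^ 2 ≤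
      8 * (Real.exp (4 * |x|) + Real.exp (4 * |y|)) := by
    intro x y
    have e : ∀ x : ℝ, Real.exp x ^ 4 ≤ Real.exp (4 * |x|) := fun x => by
      rw [← Real.exp_nat_mul, Real.exp_le_exp]; push_cast; nlinarith [le_abs_self x]
    nlinarith [e x, e y, sq_nonneg (Real.exp x - Real.exp y),
      sq_nonneg (Real.exp x ^ 2 - Real.exp y ^ 2), Real.exp_pos x, Real.exp_pos y,
      mul_pos (Real.exp_pos x) (Real.exp_pos y), sq_nonneg (Real.exp x + Real.exp y),
      mul_nonneg (sq_nonneg (Real.exp x - Real.exp y)) (sq_nonneg (Real.exp x + Real.exp y)),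
      sq_nonneg ((Real.exp x - Real.exp y) ^ 2)]
  have hq : ∫⁻ z, ENNReal.ofReal ((Real.exp (χ z) + Real.exp (χ' z)) ^ 2) ^ 2 ≤
      ENNReal.ofReal (16 * E) := by
    calc _ ≤ ∫⁻ z, (ENNReal.ofReal 8 * ENNReal.ofReal (Real.exp (4 * |χ z|)) +
          ENNReal.ofReal 8 * ENNReal.ofReal (Real.exp (4 * |χ' z|))) := by
          refine lintegral_mono fun z => ?_
          simp only
          rw [← ENNReal.ofReal_mul (by norm_num), ← ENNReal.ofReal_mul (by norm_num),
            ← ENNReal.ofReal_add (by positivity) (by positivity),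
            ← ENNReal.ofReal_pow (by positivity), ← mul_add]
          exact ENNReal.ofReal_le_ofReal (h4 _ _)
      _ ≤ ENNReal.ofReal 8 * ENNReal.ofReal E + ENNReal.ofReal 8 * ENNReal.ofReal E := by
          rw [lintegral_add_left (by fun_prop), lintegral_const_mul _ (by fun_prop),
            lintegral_const_mul _ (by fun_prop)]
          gcongr
      _ = _ := by
          rw [← ENNReal.ofReal_mul (by norm_num), ← ENNReal.ofReal_add (by positivity)
            (by positivity)]
          congr 1; ring
  have h1 : eLpNorm (fun z => Real.exp (χ z) - Real.exp (χ' z)) 2 volume ^ 2 ≤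
      ∫⁻ z, ‖χ z - χ' z‖ₑ * ENNReal.ofReal ((Real.exp (χ z) + Real.exp (χ' z)) ^ 2) := by
    rw [eLpNorm_two_sq]
    refine lintegral_mono fun z => ?_
    rw [← ofReal_norm, ← ofReal_norm, ← ENNReal.ofReal_mul (norm_nonneg _),
      ← ENNReal.ofReal_pow (norm_nonneg _)]
    exact ENNReal.ofReal_le_ofReal (sq_abs_exp_sub_exp_le _ _)
  have h2 := sq_lintegral_mul_le (μ := (volume : Measure (I × I)))
    (f := fun z => ‖χ z - χ' z‖ₑ)
    (g := fun z => ENNReal.ofReal ((Real.exp (χ z) + Real.exp (χ' z)) ^ 2))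
    (by fun_prop) (by fun_prop)
  rw [← eLpNorm_two_sq (fun z => χ z - χ' z)] at h2
  have h3 := (pow_le_pow_left' h1 2).trans (h2.trans (mul_le_mul' (pow_le_pow_left' hd 2) hq))
  rw [← ENNReal.pow_le_pow_left_iff two_ne_zero, ← ENNReal.pow_le_pow_left_iff two_ne_zero]
  refine h3.trans ?_
  rw [← ENNReal.ofReal_pow hd0, ← ENNReal.ofReal_mul (by positivity),
    ← ENNReal.ofReal_pow (by positivity), Real.sq_sqrt (by positivity),
    ← ENNReal.ofReal_pow (by positivity)]
  refine ENNReal.ofReal_le_ofReal ?_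
  nlinarith [mul_nonneg (sq_nonneg d) (by nlinarith : (0 : ℝ) ≤ E ^ 2 - E)]

theorem eLpNorm_softmax_sub_le (hχ : Measurable χ) (hχ' : Measurable χ')
    (hE : ∫⁻ z, ENNReal.ofReal (Real.exp (4 * |χ z|)) ≤ ENNReal.ofReal E)
    (hE' : ∫⁻ z, ENNReal.ofReal (Real.exp (4 * |χ' z|)) ≤ ENNReal.ofReal E) (hE1 : 1 ≤ E)
    (hd0 : 0 ≤ d) (hd : eLpNorm (fun z => χ z - χ' z) 2 volume ≤ ENNReal.ofReal d) :
    eLpNorm (fun z => softmax χ z - softmax χ' z) 2 volume ≤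
      ENNReal.ofReal (2 * E ^ 3 * Real.sqrt (4 * E * d)) := by
  have hD := eLpNorm_exp_sub_exp_le hχ hχ' hE hE' hE1 hd0 hd
  set D := Real.sqrt (4 * E * d)
  have hD0 : 0 ≤ D := Real.sqrt_nonneg _
  have i1 : Integrable fun z => Real.exp (χ z) := by
    simpa using integrable_exp_mul_of_lintegral_le hχ hE (a := 1) (by norm_num)
  have i2 : Integrable fun z => Real.exp (χ' z) := by
    simpa using integrable_exp_mul_of_lintegral_le hχ' hE' (a := 1) (by norm_num)
  have z1 := one_le_mul_integral_exp hχ hE hE1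
  have z2 := one_le_mul_integral_exp hχ' hE' hE1
  set Z := ∫ z, Real.exp (χ z) with hZ
  set Z' := ∫ z, Real.exp (χ' z) with hZ'
  have hE0 : 0 < E := by linarith
  have hZ0 : 0 < Z := pos_of_mul_pos_right (by linarith) hE0.le
  have hZ0' : 0 < Z' := pos_of_mul_pos_right (by linarith) hE0.le
  have hZi : Z⁻¹ ≤ E := by rw [inv_le_iff_one_le_mul₀ hZ0]; linarith
  have hZi' : Z'⁻¹ ≤ E := by rw [inv_le_iff_one_le_mul₀ hZ0']; linarith
  have hZZ : |Z' - Z| ≤ D := by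
    have h1 := (enorm_integral_le_lintegral_enorm (μ := volume)
      fun z => Real.exp (χ z) - Real.exp (χ' z)).trans_eq eLpNorm_one_eq_lintegral_enorm.symm
    have h2 := h1.trans ((eLpNorm_le_eLpNorm_of_exponent_le one_le_two (by fun_prop)).trans hD)
    rw [integral_sub i1 i2, ← ofReal_norm] at h2
    rw [abs_sub_comm]
    exact (ENNReal.ofReal_le_ofReal_iff hD0).1 h2
  have hn' : eLpNorm (fun z => Real.exp (χ' z)) 2 volume ≤ ENNReal.ofReal E := by
    rw [← ENNReal.pow_le_pow_left_iff two_ne_zero, eLpNorm_two_sq]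
    have h1 := integral_exp_mul_le hχ' hE' hE1 (a := 2) (by norm_num)
    have h2 := ENNReal.ofReal_le_ofReal h1
    rw [ofReal_integral_eq_lintegral_ofReal (integrable_exp_mul_of_lintegral_le hχ' hE'
      (by norm_num)) (Filter.Eventually.of_forall fun z => by positivity)] at h2
    refine le_trans (le_of_eq (lintegral_congr fun z => ?_)) (h2.trans ?_)
    · rw [← ofReal_norm, ← ENNReal.ofReal_pow (norm_nonneg _), Real.norm_eq_abs, Real.abs_exp,
        ← Real.exp_nat_mul]
      norm_num
    · rw [← ENNReal.ofReal_pow hE0.le]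
      exact ENNReal.ofReal_le_ofReal (by nlinarith)
  -- The numerator and the denominator are changed separately. The inverses of `Z` and `Z'` are at
  -- most `E`, so the terms cost `E D` and `E³ D`, together at most `2 E³ D`.
  have e : (fun z => softmax χ z - softmax χ' z) =
      (Z⁻¹ • fun z => Real.exp (χ z) - Real.exp (χ' z)) +
        ((Z⁻¹ * Z'⁻¹ * (Z' - Z)) • fun z => Real.exp (χ' z)) := by
    funext z
    simp only [softmax, ← hZ, ← hZ', Pi.add_apply, Pi.smul_apply, smul_eq_mul]
    field_simp
    ring
  rw [e]
  refine (eLpNorm_add_le (by fun_prop) (by fun_prop) one_le_two).trans ?_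
  rw [eLpNorm_const_smul, eLpNorm_const_smul, ← ofReal_norm, ← ofReal_norm]
  refine (add_le_add (mul_le_mul' (ENNReal.ofReal_le_ofReal (q := E) ?_) hD)
    (mul_le_mul' (ENNReal.ofReal_le_ofReal (q := E * E * D) ?_) hn')).trans ?_
  · rw [Real.norm_of_nonneg (by positivity)]; exact hZi
  · rw [norm_mul, norm_mul, Real.norm_of_nonneg (by positivity),
      Real.norm_of_nonneg (inv_nonneg.2 hZ0'.le)]
    exact mul_le_mul (mul_le_mul hZi hZi' (by positivity) hE0.le) hZZ (norm_nonneg _)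
      (by positivity)
  · rw [← ENNReal.ofReal_mul hE0.le, ← ENNReal.ofReal_mul (by positivity),
      ← ENNReal.ofReal_add (by positivity) (by positivity)]
    refine ENNReal.ofReal_le_ofReal ?_
    have : E ≤ E ^ 3 := by nlinarith [mul_nonneg hE0.le (by nlinarith : (0 : ℝ) ≤ E ^ 2 - 1)]
    nlinarith

end Softmax

theorem eLpNorm_two_mul_prod {f g : I → ℝ} (hf : Measurable f) (hg : Measurable g) :
    eLpNorm (fun z : I × I => f z.1 * g z.2) 2 volume =
      eLpNorm f 2 volume * eLpNorm g 2 volume := by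
  have h : ∀ {a b : ℝ≥0∞}, a ^ 2 = b ^ 2 → a = b := fun h =>
    le_antisymm ((ENNReal.pow_le_pow_left_iff two_ne_zero).1 h.le)
      ((ENNReal.pow_le_pow_left_iff two_ne_zero).1 h.ge)
  apply h
  rw [mul_pow, eLpNorm_two_sq, eLpNorm_two_sq,
    eLpNorm_two_sq, Measure.volume_eq_prod, ← lintegral_prod_mul
      (hf.enorm.pow_const 2).aemeasurable (hg.enorm.pow_const 2).aemeasurable]
  simp only [enorm_mul, mul_pow]

/-! ### Size, distance and exponential moments of the action kernel. -/

section Chi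

variable {q : ℕ} {Δ : Matrix (Fin q) (Fin q) ℝ} {κ R : ℝ} {w₁ w₁' w₂ w₂' : I → ℝ}
  {Y₁ Y₁' Y₂ Y₂' : Fin q → I → ℝ}

theorem measurable_actionKernel (h₁ : ∀ f, Measurable (Y₁ f)) (h₂ : ∀ f, Measurable (Y₂ f)) :
    Measurable (actionKernel Δ Y₁ Y₂) := by
  have : actionKernel Δ Y₁ Y₂ = fun z => ∑ i, ∑ j, actionMatrix Δ i j * (Y₁ i z.1 * Y₂ j z.2) :=
    funext fun z => actionKernel_eq_sum Δ Y₁ Y₂ z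
  rw [this]
  exact Finset.measurable_sum _ fun i _ => Finset.measurable_sum _ fun j _ =>
    (((h₁ i).comp measurable_fst).mul ((h₂ j).comp measurable_snd)).const_mul _

theorem abs_actionKernel_le (hR : 0 ≤ R) (hw₁ : ∀ v, 1 ≤ w₁ v)
    (h₁ : ∀ f v, |Y₁ f v| ≤ R * w₁ v) (h₂ : ∀ f v, |Y₂ f v| ≤ R * w₂ v) (z : I × I) :
    |actionKernel Δ Y₁ Y₂ z| ≤
      (∑ i, ∑ j, |actionMatrix Δ i j|) * R ^ 2 * (w₁ z.1 * w₂ z.2) := by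
  rw [actionKernel_eq_sum, Finset.sum_mul, Finset.sum_mul]
  refine (Finset.abs_sum_le_sum_abs _ _).trans (Finset.sum_le_sum fun i _ => ?_)
  rw [Finset.sum_mul, Finset.sum_mul]
  refine (Finset.abs_sum_le_sum_abs _ _).trans (Finset.sum_le_sum fun j _ => ?_)
  rw [abs_mul, abs_mul, mul_assoc]
  refine mul_le_mul_of_nonneg_left ?_ (abs_nonneg _)
  calc _ ≤ (R * w₁ z.1) * (R * w₂ z.2) :=
        mul_le_mul (h₁ i z.1) (h₂ j z.2) (abs_nonneg _)
          (mul_nonneg hR (by linarith [hw₁ z.1]))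
    _ = _ := by ring

theorem eLpNorm_actionKernel_sub_le (hκ : 0 ≤ κ) (hR : 0 ≤ R)
    (h₁ : ∀ f, CloseSignals κ w₁ w₁' R (Y₁ f) (Y₁' f))
    (h₂ : ∀ f, CloseSignals κ w₂ w₂' R (Y₂ f) (Y₂' f)) :
    eLpNorm (fun z => actionKernel Δ Y₁ Y₂ z - actionKernel Δ Y₁' Y₂' z) 2 volume ≤
      ENNReal.ofReal ((∑ i, ∑ j, |actionMatrix Δ i j|) * (2 * κ * R ^ 2)) := by
  have hterm : ∀ i j, eLpNorm (fun z : I × I => Y₁ i z.1 * Y₂ j z.2 - Y₁' i z.1 * Y₂' j z.2) 2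
      volume ≤ ENNReal.ofReal (2 * κ * R ^ 2) := by
    intro i j
    have m1 := (h₁ i).measurable
    have m1' := (h₁ i).measurable'
    have m2 := (h₂ j).measurable
    have m2' := (h₂ j).measurable'
    have e : (fun z : I × I => Y₁ i z.1 * Y₂ j z.2 - Y₁' i z.1 * Y₂' j z.2) =
        (fun z : I × I => (Y₁ i z.1 - Y₁' i z.1) * Y₂ j z.2) +
          fun z : I × I => Y₁' i z.1 * (Y₂ j z.2 - Y₂' j z.2) := by
      funext z; simp only [Pi.add_apply]; ring
    rw [e]
    refine (eLpNorm_add_le (by fun_prop) (by fun_prop) one_le_two).trans ?_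
    rw [eLpNorm_two_mul_prod (f := fun v => Y₁ i v - Y₁' i v) (m1.sub m1') m2,
      eLpNorm_two_mul_prod (g := fun v => Y₂ j v - Y₂' j v) m1' (m2.sub m2')]
    refine (add_le_add (mul_le_mul' (h₁ i).norm_sub_le (h₂ j).norm_le)
      (mul_le_mul' (h₁ i).norm_le' (h₂ j).norm_sub_le)).trans ?_
    rw [← ENNReal.ofReal_mul (by positivity), ← ENNReal.ofReal_mul (by positivity),
      ← ENNReal.ofReal_add (by positivity) (by positivity)]
    exact ENNReal.ofReal_le_ofReal (by linarith)
  have e : (fun z => actionKernel Δ Y₁ Y₂ z - actionKernel Δ Y₁' Y₂' z) =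
      ∑ i, ∑ j, actionMatrix Δ i j • fun z : I × I =>
        Y₁ i z.1 * Y₂ j z.2 - Y₁' i z.1 * Y₂' j z.2 := by
    funext z
    simp only [actionKernel_eq_sum, Finset.sum_apply, Pi.smul_apply, smul_eq_mul, mul_sub,
      Finset.sum_sub_distrib]
  have hm : ∀ i j, Measurable fun z : I × I =>
      Y₁ i z.1 * Y₂ j z.2 - Y₁' i z.1 * Y₂' j z.2 := fun i j => by
    have m1 := (h₁ i).measurable
    have m1' := (h₁ i).measurable'
    have m2 := (h₂ j).measurable
    have m2' := (h₂ j).measurable'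
    fun_prop
  rw [e, Finset.sum_mul, ENNReal.ofReal_sum_of_nonneg fun i _ => by positivity]
  refine (eLpNorm_sum_le (fun i _ => ?_) one_le_two).trans (Finset.sum_le_sum fun i _ => ?_)
  · exact Finset.aestronglyMeasurable_sum _ fun j _ =>
      ((hm i j).const_smul _).aestronglyMeasurable
  rw [Finset.sum_mul, ENNReal.ofReal_sum_of_nonneg fun i _ => by positivity]
  refine (eLpNorm_sum_le (fun j _ => ((hm i j).const_smul _).aestronglyMeasurable)
    one_le_two).trans (Finset.sum_le_sum fun j _ => ?_)
  rw [eLpNorm_const_smul, ENNReal.ofReal_mul (abs_nonneg _), ← ofReal_norm, Real.norm_eq_abs]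
  exact mul_le_mul' le_rfl (hterm i j)

/-- From `4 w₁ w₂ ≤ 2 (w₁² + w₂²)` the exponential factors into functions of separate variables.
This is where the hypothesis on exponentials of squared signals comes from. -/
theorem lintegral_exp_actionKernel_le (hR : 0 ≤ R) (hw₁ : ∀ v, 1 ≤ w₁ v)
    (hm₁ : Measurable w₁) (hm₂ : Measurable w₂)
    (h₁ : ∀ f v, |Y₁ f v| ≤ R * w₁ v) (h₂ : ∀ f v, |Y₂ f v| ≤ R * w₂ v) {a B : ℝ} (hB : 0 ≤ B)
    (ha : 2 * ((∑ i, ∑ j, |actionMatrix Δ i j|) * R ^ 2) ≤ a)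
    (hB₁ : ∫⁻ v, ENNReal.ofReal (Real.exp (a * w₁ v ^ 2)) ≤ ENNReal.ofReal B)
    (hB₂ : ∫⁻ v, ENNReal.ofReal (Real.exp (a * w₂ v ^ 2)) ≤ ENNReal.ofReal B) :
    ∫⁻ z, ENNReal.ofReal (Real.exp (4 * |actionKernel Δ Y₁ Y₂ z|)) ≤ ENNReal.ofReal (B ^ 2) := by
  calc _ ≤ ∫⁻ z : I × I, ENNReal.ofReal (Real.exp (a * w₁ z.1 ^ 2)) *
        ENNReal.ofReal (Real.exp (a * w₂ z.2 ^ 2)) := by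
        refine lintegral_mono fun z => ?_
        simp only
        rw [← ENNReal.ofReal_mul (by positivity), ← Real.exp_add]
        refine ENNReal.ofReal_le_ofReal (Real.exp_le_exp.2 ?_)
        have h3 := abs_actionKernel_le (Δ := Δ) hR hw₁ h₁ h₂ z
        set M := (∑ i, ∑ j, |actionMatrix Δ i j|) * R ^ 2
        have hM : 0 ≤ M := by positivity
        nlinarith [mul_nonneg hM (sq_nonneg (w₁ z.1 - w₂ z.2)),
          mul_nonneg (sub_nonneg.2 ha) (add_nonneg (sq_nonneg (w₁ z.1)) (sq_nonneg (w₂ z.2)))]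
    _ = (∫⁻ v, ENNReal.ofReal (Real.exp (a * w₁ v ^ 2))) *
        ∫⁻ v, ENNReal.ofReal (Real.exp (a * w₂ v ^ 2)) := by
        rw [Measure.volume_eq_prod]
        exact lintegral_prod_mul (f := fun v => ENNReal.ofReal (Real.exp (a * w₁ v ^ 2)))
          (g := fun v => ENNReal.ofReal (Real.exp (a * w₂ v ^ 2))) (by fun_prop) (by fun_prop)
    _ ≤ _ := by
        rw [sq, ENNReal.ofReal_mul hB]
        exact mul_le_mul' hB₁ hB₂

end Chi

/-! ### Exponential moments of the envelope. -/

section Envelope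

variable {p : ℕ}

/-- The pointwise envelope of a signal. -/
def envelope (X : Fin p → I → ℝ) (v : I) : ℝ := 1 + ∑ g, |X g v|

theorem one_le_envelope (X : Fin p → I → ℝ) (v : I) : 1 ≤ envelope X v := by
  have : 0 ≤ ∑ g, |X g v| := Finset.sum_nonneg fun _ _ => abs_nonneg _
  unfold envelope; linarith

theorem abs_le_envelope (X : Fin p → I → ℝ) (g : Fin p) (v : I) : |X g v| ≤ envelope X v := by
  have := Finset.single_le_sum (f := fun g => |X g v|) (fun _ _ => abs_nonneg _)
    (Finset.mem_univ g)
  beta_reduce at this; unfold envelope; linarith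

theorem measurable_envelope {X : Fin p → I → ℝ} (hX : ∀ g, Measurable (X g)) :
    Measurable (envelope X) :=
  measurable_const.add (Finset.measurable_sum _ fun g _ => (hX g).abs)

/-- Either all features are at most 1 and the envelope is at most `p + 1`, or the largest feature
exceeds 1 and the envelope is at most `p + 1` times it. -/
theorem exp_envelope_le {X : Fin p → I → ℝ} {a : ℝ} (ha : 0 ≤ a) (v : I) :
    Real.exp (a * envelope X v ^ 2) ≤ Real.exp (a * (p + 1) ^ 2) +
      ∑ g, Real.exp (a * (p + 1) ^ 2 * X g v ^ 2) := by
  have hs : 0 ≤ ∑ g, Real.exp (a * (p + 1) ^ 2 * X g v ^ 2) :=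
    Finset.sum_nonneg fun _ _ => by positivity
  by_cases h : ∀ g, |X g v| ≤ 1
  · have h1 : envelope X v ≤ p + 1 := by
      have := Finset.sum_le_sum fun g (_ : g ∈ Finset.univ) => h g
      simp at this; unfold envelope; linarith
    have h2 : envelope X v ^ 2 ≤ (p + 1) ^ 2 :=
      pow_le_pow_left₀ (by linarith [one_le_envelope X v]) h1 2
    have := Real.exp_le_exp.2 (mul_le_mul_of_nonneg_left h2 ha)
    linarith
  · push Not at h
    obtain ⟨g₀, hg₀⟩ := h
    obtain ⟨g, -, hg⟩ := Finset.exists_max_image Finset.univ (fun g => |X g v|) ⟨g₀, Finset.mem_univ _⟩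
    have hg1 : 1 ≤ |X g v| := hg₀.le.trans (hg g₀ (Finset.mem_univ _))
    have h1 : envelope X v ≤ (p + 1) * |X g v| := by
      have := Finset.sum_le_sum fun g' (_ : g' ∈ Finset.univ) => hg g' (Finset.mem_univ _)
      simp at this; unfold envelope; linarith
    have h2 : envelope X v ^ 2 ≤ (p + 1) ^ 2 * X g v ^ 2 := by
      rw [← sq_abs (X g v), ← mul_pow]
      exact pow_le_pow_left₀ (by linarith [one_le_envelope X v]) h1 2
    have h3 := Real.exp_le_exp.2 (mul_le_mul_of_nonneg_left h2 ha)
    rw [← mul_assoc] at h3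
    have h4 := Finset.single_le_sum (f := fun g => Real.exp (a * (p + 1) ^ 2 * X g v ^ 2))
      (fun _ _ => by positivity) (Finset.mem_univ g)
    have h5 := Real.exp_pos (a * (p + 1) ^ 2)
    beta_reduce at h4
    linarith

theorem lintegral_exp_envelope_le {X : Fin p → I → ℝ} (hX : ∀ g, Measurable (X g)) {a : ℝ}
    (ha : 0 ≤ a) {b : Fin p → ℝ} (hb0 : ∀ g, 0 ≤ b g)
    (hb : ∀ g, ∫⁻ v, ENNReal.ofReal (Real.exp (a * (p + 1) ^ 2 * X g v ^ 2)) ≤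
      ENNReal.ofReal (b g)) :
    ∫⁻ v, ENNReal.ofReal (Real.exp (a * envelope X v ^ 2)) ≤
      ENNReal.ofReal (Real.exp (a * (p + 1) ^ 2) + ∑ g, b g) := by
  calc _ ≤ ∫⁻ v, (ENNReal.ofReal (Real.exp (a * (p + 1) ^ 2)) +
        ∑ g, ENNReal.ofReal (Real.exp (a * (p + 1) ^ 2 * X g v ^ 2))) := by
        refine lintegral_mono fun v => ?_
        simp only
        rw [← ENNReal.ofReal_sum_of_nonneg fun _ _ => by positivity,
          ← ENNReal.ofReal_add (by positivity) (Finset.sum_nonneg fun _ _ => by positivity)]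
        exact ENNReal.ofReal_le_ofReal (exp_envelope_le ha v)
    _ = ENNReal.ofReal (Real.exp (a * (p + 1) ^ 2)) +
        ∑ g, ∫⁻ v, ENNReal.ofReal (Real.exp (a * (p + 1) ^ 2 * X g v ^ 2)) := by
        rw [lintegral_add_left (by fun_prop), lintegral_finsetSum _ fun g _ => by fun_prop]
        simp
    _ ≤ _ := by
        rw [ENNReal.ofReal_add (by positivity) (Finset.sum_nonneg fun _ _ => hb0 _),
          ENNReal.ofReal_sum_of_nonneg fun _ _ => hb0 _]
        exact add_le_add le_rfl (Finset.sum_le_sum fun g _ => hb g)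

end Envelope

/-! ### Deterministic transfer to a nearby kernel and nearby signals. -/

/-- `X'` approximates the signals `X` in `L²`, together with their exponential moments of
order `c`. -/
structure SignalsNear {p : ℕ} (κ c : ℝ) (X X' : Fin p → I → ℝ) : Prop where
  measurable : ∀ g, Measurable (X' g)
  sub_le : ∀ g, eLpNorm (fun v => X g v - X' g v) 2 volume ≤ ENNReal.ofReal κ
  exp_sub_le : ∀ g, eLpNorm (fun v => Real.exp (c * X g v ^ 2) - Real.exp (c * X' g v ^ 2)) 2
    volume ≤ 1

theorem memLp_of_integrable_exp {X : I → ℝ} (hX : Measurable X)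
    (hexp : ∀ c : ℝ, Integrable fun u => Real.exp (c * X u ^ 2)) {r : ℕ} (hr : r ≠ 0) :
    MemLp X r := by
  rw [← integrable_norm_rpow_iff hX.aestronglyMeasurable (by exact_mod_cast hr) (by simp)]
  refine (hexp r).mono' (hX.norm.pow_const _).aestronglyMeasurable (Filter.Eventually.of_forall fun u => ?_)
  simp only [ENNReal.toReal_natCast, Real.rpow_natCast, norm_pow, Real.norm_eq_abs, abs_abs]
  have h1 : |X u| ≤ Real.exp (X u ^ 2) := by
    have := Real.add_one_le_exp (X u ^ 2)
    nlinarith [sq_abs (X u), sq_nonneg (|X u| - 1)]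
  calc _ ≤ Real.exp (X u ^ 2) ^ r := pow_le_pow_left₀ (abs_nonneg _) h1 r
    _ = _ := (Real.exp_nat_mul _ _).symm

theorem SignalsNear.closeSignals {p : ℕ} {κ c R : ℝ} {X X' : Fin p → I → ℝ}
    (h : SignalsNear κ c X X') (hX : ∀ g, Measurable (X g)) (hX2 : ∀ g, MemLp (X g) 2)
    (hκ : 0 ≤ κ) (hκ1 : κ ≤ 1) (hR1 : 1 ≤ R)
    (hR : ∀ g, (eLpNorm (X g) 2 volume).toReal + 1 ≤ R) (g : Fin p) :
    CloseSignals κ (envelope X) (envelope X') R (X g) (X' g) where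
  measurable := hX g
  measurable' := h.measurable g
  norm_le := ENNReal.le_ofReal_iff_toReal_le (hX2 g).2.ne (by linarith) |>.2 (by linarith [hR g])
  norm_le' := by
    have e : X' g = X g - fun v => X g v - X' g v := by funext v; simp
    rw [e]
    refine (eLpNorm_sub_le (hX g).aestronglyMeasurable
      ((hX g).sub (h.measurable g)).aestronglyMeasurable one_le_two).trans ?_
    refine (add_le_add (ENNReal.ofReal_toReal (hX2 g).2.ne).ge (h.sub_le g)).trans ?_
    rw [← ENNReal.ofReal_add ENNReal.toReal_nonneg hκ]
    exact ENNReal.ofReal_le_ofReal (by linarith [hR g])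
  norm_sub_le := (h.sub_le g).trans (ENNReal.ofReal_le_ofReal (by nlinarith))
  abs_le v := (abs_le_envelope X g v).trans
    (le_mul_of_one_le_left (by linarith [one_le_envelope X v]) hR1)
  abs_le' v := (abs_le_envelope X' g v).trans
    (le_mul_of_one_le_left (by linarith [one_le_envelope X' v]) hR1)

/-- The exponentials differ by at most 1 in `L²`, hence in `L¹`. The `+ 1` is inside the integral,
which makes no difference for a probability measure. -/
theorem SignalsNear.lintegral_exp_le {p : ℕ} {κ c : ℝ} {X X' : Fin p → I → ℝ}
    (h : SignalsNear κ c X X') (hX : ∀ g, Measurable (X g))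
    (hexp : ∀ g, Integrable fun u => Real.exp (c * X g u ^ 2)) (g : Fin p) :
    ∫⁻ v, ENNReal.ofReal (Real.exp (c * X' g v ^ 2)) ≤
      ENNReal.ofReal (∫ v, Real.exp (c * X g v ^ 2) + 1) := by
  have m1 := hX g
  have m2 := h.measurable g
  have h1 := (eLpNorm_le_eLpNorm_of_exponent_le one_le_two (by fun_prop)).trans (h.exp_sub_le g)
  rw [eLpNorm_one_eq_lintegral_enorm] at h1
  rw [integral_add (hexp g) (integrable_const 1), ENNReal.ofReal_add (integral_nonneg fun v => by
    positivity) (by simp), ofReal_integral_eq_lintegral_ofReal (hexp g)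
      (Filter.Eventually.of_forall fun v => by positivity)]
  calc _ ≤ ∫⁻ v, (ENNReal.ofReal (Real.exp (c * X g v ^ 2)) +
        ‖Real.exp (c * X g v ^ 2) - Real.exp (c * X' g v ^ 2)‖ₑ) := by
        refine lintegral_mono fun v => ?_
        beta_reduce
        rw [← ofReal_norm, ← ENNReal.ofReal_add (by positivity) (norm_nonneg _)]
        refine ENNReal.ofReal_le_ofReal ?_
        linarith [neg_abs_le (Real.exp (c * X g v ^ 2) - Real.exp (c * X' g v ^ 2)),
          Real.norm_eq_abs (Real.exp (c * X g v ^ 2) - Real.exp (c * X' g v ^ 2))]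
    _ ≤ _ := by
        rw [lintegral_add_left (by fun_prop)]
        refine add_le_add le_rfl (h1.trans (by simp))

/-- The deterministic core. The constants are fixed in the order radius, moment order, moment bound,
tolerance; each depends only on earlier ones and the data, so `κ` and `c` serve all networks of the
given architecture and all `ε` at once. -/
theorem exists_transfer {p q : ℕ} (W : Graphon) (X₁ X₂ : Fin p → I → ℝ)
    (Δ : Matrix (Fin q) (Fin q) ℝ)
    (hX₁ : ∀ g, Measurable (X₁ g)) (hX₂ : ∀ g, Measurable (X₂ g))
    (hexp₁ : ∀ g, ∀ c : ℝ, Integrable (fun u => Real.exp (c * X₁ g u ^ 2)))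
    (hexp₂ : ∀ g, ∀ c : ℝ, Integrable (fun u => Real.exp (c * X₂ g u ^ 2)))
    (L F h T : ℕ) (Ω ω : Fin 3 → ℝ≥0) {η : ℝ} (hη : 0 < η) :
    ∃ κ c : ℝ, 0 < κ ∧ ∀ (V : I → I → ℝ) (X₁' X₂' : Fin p → I → ℝ) (hV : IsKernel V),
      (∀ u v, V u v = V v u) → ‖kernelOp W.isKernel - kernelOp hV‖ ≤ κ →
      SignalsNear κ c X₁ X₁' → SignalsNear κ c X₂ X₂' →
      ∀ ε : ℝ, 0 < ε → ∀ Ψ : WRNN L F p h q, Ψ.Admissible Ω ω ε →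
        Integrable (fun z => Real.exp (Ψ.chi T Δ W.toFun X₁ X₂ z)) ∧
        Integrable (fun z => Real.exp (Ψ.chi T Δ V X₁' X₂' z)) ∧
        eLpNorm (fun z => softmax (Ψ.chi T Δ W.toFun X₁ X₂) z - softmax (Ψ.chi T Δ V X₁' X₂') z)
          2 volume ≤ ENNReal.ofReal η := by
  have hL₁ : ∀ g, MemLp (X₁ g) 2 := fun g => by
    simpa using memLp_of_integrable_exp (hX₁ g) (hexp₁ g) two_ne_zero
  have hL₂ : ∀ g, MemLp (X₂ g) 2 := fun g => by
    simpa using memLp_of_integrable_exp (hX₂ g) (hexp₂ g) two_ne_zero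
  set Ωm : ℝ≥0 := Ω 0 + Ω 1 + Ω 2 with hΩm
  have hΩ : ∀ i, Ω i ≤ Ωm := by
    intro i
    fin_cases i
    · exact le_self_add.trans le_self_add
    · exact le_add_self.trans le_self_add
    · exact le_add_self
  set R₀ : ℝ := 1 + (∑ g, (eLpNorm (X₁ g) 2 volume).toReal) +
    ∑ g, (eLpNorm (X₂ g) 2 volume).toReal with hR₀
  have hs₁ : 0 ≤ ∑ g, (eLpNorm (X₁ g) 2 volume).toReal :=
    Finset.sum_nonneg fun _ _ => ENNReal.toReal_nonneg
  have hs₂ : 0 ≤ ∑ g, (eLpNorm (X₂ g) 2 volume).toReal :=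
    Finset.sum_nonneg fun _ _ => ENNReal.toReal_nonneg
  have hR₀1 : 1 ≤ R₀ := by rw [hR₀]; linarith
  have hR₁ : ∀ g, (eLpNorm (X₁ g) 2 volume).toReal + 1 ≤ R₀ := fun g => by
    have := Finset.single_le_sum (f := fun g => (eLpNorm (X₁ g) 2 volume).toReal)
      (fun _ _ => ENNReal.toReal_nonneg) (Finset.mem_univ g)
    beta_reduce at this; rw [hR₀]; linarith
  have hR₂ : ∀ g, (eLpNorm (X₂ g) 2 volume).toReal + 1 ≤ R₀ := fun g => by
    have := Finset.single_le_sum (f := fun g => (eLpNorm (X₂ g) 2 volume).toReal)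
      (fun _ _ => ENNReal.toReal_nonneg) (Finset.mem_univ g)
    beta_reduce at this; rw [hR₀]; linarith
  set R := outputRadius (p + F + h) L T Ωm R₀ with hR
  have hR0 : 0 ≤ R := outputRadius_nonneg (by linarith)
  set k := ∑ i, ∑ j, |actionMatrix Δ i j| with hk
  have hk0 : 0 ≤ k := Finset.sum_nonneg fun _ _ => Finset.sum_nonneg fun _ _ => abs_nonneg _
  -- The coefficient of the squared envelopes after `2 w₁ w₂ ≤ w₁² + w₂²` in `4 |χ|`; passing from
  -- envelope to features costs the factor `(p + 1) ^ 2` in `c`.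
  set a := 2 * (k * R ^ 2) with ha
  have ha0 : 0 ≤ a := by positivity
  set c := a * (p + 1) ^ 2 with hc
  have hi₁ : ∀ g, 0 ≤ ∫ v, Real.exp (c * X₁ g v ^ 2) + 1 := fun g =>
    integral_nonneg fun v => by positivity
  have hi₂ : ∀ g, 0 ≤ ∫ v, Real.exp (c * X₂ g v ^ 2) + 1 := fun g =>
    integral_nonneg fun v => by positivity
  have hS₁ := Finset.sum_nonneg fun g (_ : g ∈ Finset.univ) => hi₁ g
  have hS₂ := Finset.sum_nonneg fun g (_ : g ∈ Finset.univ) => hi₂ g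
  set B : ℝ := Real.exp c + (∑ g, ∫ v, Real.exp (c * X₁ g v ^ 2) + 1) +
    ∑ g, ∫ v, Real.exp (c * X₂ g v ^ 2) + 1 with hB
  have hB1 : 1 ≤ B := by
    have : 1 ≤ Real.exp c := Real.one_le_exp (by positivity)
    rw [hB]; linarith
  have hE1 : 1 ≤ B ^ 2 := one_le_pow₀ hB1
  -- The final softmax bound is continuous in the tolerance and vanishes at zero.
  obtain ⟨κ₀, hκ₀, hκ₀'⟩ : ∃ κ₀ : ℝ, 0 < κ₀ ∧
      2 * (B ^ 2) ^ 3 * Real.sqrt (4 * B ^ 2 * (k * (2 * κ₀ * R ^ 2))) ≤ η := by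
    have hcont : Filter.Tendsto (fun κ₀ : ℝ => 2 * (B ^ 2) ^ 3 *
        Real.sqrt (4 * B ^ 2 * (k * (2 * κ₀ * R ^ 2)))) (nhdsWithin 0 (Set.Ioi 0))
        (nhds 0) := by
      have : Continuous fun κ₀ : ℝ => 2 * (B ^ 2) ^ 3 *
        Real.sqrt (4 * B ^ 2 * (k * (2 * κ₀ * R ^ 2))) := by fun_prop
      simpa using (this.tendsto 0).mono_left nhdsWithin_le_nhds
    obtain ⟨κ₀, h1, h2⟩ := ((hcont.eventually (ge_mem_nhds hη)).and
      self_mem_nhdsWithin).exists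
    exact ⟨κ₀, h2, h1⟩
  obtain ⟨κ₁, hκ₁, hfilter⟩ := exists_eLpNorm_graphonFilter_sub_le Ωm
    (τ := min κ₀ 1) (lt_min hκ₀ one_pos)
  have hm0 : 0 ≤ min κ₀ 1 := (lt_min hκ₀ one_pos).le
  refine ⟨min κ₁ (min κ₀ 1), c, lt_min hκ₁ (lt_min hκ₀ one_pos), ?_⟩
  intro V X₁' X₂' hV hVs hVn hn₁ hn₂ ε hε Ψ hΨ
  have hK : CloseKernels (min κ₀ 1) Ωm W.toFun V :=
    ⟨W.isKernel, hV, W.symm', hVs, fun b hb X hX => hfilter W.isKernel hV W.symm' hVs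
      (hVn.trans (min_le_left _ _)) b hb X hX⟩
  have hn₁' : SignalsNear (min κ₀ 1) c X₁ X₁' := ⟨hn₁.1, fun g => (hn₁.2 g).trans
    (ENNReal.ofReal_le_ofReal (min_le_right _ _)), hn₁.3⟩
  have hn₂' : SignalsNear (min κ₀ 1) c X₂ X₂' := ⟨hn₂.1, fun g => (hn₂.2 g).trans
    (ENNReal.ofReal_le_ofReal (min_le_right _ _)), hn₂.3⟩
  have hY₁ : ∀ f, CloseSignals (min κ₀ 1) (envelope X₁) (envelope X₁') R _ _ :=
    CloseSignals.output hm0 (one_le_envelope _) (one_le_envelope _) hε hΩ hK hΨ (by linarith)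
      (hn₁'.closeSignals hX₁ hL₁ hm0 (min_le_right _ _) hR₀1 hR₁) T
  have hY₂ : ∀ f, CloseSignals (min κ₀ 1) (envelope X₂) (envelope X₂') R _ _ :=
    CloseSignals.output hm0 (one_le_envelope _) (one_le_envelope _) hε hΩ hK hΨ (by linarith)
      (hn₂'.closeSignals hX₂ hL₂ hm0 (min_le_right _ _) hR₀1 hR₂) T
  have hχ : Measurable (Ψ.chi T Δ W.toFun X₁ X₂) :=
    measurable_actionKernel (fun f => (hY₁ f).measurable) fun f => (hY₂ f).measurable
  have hχ' : Measurable (Ψ.chi T Δ V X₁' X₂') :=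
    measurable_actionKernel (fun f => (hY₁ f).measurable') fun f => (hY₂ f).measurable'
  -- The original signals count as perturbations of themselves, so the same moment bound `B` covers
  -- both sides.
  have near_self : ∀ {X : Fin p → I → ℝ}, (∀ g, Measurable (X g)) → SignalsNear 0 c X X :=
    fun hX => ⟨hX, fun g => by simp, fun g => by simp⟩
  have hBB₁ : ∀ {X' : Fin p → I → ℝ} {κ : ℝ}, SignalsNear κ c X₁ X' →
      ∫⁻ v, ENNReal.ofReal (Real.exp (a * envelope X' v ^ 2)) ≤ ENNReal.ofReal B := fun hn =>
    (lintegral_exp_envelope_le hn.measurable ha0 hi₁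
      (hn.lintegral_exp_le hX₁ fun g => hexp₁ g c)).trans
      (ENNReal.ofReal_le_ofReal (by rw [hB]; linarith))
  have hBB₂ : ∀ {X' : Fin p → I → ℝ} {κ : ℝ}, SignalsNear κ c X₂ X' →
      ∫⁻ v, ENNReal.ofReal (Real.exp (a * envelope X' v ^ 2)) ≤ ENNReal.ofReal B := fun hn =>
    (lintegral_exp_envelope_le hn.measurable ha0 hi₂
      (hn.lintegral_exp_le hX₂ fun g => hexp₂ g c)).trans
      (ENNReal.ofReal_le_ofReal (by rw [hB]; linarith))
  have hE : ∫⁻ z, ENNReal.ofReal (Real.exp (4 * |Ψ.chi T Δ W.toFun X₁ X₂ z|)) ≤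
      ENNReal.ofReal (B ^ 2) :=
    lintegral_exp_actionKernel_le hR0 (one_le_envelope X₁) (measurable_envelope hX₁)
      (measurable_envelope hX₂) (fun f => (hY₁ f).abs_le) (fun f => (hY₂ f).abs_le)
      (by linarith) le_rfl (hBB₁ (near_self hX₁)) (hBB₂ (near_self hX₂))
  have hE' : ∫⁻ z, ENNReal.ofReal (Real.exp (4 * |Ψ.chi T Δ V X₁' X₂' z|)) ≤
      ENNReal.ofReal (B ^ 2) :=
    lintegral_exp_actionKernel_le hR0 (one_le_envelope X₁') (measurable_envelope hn₁.measurable)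
      (measurable_envelope hn₂.measurable) (fun f => (hY₁ f).abs_le') (fun f => (hY₂ f).abs_le')
      (by linarith) le_rfl (hBB₁ hn₁) (hBB₂ hn₂)
  refine ⟨?_, ?_, ?_⟩
  · simpa using integrable_exp_mul_of_lintegral_le hχ hE (a := 1) (by norm_num)
  · simpa using integrable_exp_mul_of_lintegral_le hχ' hE' (a := 1) (by norm_num)
  · refine (eLpNorm_softmax_sub_le hχ hχ' hE hE' hE1 (by positivity)
      (eLpNorm_actionKernel_sub_le hm0 hR0 hY₁ hY₂)).trans (ENNReal.ofReal_le_ofReal ?_)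
    refine le_trans ?_ hκ₀'
    gcongr
    exact min_le_left _ _

/-! ### Cells as a partition of the interval, and replacement of points by labels. -/

section CellIndex

variable {n : ℕ}

theorem cell_index_unique {u : Fin n → I} {v : I} {i j : Fin n} (hi : v ∈ cell u i)
    (hj : v ∈ cell u j) : i = j := by
  have key : ∀ {i j : Fin n}, toLex (u i, i) ≤ toLex (u j, j) → toLex (u j, j) ≤ toLex (u i, i) →
      i = j := fun h1 h2 => congrArg Prod.snd (toLex.injective (le_antisymm h1 h2))
  rcases hi with ⟨h1, h2⟩ | ⟨h1, h2⟩ <;> rcases hj with ⟨h3, h4⟩ | ⟨h3, h4⟩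
  · exact key (h4 _ h1) (h2 _ h3)
  · exact absurd h1 (not_le.2 (h3 i))
  · exact absurd h3 (not_le.2 (h1 j))
  · exact key (h4 _) (h2 _)

theorem exists_mem_cell [NeZero n] (u : Fin n → I) (v : I) : ∃ i, v ∈ cell u i := by
  by_cases h : ∃ j, u j ≤ v
  · obtain ⟨i, hi, hmax⟩ := Finset.exists_max_image (Finset.univ.filter fun j => u j ≤ v)
      (fun j => toLex (u j, j)) (h.imp fun j hj => by simpa using hj)
    exact ⟨i, Or.inl ⟨by simpa using hi, fun j hj => hmax j (by simpa using hj)⟩⟩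
  · push Not at h
    obtain ⟨i, -, hmax⟩ := Finset.exists_max_image (Finset.univ : Finset (Fin n))
      (fun j => toLex (u j, j)) ⟨0, Finset.mem_univ _⟩
    exact ⟨i, Or.inr ⟨h, fun j => hmax j (Finset.mem_univ _)⟩⟩

variable [NeZero n]

/-- The index of the cell containing `v`. -/
def cellIndex (u : Fin n → I) (v : I) : Fin n := (exists_mem_cell u v).choose

theorem mem_cell_cellIndex (u : Fin n → I) (v : I) : v ∈ cell u (cellIndex u v) :=
  (exists_mem_cell u v).choose_spec

theorem mem_cell_iff {u : Fin n → I} {v : I} {i : Fin n} : v ∈ cell u i ↔ cellIndex u v = i :=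
  ⟨fun h => cell_index_unique (mem_cell_cellIndex u v) h, fun h => h ▸ mem_cell_cellIndex u v⟩

theorem cell_indicator_apply (u : Fin n → I) (v : I) (i : Fin n) :
    (cell u i).indicator (1 : I → ℝ) v = if cellIndex u v = i then 1 else 0 := by
  classical
  simp [Set.indicator_apply, mem_cell_iff]

theorem inducedKernel_apply (u : Fin n → I) (M : Fin n → Fin n → ℝ) (s t : I) :
    inducedKernel u M s t = M (cellIndex u s) (cellIndex u t) := by
  simp [inducedKernel, cell_indicator_apply]

theorem inducedSignal_apply (u : Fin n → I) (x : Fin n → ℝ) (s : I) :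
    inducedSignal u x s = x (cellIndex u s) := by
  simp [inducedSignal, cell_indicator_apply]

theorem measurable_cellIndex_uncurry :
    Measurable fun z : (Fin n → I) × I => cellIndex z.1 z.2 := by
  refine measurable_to_countable' fun i => ?_
  convert measurableSet_mem_cell i using 1
  ext z
  simp [mem_cell_iff]

theorem measurable_cellIndex (u : Fin n → I) : Measurable (cellIndex u) :=
  measurable_cellIndex_uncurry.comp (measurable_const.prodMk measurable_id)

/-- The label of the cell containing `v`. -/
def cellLabel (u : Fin n → I) (v : I) : I := u (cellIndex u v)

theorem measurable_cellLabel (u : Fin n → I) : Measurable (cellLabel u) :=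
  (measurable_of_countable u).comp (measurable_cellIndex u)

theorem lintegral_cellIndex (u : Fin n → I) (f : Fin n → ℝ≥0∞) :
    ∫⁻ v, f (cellIndex u v) = ∑ i, volume (cell u i) * f i := by
  have h : ∀ v, f (cellIndex u v) = ∑ i, (cell u i).indicator (fun _ => f i) v := fun v => by
    classical
    simp [Set.indicator_apply, mem_cell_iff]
  simp only [h]
  rw [lintegral_finsetSum _ fun i _ => measurable_const.indicator (measurableSet_cell u i)]
  refine Finset.sum_congr rfl fun i _ => ?_
  rw [lintegral_indicator_const (measurableSet_cell u i), mul_comm]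

theorem lintegral_cellIndex_prod (u : Fin n → I) (f : Fin n → Fin n → ℝ≥0∞) :
    ∫⁻ z : I × I, f (cellIndex u z.1) (cellIndex u z.2) =
      ∑ i, ∑ j, volume (cell u i) * volume (cell u j) * f i j := by
  have hm : Measurable fun z : I × I => f (cellIndex u z.1) (cellIndex u z.2) :=
    (measurable_of_countable fun p : Fin n × Fin n => f p.1 p.2).comp
      (((measurable_cellIndex u).comp measurable_fst).prodMk
        ((measurable_cellIndex u).comp measurable_snd))
  rw [Measure.volume_eq_prod, lintegral_prod _ hm.aemeasurable]
  have h : ∀ x, ∫⁻ y, f (cellIndex u x) (cellIndex u y) =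
      ∑ j, volume (cell u j) * f (cellIndex u x) j := fun x => lintegral_cellIndex u _
  simp only [h]
  rw [lintegral_cellIndex u fun i => ∑ j, volume (cell u j) * f i j]
  simp only [Finset.mul_sum, mul_assoc]

/-- The sum of the squares of the cell lengths. -/
def cellEnergy (u : Fin n → I) : ℝ≥0∞ := ∑ i, volume (cell u i) ^ 2

theorem sq_sum_mul_le {ι : Type*} [Fintype ι] (f g : ι → ℝ≥0∞) :
    (∑ i, f i * g i) ^ 2 ≤ (∑ i, f i ^ 2) * ∑ i, g i ^ 2 := by
  let _ : MeasurableSpace ι := ⊤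
  have := sq_lintegral_mul_le (μ := Measure.count) (f := f) (g := g)
    (measurable_of_countable f).aemeasurable (measurable_of_countable g).aemeasurable
  simpa [lintegral_count, tsum_fintype] using this

/-- Cauchy–Schwarz over pairs of cells separates the random lengths from the values at the labels.
The remaining sum is unweighted, so its mean can be computed from the independence of the labels. -/
theorem sq_lintegral_cellLabel_le (u : Fin n → I) (f : I × I → ℝ≥0∞) :
    (∫⁻ z : I × I, f (cellLabel u z.1, cellLabel u z.2)) ^ 2 ≤
      cellEnergy u ^ 2 * ∑ i, ∑ j, f (u i, u j) ^ 2 := by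
  simp only [cellLabel]
  rw [lintegral_cellIndex_prod u fun i j => f (u i, u j), ← Fintype.sum_prod_type',
    ← Fintype.sum_prod_type']
  refine (sq_sum_mul_le _ _).trans (le_of_eq ?_)
  congr 1
  rw [cellEnergy, sq, Finset.sum_mul_sum, ← Fintype.sum_prod_type']
  simp only [mul_pow]

/-- The cell contains the whole interval from its label to `v`, or, if it wraps around, the interval
from `0` to `v`; the condition `r ≤ v` handles the second case. -/
theorem cell_of_lt_dist {u : Fin n → I} {v : I} {r : ℝ} (hr : r < dist (cellLabel u v) v)
    (hv : r ≤ v) : ENNReal.ofReal r ≤ volume (cell u (cellIndex u v)) := by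
  rcases mem_cell_cellIndex u v with ⟨h1, h2⟩ | ⟨h1, h2⟩
  · have hsub : Set.Icc (cellLabel u v) v ⊆ cell u (cellIndex u v) := fun x hx =>
      Or.inl ⟨hx.1, fun j hj => h2 j (hj.trans hx.2)⟩
    refine le_trans ?_ (measure_mono hsub)
    rw [unitInterval.volume_Icc]
    refine ENNReal.ofReal_le_ofReal ?_
    have h3 : (cellLabel u v : ℝ) ≤ v := h1
    rw [Subtype.dist_eq, Real.dist_eq, abs_of_nonpos (by linarith)] at hr
    linarith
  · have hsub : Set.Icc 0 v ⊆ cell u (cellIndex u v) := fun x hx =>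
      Or.inr ⟨fun j => hx.2.trans_lt (h1 j), h2⟩
    refine le_trans ?_ (measure_mono hsub)
    rw [unitInterval.volume_Icc]
    exact ENNReal.ofReal_le_ofReal (by simpa using hv)

/-- The length of the cell of `v`, integrated over `v`, is the cell energy, so Markov's inequality
bounds the points in long cells. The extra `r` accounts for points near `0`. -/
theorem volume_lt_dist_cellLabel_le (u : Fin n → I) {r : ℝ} (hr : 0 < r) :
    volume {v | r < dist (cellLabel u v) v} ≤
      ENNReal.ofReal r + cellEnergy u / ENNReal.ofReal r := by
  have hsub : {v | r < dist (cellLabel u v) v} ⊆ {v : I | (v : ℝ) < r} ∪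
      {v | ENNReal.ofReal r ≤ volume (cell u (cellIndex u v))} := fun v hv => by
    by_cases h : (v : ℝ) < r
    · exact Or.inl h
    · exact Or.inr (cell_of_lt_dist hv (not_lt.1 h))
  refine (measure_mono hsub).trans ((measure_union_le _ _).trans (add_le_add ?_ ?_))
  · rw [unitInterval.volume_apply]
    refine (measure_mono (t := Set.Ico 0 r) ?_).trans (by simp)
    rintro _ ⟨v, hv, rfl⟩
    exact ⟨v.2.1, hv⟩
  · have hm : Measurable fun v => volume (cell u (cellIndex u v)) :=
      (measurable_of_countable fun i => volume (cell u i)).comp (measurable_cellIndex u)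
    refine (meas_ge_le_lintegral_div hm.aemeasurable (by simpa using hr)
      ENNReal.ofReal_ne_top).trans ?_
    rw [lintegral_cellIndex u fun i => volume (cell u i)]
    simp only [cellEnergy, sq, le_refl]

theorem exists_eLpNorm_cellLabel_sub_le {g : I × I → ℝ} (hg : Continuous g) {τ : ℝ}
    (hτ : 0 < τ) : ∃ κ : ℝ, 0 < κ ∧ ∀ {n : ℕ} [NeZero n] (u : Fin n → I),
      cellEnergy u ≤ ENNReal.ofReal κ →
        eLpNorm (fun z => g (cellLabel u z.1, cellLabel u z.2) - g z) 2 volume ≤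
          ENNReal.ofReal τ := by
  obtain ⟨B, hB⟩ : ∃ B : ℝ, ∀ z, |g z| ≤ B := by
    obtain ⟨B, hB⟩ := isCompact_univ.exists_bound_of_continuousOn hg.continuousOn
    exact ⟨B, fun z => hB z (Set.mem_univ z)⟩
  have hB0 : 0 ≤ B := (abs_nonneg _).trans (hB (0, 0))
  have huc : UniformContinuous g := CompactSpace.uniformContinuous_of_continuous hg
  obtain ⟨r₀, hr₀, hr₀'⟩ := Metric.uniformContinuous_iff.1 huc (τ / 2) (by positivity)
  -- With energy at most `r * r` the bad set has measure at most `2 r`, and there the squared error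
  -- is at most `4 B ^ 2`. Each coordinate thus contributes at most `C r ≤ τ² / 4`, as do the good
  -- points by uniform continuity.
  set C : ℝ := 8 * B ^ 2 + 1 with hC
  set r : ℝ := min (r₀ / 2) (τ ^ 2 / (4 * C)) with hr
  have hr0 : 0 < r := by positivity
  have hrr : r < r₀ := (min_le_left _ _).trans_lt (by linarith)
  have hrC : C * r ≤ τ ^ 2 / 4 := by
    have := mul_le_mul_of_nonneg_left (min_le_right (r₀ / 2) (τ ^ 2 / (4 * C)))
      (by positivity : 0 ≤ C)
    have hC0 : C ≠ 0 := by positivity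
    refine this.trans (le_of_eq ?_); field_simp
  refine ⟨r * r, by positivity, fun {n} _ u hu => ?_⟩
  set bad : Set I := {v | r < dist (cellLabel u v) v}
  have hbadm : MeasurableSet bad :=
    measurableSet_lt measurable_const ((measurable_cellLabel u).dist measurable_id)
  have hbad : volume bad ≤ ENNReal.ofReal (2 * r) := by
    refine (volume_lt_dist_cellLabel_le u hr0).trans ?_
    rw [two_mul, ENNReal.ofReal_add hr0.le hr0.le]
    refine add_le_add le_rfl (ENNReal.div_le_of_le_mul ?_)
    rwa [← ENNReal.ofReal_mul hr0.le]
  have hpt : ∀ z : I × I, ‖g (cellLabel u z.1, cellLabel u z.2) - g z‖ₑ ^ 2 ≤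
      ENNReal.ofReal (τ ^ 2 / 4) + (bad.indicator (fun _ => ENNReal.ofReal (4 * B ^ 2)) z.1 +
        bad.indicator (fun _ => ENNReal.ofReal (4 * B ^ 2)) z.2) := by
    intro z
    rw [← ofReal_norm, ← ENNReal.ofReal_pow (norm_nonneg _), Real.norm_eq_abs]
    have hbig : |g (cellLabel u z.1, cellLabel u z.2) - g z| ^ 2 ≤ 4 * B ^ 2 := by
      have : |g (cellLabel u z.1, cellLabel u z.2) - g z| ≤ 2 * B :=
        (abs_sub _ _).trans (by linarith [hB z, hB (cellLabel u z.1, cellLabel u z.2)])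
      nlinarith [abs_nonneg (g (cellLabel u z.1, cellLabel u z.2) - g z)]
    by_cases h1 : z.1 ∈ bad
    · refine le_trans (ENNReal.ofReal_le_ofReal hbig) ?_
      simp only [Set.indicator_of_mem h1]
      exact le_self_add.trans le_add_self
    by_cases h2 : z.2 ∈ bad
    · refine le_trans (ENNReal.ofReal_le_ofReal hbig) ?_
      simp only [Set.indicator_of_mem h2]
      exact le_add_self.trans le_add_self
    have hd : dist (cellLabel u z.1, cellLabel u z.2) z < r₀ := by
      refine lt_of_le_of_lt ?_ hrr
      rw [Prod.dist_eq]
      exact max_le (not_lt.1 h1) (not_lt.1 h2)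
    have := hr₀' hd
    rw [Real.dist_eq] at this
    refine le_trans (ENNReal.ofReal_le_ofReal ?_) le_self_add
    nlinarith [abs_nonneg (g (cellLabel u z.1, cellLabel u z.2) - g z)]
  rw [← ENNReal.pow_le_pow_left_iff two_ne_zero, eLpNorm_two_sq]
  have hmi : Measurable (bad.indicator fun _ => ENNReal.ofReal (4 * B ^ 2)) :=
    measurable_const.indicator hbadm
  have hi : ∫⁻ v, bad.indicator (fun _ => ENNReal.ofReal (4 * B ^ 2)) v ≤
      ENNReal.ofReal (C * r) := by
    rw [lintegral_indicator_const hbadm]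
    refine (mul_le_mul' le_rfl hbad).trans ?_
    rw [← ENNReal.ofReal_mul (by positivity)]
    exact ENNReal.ofReal_le_ofReal (by rw [hC]; nlinarith)
  calc _ ≤ _ := lintegral_mono hpt
    _ = ENNReal.ofReal (τ ^ 2 / 4) +
        ((∫⁻ v, bad.indicator (fun _ => ENNReal.ofReal (4 * B ^ 2)) v) +
          ∫⁻ v, bad.indicator (fun _ => ENNReal.ofReal (4 * B ^ 2)) v) := by
      have e1 : ∫⁻ z : I × I, bad.indicator (fun _ => ENNReal.ofReal (4 * B ^ 2)) z.1 = _ :=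
        (measurePreserving_fst (μ := volume) (ν := (volume : Measure I))).lintegral_comp hmi
      have e2 : ∫⁻ z : I × I, bad.indicator (fun _ => ENNReal.ofReal (4 * B ^ 2)) z.2 = _ :=
        (measurePreserving_snd (μ := (volume : Measure I)) (ν := volume)).lintegral_comp hmi
      rw [lintegral_add_left measurable_const, lintegral_add_left
        (f := fun z : I × I => bad.indicator (fun _ => ENNReal.ofReal (4 * B ^ 2)) z.1)
        (hmi.comp measurable_fst), e1, e2]
      simp
    _ ≤ _ := by
      refine (add_le_add le_rfl (add_le_add hi hi)).trans ?_
      rw [← ENNReal.ofReal_add (by positivity) (by positivity),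
        ← ENNReal.ofReal_add (by positivity) (by positivity), ← ENNReal.ofReal_pow hτ.le]
      exact ENNReal.ofReal_le_ofReal (by nlinarith)

end CellIndex

/-! ### The expected cell energy -/

section Energy

/-- The second alternative is the cell that wraps around: `v` lies below every label and `w` above
every label. -/
theorem no_label_or_all_labels_of_cellIndex_eq {n : ℕ} [NeZero n] {u : Fin n → I} {v w : I}
    (h : cellIndex u v = cellIndex u w) :
    (∀ j, u j ∉ Set.Ioc v w) ∨ ∀ j, u j ∈ Set.Ioc v w := by
  rcases mem_cell_cellIndex u v with ⟨h1, h2⟩ | ⟨h1, h2⟩ <;>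
    rcases mem_cell_cellIndex u w with ⟨h3, h4⟩ | ⟨h3, h4⟩
  · refine Or.inl fun j hj => ?_
    have := h4 j hj.2
    rw [← h] at this
    rw [Prod.Lex.toLex_le_toLex] at this
    rcases this with h5 | h5
    · exact absurd (h5.trans_le h1) (not_lt.2 hj.1.le)
    · exact absurd (h5.1.trans_le h1) (not_le.2 hj.1)
  · exact Or.inl fun j hj => absurd hj.2 (not_le.2 (h3 j))
  · refine Or.inr fun j => ⟨h1 j, ?_⟩
    have := h2 j
    rw [h, Prod.Lex.toLex_le_toLex] at this
    rcases this with h5 | h5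
    · exact h5.le.trans h3
    · exact h5.1.le.trans h3
  · exact Or.inl fun j hj => absurd hj.2 (not_le.2 (h3 j))

theorem volume_cellIndex_eq_le {n : ℕ} [NeZero n] (v w : I) :
    volume {u : Fin n → I | cellIndex u v = cellIndex u w} ≤
      ENNReal.ofReal ((1 - |(w : ℝ) - v|) ^ n) + ENNReal.ofReal (|(w : ℝ) - v| ^ n) := by
  have key : ∀ v w : I, v ≤ w → volume {u : Fin n → I | cellIndex u v = cellIndex u w} ≤
      ENNReal.ofReal ((1 - |(w : ℝ) - v|) ^ n) + ENNReal.ofReal (|(w : ℝ) - v| ^ n) := by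
    intro v w hvw
    have hvw' : (v : ℝ) ≤ w := hvw
    have h1 : (w : ℝ) ≤ 1 := w.2.2
    have h0 : (0 : ℝ) ≤ v := v.2.1
    have hsub : {u : Fin n → I | cellIndex u v = cellIndex u w} ⊆
        (Set.univ.pi fun _ => (Set.Ioc v w)ᶜ) ∪ Set.univ.pi fun _ => Set.Ioc v w := fun u hu => by
      rcases no_label_or_all_labels_of_cellIndex_eq hu with h | h
      · exact Or.inl fun j _ => h j
      · exact Or.inr fun j _ => h j
    refine (measure_mono hsub).trans ((measure_union_le _ _).trans (le_of_eq ?_))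
    rw [volume_pi_pi, volume_pi_pi, prob_compl_eq_one_sub measurableSet_Ioc,
      unitInterval.volume_Ioc, abs_of_nonneg (by linarith), ← ENNReal.ofReal_one,
      ← ENNReal.ofReal_sub _ (by linarith)]
    simp only [Finset.prod_const, Finset.card_univ, Fintype.card_fin]
    rw [ENNReal.ofReal_pow (by linarith), ENNReal.ofReal_pow (by linarith)]
  rcases le_total v w with h | h
  · exact key v w h
  · have := key w v h
    rw [abs_sub_comm] at this
    simpa only [eq_comm] using this

/-- For fixed `v` and uniform `w`, the distance `|w - v|` has density at most 2 on `[0, 1]`. -/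
theorem lintegral_abs_sub_le {g : ℝ → ℝ≥0∞} (hg : Measurable g) (v : I) :
    ∫⁻ w : I, g |(w : ℝ) - v| ≤ 2 * ∫⁻ t in Set.Icc (0 : ℝ) 1, g t := by
  set G : ℝ → ℝ≥0∞ := (Set.Icc (0 : ℝ) 1).indicator g with hG
  have hGm : Measurable G := hg.indicator measurableSet_Icc
  have hpt : ∀ w : I, g |(w : ℝ) - v| ≤ G ((w : ℝ) - v) + G ((v : ℝ) - w) := by
    intro w
    have := w.2.1; have := w.2.2; have := v.2.1; have := v.2.2
    rcases le_total (v : ℝ) w with h | h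
    · rw [abs_of_nonneg (by linarith), hG, Set.indicator_of_mem (s := Set.Icc (0 : ℝ) 1)
        (a := (w : ℝ) - v) ⟨by linarith, by linarith⟩]
      exact le_self_add
    · rw [abs_of_nonpos (by linarith), neg_sub, hG, Set.indicator_of_mem (s := Set.Icc (0 : ℝ) 1)
        (a := (v : ℝ) - w) ⟨by linarith, by linarith⟩]
      exact le_add_self
  refine (lintegral_mono hpt).trans ?_
  have hcoe := (measurePreserving_subtype_coe (μa := (volume : Measure ℝ))
    (measurableSet_Icc (a := (0 : ℝ)) (b := 1))).lintegral_comp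
    (f := fun x : ℝ => G (x - v) + G (v - x)) (by fun_prop)
  refine (le_of_eq hcoe).trans ((setLIntegral_le_lintegral _ _).trans (le_of_eq ?_))
  rw [lintegral_add_left (by fun_prop), lintegral_sub_right_eq_self G (v : ℝ),
    lintegral_sub_left_eq_self G (v : ℝ), hG, lintegral_indicator measurableSet_Icc, two_mul]

theorem setLIntegral_pow_Icc (n : ℕ) :
    ∫⁻ t in Set.Icc (0 : ℝ) 1, ENNReal.ofReal (t ^ n) = ENNReal.ofReal (1 / (n + 1)) := by
  rw [← ofReal_integral_eq_lintegral_ofReal]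
  · rw [integral_Icc_eq_integral_Ioc, ← intervalIntegral.integral_of_le zero_le_one, integral_pow]
    simp
  · exact (Continuous.integrableOn_Icc (by fun_prop))
  · exact (ae_restrict_mem measurableSet_Icc).mono fun t ht => pow_nonneg ht.1 n

theorem setLIntegral_one_sub_pow_Icc (n : ℕ) :
    ∫⁻ t in Set.Icc (0 : ℝ) 1, ENNReal.ofReal ((1 - t) ^ n) = ENNReal.ofReal (1 / (n + 1)) := by
  rw [← ofReal_integral_eq_lintegral_ofReal]
  · rw [integral_Icc_eq_integral_Ioc, ← intervalIntegral.integral_of_le zero_le_one,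
      intervalIntegral.integral_comp_sub_left (fun t : ℝ => t ^ n), integral_pow]
    simp
  · exact (Continuous.integrableOn_Icc (by fun_prop))
  · exact (ae_restrict_mem measurableSet_Icc).mono fun t ht => pow_nonneg (by linarith [ht.2]) n

theorem measurable_volume_cell {n : ℕ} (i : Fin n) :
    Measurable fun u : Fin n → I => volume (cell u i) :=
  measurable_measure_prodMk_left (measurableSet_mem_cell i)

theorem measurable_cellEnergy {n : ℕ} : Measurable (cellEnergy (n := n)) :=
  Finset.measurable_sum _ fun i _ => (measurable_volume_cell i).pow_const 2

/-- The energy is the probability that two uniform points share a cell. Exchanging integrals, points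
at distance `t` do so with probability at most `(1 - t)^n + t^n`, and integration gives `4 / (n +
1)`. -/
theorem lintegral_cellEnergy_le (n : ℕ) [NeZero n] :
    ∫⁻ u : Fin n → I, cellEnergy u ≤ ENNReal.ofReal (4 / n) := by
  classical
  have h1 : ∀ u : Fin n → I, cellEnergy u =
      ∫⁻ z : I × I, if cellIndex u z.1 = cellIndex u z.2 then 1 else 0 := fun u => by
    rw [lintegral_cellIndex_prod u fun i j => if i = j then 1 else 0]
    simp [cellEnergy, sq]
  have hm : Measurable fun y : (Fin n → I) × (I × I) =>
      if cellIndex y.1 y.2.1 = cellIndex y.1 y.2.2 then (1 : ℝ≥0∞) else 0 := by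
    refine Measurable.ite (measurableSet_eq_fun ?_ ?_) measurable_const measurable_const
    · exact measurable_cellIndex_uncurry.comp
        (measurable_fst.prodMk (measurable_fst.comp measurable_snd))
    · exact measurable_cellIndex_uncurry.comp
        (measurable_fst.prodMk (measurable_snd.comp measurable_snd))
  simp only [h1]
  rw [lintegral_lintegral_swap hm.aemeasurable]
  have h2 : ∀ z : I × I, (∫⁻ u : Fin n → I, if cellIndex u z.1 = cellIndex u z.2
      then (1 : ℝ≥0∞) else 0) ≤ ENNReal.ofReal ((1 - |(z.2 : ℝ) - z.1|) ^ n) +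
        ENNReal.ofReal (|(z.2 : ℝ) - z.1| ^ n) := by
    intro z
    refine le_trans (le_of_eq ?_) (volume_cellIndex_eq_le z.1 z.2)
    have hs : MeasurableSet {u : Fin n → I | cellIndex u z.1 = cellIndex u z.2} :=
      measurableSet_eq_fun
        (measurable_cellIndex_uncurry.comp (measurable_id.prodMk measurable_const))
        (measurable_cellIndex_uncurry.comp (measurable_id.prodMk measurable_const))
    rw [← lintegral_indicator_one hs]
    simp only [Set.indicator_apply, Set.mem_ofPred_eq, Pi.one_apply]
  refine (lintegral_mono h2).trans ?_
  rw [Measure.volume_eq_prod, lintegral_prod _ (by fun_prop)]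
  have h3 : ∀ v : I, ∫⁻ w : I, (ENNReal.ofReal ((1 - |(w : ℝ) - v|) ^ n) +
      ENNReal.ofReal (|(w : ℝ) - v| ^ n)) ≤ ENNReal.ofReal (4 / n) := by
    intro v
    rw [lintegral_add_left (by fun_prop)]
    have e1 := lintegral_abs_sub_le (g := fun t => ENNReal.ofReal ((1 - t) ^ n)) (by fun_prop) v
    have e2 := lintegral_abs_sub_le (g := fun t => ENNReal.ofReal (t ^ n)) (by fun_prop) v
    rw [setLIntegral_one_sub_pow_Icc] at e1
    rw [setLIntegral_pow_Icc] at e2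
    refine (add_le_add e1 e2).trans ?_
    have : (2 : ℝ≥0∞) = ENNReal.ofReal 2 := by simp
    rw [this, ← ENNReal.ofReal_mul (by norm_num), ← ENNReal.ofReal_add (by positivity)
      (by positivity)]
    refine ENNReal.ofReal_le_ofReal ?_
    have hn : (0 : ℝ) < n := by exact_mod_cast Nat.pos_of_ne_zero (NeZero.ne n)
    have : (1 : ℝ) / (n + 1) ≤ 1 / n := by gcongr; linarith
    calc _ = 4 * ((1 : ℝ) / (n + 1)) := by ring
      _ ≤ 4 * (1 / n) := by gcongr
      _ = _ := by ring
  refine (lintegral_mono h3).trans ?_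
  simp

theorem map_pair_eq_prod {n : ℕ} {i j : Fin n} (hij : i ≠ j) :
    (volume : Measure (Fin n → I)).map (fun u => (u i, u j)) = volume := by
  have h := (ProbabilityTheory.iIndepFun_pi (μ := fun _ : Fin n => (volume : Measure I))
    (X := fun _ => id) fun _ => aemeasurable_id).indepFun hij
  simp only [id] at h
  rw [ProbabilityTheory.indepFun_iff_map_prod_eq_prod_map_map (measurable_pi_apply i).aemeasurable
    (measurable_pi_apply j).aemeasurable] at h
  rw [volume_pi, h, Measure.pi_map_eval, Measure.pi_map_eval]
  simp [Measure.volume_eq_prod]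

/-- Distinct labels are independent, so their pair is uniform on the square. The diagonal is a null
set and must be controlled separately, but has only `n` terms. -/
theorem lintegral_sum_pair_le {n : ℕ} {f : I × I → ℝ≥0∞} (hf : Measurable f) :
    ∫⁻ u : Fin n → I, ∑ i, ∑ j, f (u i, u j) ≤
      (n : ℝ≥0∞) ^ 2 * (∫⁻ z, f z) + n * ∫⁻ x, f (x, x) := by
  have hm : ∀ i j, Measurable fun u : Fin n → I => f (u i, u j) := fun i j =>
    hf.comp ((measurable_pi_apply i).prodMk (measurable_pi_apply j))
  have h : ∀ i j : Fin n, ∫⁻ u : Fin n → I, f (u i, u j) ≤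
      (∫⁻ z, f z) + if i = j then ∫⁻ x, f (x, x) else 0 := by
    intro i j
    split_ifs with hij
    · subst hij
      refine le_trans (le_of_eq ?_) le_add_self
      exact (measurePreserving_eval (fun _ : Fin n => (volume : Measure I)) i).lintegral_comp
        (f := fun x => f (x, x)) (by fun_prop)
    · rw [add_zero, ← map_pair_eq_prod hij, lintegral_map hf (by fun_prop)]
  rw [lintegral_finsetSum _ fun i _ => Finset.measurable_sum _ fun j _ => hm i j]
  simp only [lintegral_finsetSum _ fun j _ => hm _ j]
  refine (Finset.sum_le_sum fun i _ => Finset.sum_le_sum fun j _ => h i j).trans (le_of_eq ?_)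
  simp [Finset.sum_add_distrib, sq, mul_assoc]

end Energy

/-! ### Events of high probability -/

/-- The property `P` of sampled graphs with at least one node holds with probability tending
to `1`. -/
def WithHighProbability (P : ∀ n, Sample (n + 1) → Prop) : Prop :=
  ∀ δ : ℝ, 0 < δ → ∃ N : ℕ, ∀ n, N ≤ n → volume {s | ¬ P n s} ≤ ENNReal.ofReal δ

section HighProbability

variable {P Q : ∀ n, Sample (n + 1) → Prop}

theorem WithHighProbability.mono (hP : WithHighProbability P) (h : ∀ n s, P n s → Q n s) :
    WithHighProbability Q := fun δ hδ =>
  (hP δ hδ).imp fun _ hN n hn => (measure_mono (Set.ofPred_subset_ofPred.2 fun s hs hPs => hs (h n s hPs))).trans (hN n hn)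

theorem WithHighProbability.and (hP : WithHighProbability P) (hQ : WithHighProbability Q) :
    WithHighProbability fun n s => P n s ∧ Q n s := by
  intro δ hδ
  obtain ⟨N, hN⟩ := hP (δ / 2) (by positivity)
  obtain ⟨M, hM⟩ := hQ (δ / 2) (by positivity)
  refine ⟨max N M, fun n hn => ?_⟩
  have hsub : {s : Sample (n + 1) | ¬ (P n s ∧ Q n s)} ⊆ {s | ¬ P n s} ∪ {s | ¬ Q n s} :=
    fun s hs => not_and_or.1 hs
  refine (measure_mono hsub).trans ((measure_union_le _ _).trans ((add_le_add
    (hN n ((le_max_left _ _).trans hn)) (hM n ((le_max_right _ _).trans hn))).trans ?_))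
  rw [← ENNReal.ofReal_add (by positivity) (by positivity), add_halves]

theorem WithHighProbability.forall_fin {p : ℕ} {P : Fin p → ∀ n, Sample (n + 1) → Prop}
    (hP : ∀ g, WithHighProbability (P g)) :
    WithHighProbability fun n s => ∀ g, P g n s := by
  induction p with
  | zero => exact fun δ _ => ⟨0, fun n _ => by simp⟩
  | succ p ih =>
    refine ((hP 0).and (ih fun g => hP g.succ)).mono fun n s h => ?_
    exact Fin.cases h.1 h.2

end HighProbability

theorem volume_labels_le {n : ℕ} (p : (Fin n → I) → Prop) {δ : ℝ≥0∞}
    (h : volume {u | p u} ≤ δ) : volume {s : Sample n | p s.1} ≤ δ := by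
  have : {s : Sample n | p s.1} = {u | p u} ×ˢ Set.univ := by ext; simp
  rw [this, Measure.volume_eq_prod, Measure.prod_prod]
  simpa using h

/-! ### Sampled functions converge in `L²` -/

theorem eLpNorm_four_pow {α : Type*} [MeasurableSpace α] {μ : Measure α} (f : α → ℝ) :
    eLpNorm f 4 μ ^ 4 = ∫⁻ a, (‖f a‖ₑ ^ 2) ^ 2 ∂μ := by
  have := eLpNorm_nnreal_pow_eq_lintegral (μ := μ) (f := f) (p := 4) (by norm_num)
  have e : ∀ x : ℝ≥0∞, (x ^ 2) ^ 2 = x ^ ((4 : ℝ≥0) : ℝ) := fun x => by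
    rw [← pow_mul, ← ENNReal.rpow_natCast]; norm_num
  simp only [e, ← this]
  rw [← ENNReal.rpow_natCast]
  norm_num

/-- The triangle inequality through `g`. The difference of `f` and `g` at the labels is the term
that needs the weighted Cauchy–Schwarz bound, and therefore fourth powers. -/
theorem eLpNorm_cellLabel_sub_le {n : ℕ} [NeZero n] (u : Fin n → I) {f g : I × I → ℝ}
    (hf : Measurable f) (hg : Measurable g) {a t t' : ℝ} (ha : 0 ≤ a) (ht : 0 ≤ t)
    (hta : t ^ 2 * t' ≤ a ^ 4) (h1 : cellEnergy u ≤ ENNReal.ofReal t)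
    (h2 : ∑ i, ∑ j, (‖f (u i, u j) - g (u i, u j)‖ₑ ^ 2) ^ 2 ≤ ENNReal.ofReal t')
    (hgu : eLpNorm (fun z => g (cellLabel u z.1, cellLabel u z.2) - g z) 2 volume ≤
      ENNReal.ofReal a)
    (hfg : eLpNorm (fun z => f z - g z) 2 volume ≤ ENNReal.ofReal a) :
    eLpNorm (fun z => f (cellLabel u z.1, cellLabel u z.2) - f z) 2 volume ≤
      ENNReal.ofReal (3 * a) := by
  have hl : Measurable fun z : I × I => (cellLabel u z.1, cellLabel u z.2) :=
    ((measurable_cellLabel u).comp measurable_fst).prodMk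
      ((measurable_cellLabel u).comp measurable_snd)
  have e1 : eLpNorm (fun z : I × I => f (cellLabel u z.1, cellLabel u z.2) -
      g (cellLabel u z.1, cellLabel u z.2)) 2 volume ≤ ENNReal.ofReal a := by
    rw [← ENNReal.pow_le_pow_left_iff two_ne_zero, ← ENNReal.pow_le_pow_left_iff two_ne_zero,
      eLpNorm_two_sq]
    refine (sq_lintegral_cellLabel_le u fun z => ‖f z - g z‖ₑ ^ 2).trans
      ((mul_le_mul' (pow_le_pow_left' h1 2) h2).trans ?_)
    rw [← ENNReal.ofReal_pow ht, ← ENNReal.ofReal_mul (by positivity),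
      ← ENNReal.ofReal_pow ha, ← ENNReal.ofReal_pow (by positivity), ← pow_mul]
    exact ENNReal.ofReal_le_ofReal hta
  have e3 : eLpNorm (fun z => g z - f z) 2 volume ≤ ENNReal.ofReal a :=
    (eLpNorm_sub_comm g f 2 volume).trans_le hfg
  have e : (fun z => f (cellLabel u z.1, cellLabel u z.2) - f z) =
      ((fun z : I × I => f (cellLabel u z.1, cellLabel u z.2) -
        g (cellLabel u z.1, cellLabel u z.2)) +
      fun z => g (cellLabel u z.1, cellLabel u z.2) - g z) + fun z => g z - f z := by
    funext z; simp only [Pi.add_apply]; ring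
  have m1 : Measurable fun z : I × I => f (cellLabel u z.1, cellLabel u z.2) -
      g (cellLabel u z.1, cellLabel u z.2) := (hf.comp hl).sub (hg.comp hl)
  have m2 : Measurable fun z : I × I => g (cellLabel u z.1, cellLabel u z.2) - g z :=
    (hg.comp hl).sub hg
  rw [e]
  refine (eLpNorm_add_le (m1.add m2).aestronglyMeasurable (hg.sub hf).aestronglyMeasurable
    one_le_two).trans ((add_le_add ((eLpNorm_add_le m1.aestronglyMeasurable
      m2.aestronglyMeasurable one_le_two).trans (add_le_add e1 hgu)) e3).trans (le_of_eq ?_))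
  rw [← ENNReal.ofReal_add ha ha, ← ENNReal.ofReal_add (by positivity) ha]
  congr 1; ring

/-- Continuous functions are handled by uniform continuity; a general `f` is approximated in `L⁴` by
one. Markov's inequality controls the cell energy and the fourth-power error summed over the labels;
the diagonal of that sum is negligible for large `n`. -/
theorem whp_eLpNorm_cellLabel_sub_le {f : I × I → ℝ} (hf : Measurable f) (hf4 : MemLp f 4)
    (hdiag : MemLp (fun x => f (x, x)) 4) {τ : ℝ} (hτ : 0 < τ) :
    WithHighProbability fun _ s =>
      eLpNorm (fun z => f (cellLabel s.1 z.1, cellLabel s.1 z.2) - f z) 2 volume ≤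
        ENNReal.ofReal τ := by
  intro δ hδ
  set δ₁ : ℝ := min δ 1 / 2 with hδ₁
  have hδ₁0 : 0 < δ₁ := by positivity
  have hδ₁1 : δ₁ ≤ 1 / 2 := by have := min_le_right δ 1; rw [hδ₁]; linarith
  -- Chosen so that the two Markov thresholds satisfy `t² t' = (τ / 3)⁴ δ₁ / 8`, at most `(τ / 3)⁴`.
  set β : ℝ := τ / 3 * δ₁ / 4 with hβ
  have hβ0 : 0 < β := by positivity
  obtain ⟨g, C, hgC, hgc, hg⟩ : ∃ (g : I × I → ℝ) (C : ℝ), (∀ z, ‖g z‖ ≤ C) ∧ Continuous g ∧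
      eLpNorm (fun z => f z - g z) 4 volume ≤ ENNReal.ofReal β := by
    obtain ⟨g, hg, -⟩ := hf4.exists_boundedContinuous_eLpNorm_sub_le (by norm_num)
      (ε := ENNReal.ofReal β) (by simpa using hβ0)
    exact ⟨g, ‖g‖, g.norm_coe_le_norm, g.continuous, hg⟩
  have hgm : Measurable g := hgc.measurable
  obtain ⟨κ, hκ0, hκ⟩ := exists_eLpNorm_cellLabel_sub_le hgc (τ := τ / 3) (by positivity)
  set d : I × I → ℝ≥0∞ := fun z => ‖f z - g z‖ₑ ^ 2 with hd
  have hdm : Measurable d := (hf.sub hgm).enorm.pow_const 2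
  have hA : ∫⁻ z, d z ^ 2 ≤ ENNReal.ofReal (β ^ 4) := by
    have := pow_le_pow_left' hg 4
    rw [eLpNorm_four_pow] at this
    rw [ENNReal.ofReal_pow hβ0.le]
    exact this
  have hD : ∫⁻ x, d (x, x) ^ 2 < ⊤ := by
    have hgd : MemLp (fun x : I => g (x, x)) 4 := by
      exact MemLp.of_bound (by fun_prop) C (Filter.Eventually.of_forall fun x => hgC _)
    have := (hdiag.sub hgd).2
    have h2 := eLpNorm_four_pow (μ := (volume : Measure I)) ((fun x => f (x, x)) - fun x => g (x, x))
    simp only [hd]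
    simp only [Pi.sub_apply] at h2
    rw [← h2]
    exact ENNReal.pow_lt_top this
  set D : ℝ := (∫⁻ x, d (x, x) ^ 2).toReal with hDdef
  obtain ⟨N, hN⟩ := exists_nat_ge (max (D / β ^ 4) (4 / (δ₁ * κ)))
  refine ⟨N, fun n hn => ?_⟩
  have hnN : (N : ℝ) ≤ (n + 1 : ℕ) := by exact_mod_cast hn.trans (Nat.le_succ n)
  set m : ℝ := ((n + 1 : ℕ) : ℝ) with hm
  have hm0 : 0 < m := by rw [hm]; positivity
  have hmD : D ≤ m * β ^ 4 := by
    have := ((le_max_left _ _).trans hN).trans hnN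
    rwa [div_le_iff₀ (by positivity)] at this
  have hmκ : 4 / (m * δ₁) ≤ κ := by
    have := ((le_max_right _ _).trans hN).trans hnN
    rw [div_le_iff₀ (by positivity)] at this ⊢
    linarith
  -- The means `4 / m` and at most `2 m² β⁴`, each divided by `δ₁`; the number of nodes cancels in
  -- `t² t'`.
  set t : ℝ := 4 / (m * δ₁) with ht
  set t' : ℝ := 2 * m ^ 2 * β ^ 4 / δ₁ with ht'
  have ht0 : 0 < t := by positivity
  have ht0' : 0 < t' := by positivity
  set Q : (Fin (n + 1) → I) → ℝ≥0∞ := fun u => ∑ i, ∑ j, d (u i, u j) ^ 2 with hQ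
  have hQm : Measurable Q := Finset.measurable_sum _ fun i _ => Finset.measurable_sum _ fun j _ =>
    (hdm.comp ((measurable_pi_apply i).prodMk (measurable_pi_apply j))).pow_const 2
  have hP1 : volume {u : Fin (n + 1) → I | ENNReal.ofReal t ≤ cellEnergy u} ≤
      ENNReal.ofReal δ₁ := by
    refine (meas_ge_le_lintegral_div measurable_cellEnergy.aemeasurable (by simpa using ht0)
      ENNReal.ofReal_ne_top).trans (ENNReal.div_le_of_le_mul ?_)
    refine (lintegral_cellEnergy_le (n + 1)).trans ?_
    rw [← ENNReal.ofReal_mul hδ₁0.le]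
    refine ENNReal.ofReal_le_ofReal (le_of_eq ?_)
    rw [ht]; field_simp
    exact hm
  have hP2 : volume {u : Fin (n + 1) → I | ENNReal.ofReal t' ≤ Q u} ≤ ENNReal.ofReal δ₁ := by
    refine (meas_ge_le_lintegral_div hQm.aemeasurable (by simpa using ht0')
      ENNReal.ofReal_ne_top).trans (ENNReal.div_le_of_le_mul ?_)
    refine (lintegral_sum_pair_le (hdm.pow_const 2)).trans ?_
    refine (add_le_add (mul_le_mul' le_rfl hA)
      (mul_le_mul' le_rfl (ENNReal.ofReal_toReal hD.ne).ge)).trans ?_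
    rw [← ENNReal.ofReal_natCast, ← hm, ← ENNReal.ofReal_pow hm0.le,
      ← ENNReal.ofReal_mul (by positivity), ← ENNReal.ofReal_mul (by positivity),
      ← ENNReal.ofReal_add (by positivity) (by positivity), ← ENNReal.ofReal_mul hδ₁0.le]
    refine ENNReal.ofReal_le_ofReal ?_
    have : δ₁ * t' = 2 * m ^ 2 * β ^ 4 := by rw [ht']; field_simp
    rw [this]
    nlinarith [mul_le_mul_of_nonneg_left hmD hm0.le]
  have hgood : ∀ u : Fin (n + 1) → I, ¬ ENNReal.ofReal t ≤ cellEnergy u →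
      ¬ ENNReal.ofReal t' ≤ Q u →
      eLpNorm (fun z => f (cellLabel u z.1, cellLabel u z.2) - f z) 2 volume ≤
        ENNReal.ofReal τ := by
    intro u h1 h2
    have := eLpNorm_cellLabel_sub_le u hf hgm (a := τ / 3) (t := t) (t' := t') (by positivity)
      ht0.le ?_ (not_le.1 h1).le (not_le.1 h2).le
      (hκ u ((not_le.1 h1).le.trans (ENNReal.ofReal_le_ofReal hmκ))) ?_
    · rwa [mul_div_cancel₀ τ (by norm_num : (3 : ℝ) ≠ 0)] at this
    · have : t ^ 2 * t' = (τ / 3) ^ 4 * δ₁ / 8 := by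
        rw [ht, ht', hβ]; field_simp; ring
      rw [this]
      have : 0 ≤ (τ / 3) ^ 4 := by positivity
      nlinarith
    · refine (eLpNorm_le_eLpNorm_of_exponent_le (by norm_num)
        (hf.sub hgm).aestronglyMeasurable).trans (hg.trans (ENNReal.ofReal_le_ofReal ?_))
      rw [hβ]; nlinarith
  refine volume_labels_le (fun u => ¬ eLpNorm (fun z => f (cellLabel u z.1, cellLabel u z.2) -
    f z) 2 volume ≤ ENNReal.ofReal τ) ?_
  refine (measure_mono (t := {u | ENNReal.ofReal t ≤ cellEnergy u} ∪
    {u | ENNReal.ofReal t' ≤ Q u}) fun u hu => ?_).trans ((measure_union_le _ _).trans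
      ((add_le_add hP1 hP2).trans ?_))
  · by_contra hcon
    rw [Set.mem_union, not_or] at hcon
    exact hu (hgood u hcon.1 hcon.2)
  · rw [← ENNReal.ofReal_add hδ₁0.le hδ₁0.le]
    exact ENNReal.ofReal_le_ofReal (by have := min_le_left δ 1; rw [hδ₁]; linarith)

theorem whp_eLpNorm_comp_cellLabel_sub_le {f : I → ℝ} (hf : Measurable f) (hf4 : MemLp f 4)
    {τ : ℝ} (hτ : 0 < τ) :
    WithHighProbability fun _ s =>
      eLpNorm (fun v => f (cellLabel s.1 v) - f v) 2 volume ≤ ENNReal.ofReal τ := by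
  have hfst := measurePreserving_fst (μ := (volume : Measure I)) (ν := (volume : Measure I))
  refine (whp_eLpNorm_cellLabel_sub_le (f := fun z => f z.1) (hf.comp measurable_fst)
    (hf4.comp_measurePreserving hfst) hf4 hτ).mono fun n s h => ?_
  refine le_trans (le_of_eq ?_) h
  exact (eLpNorm_comp_measurePreserving (g := fun v => f (cellLabel s.1 v) - f v)
    ((hf.comp (measurable_cellLabel s.1)).sub hf).aestronglyMeasurable hfst).symm

/-! ### The edge noise -/

/-- Grouping the factors by coordinate and applying Fubini, the coordinate `c m` carries the single
mean-zero factor `f m`. -/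
theorem integral_prod_eval_eq_zero {α ι : Type*} [Fintype α] [DecidableEq α] [Fintype ι]
    [DecidableEq ι] (c : ι → α) (f : ι → I → ℝ) (m : ι) (hc : ∀ m', c m' = c m → m' = m)
    (hf : ∫ x, f m x = 0) : ∫ e : α → I, ∏ i, f i (e (c i)) = 0 := by
  have h : ∀ e : α → I, ∏ i, f i (e (c i)) = ∏ a, ∏ i with c i = a, f i (e a) := fun e => by
    rw [← Finset.prod_fiberwise Finset.univ c]
    refine Finset.prod_congr rfl fun a _ => Finset.prod_congr rfl fun i hi => ?_
    rw [(Finset.mem_filter.1 hi).2]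
  simp only [h]
  rw [volume_pi, integral_fintype_prod_eq_prod fun a x => ∏ i with c i = a, f i x]
  refine Finset.prod_eq_zero (Finset.mem_univ (c m)) ?_
  have : Finset.univ.filter (fun i => c i = c m) = {m} := by
    ext i; simp only [Finset.mem_filter, Finset.mem_univ, true_and, Finset.mem_singleton]
    exact ⟨hc i, fun h => h ▸ rfl⟩
  rw [this]
  simpa using hf

/-- The centred indicator of an event of probability `w`. -/
def centredBernoulli (w : ℝ) (x : I) : ℝ := (if (x : ℝ) < w then 1 else 0) - w

theorem measurable_centredBernoulli (w : ℝ) : Measurable (centredBernoulli w) :=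
  (Measurable.ite (measurableSet_lt measurable_subtype_coe measurable_const) measurable_const
    measurable_const).sub_const w

theorem abs_centredBernoulli_le {w : ℝ} (hw : w ∈ Set.Icc (0 : ℝ) 1) (x : I) :
    |centredBernoulli w x| ≤ 1 := by
  unfold centredBernoulli
  have := hw.1; have := hw.2
  rw [abs_le]
  split_ifs <;> constructor <;> linarith

theorem integral_centredBernoulli {w : ℝ} (hw : w ∈ Set.Icc (0 : ℝ) 1) :
    ∫ x, centredBernoulli w x = 0 := by
  have hset : {x : I | (x : ℝ) < w} = Set.Iio (⟨w, hw⟩ : I) := by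
    ext x; simp [← Subtype.coe_lt_coe]
  have hind : ∀ x : I, (if (x : ℝ) < w then (1 : ℝ) else 0) =
      (Set.Iio (⟨w, hw⟩ : I)).indicator 1 x := fun x => by
    classical
    rw [← hset]; simp [Set.indicator_apply]
  unfold centredBernoulli
  simp only [hind]
  have hi : Integrable ((Set.Iio (⟨w, hw⟩ : I)).indicator (1 : I → ℝ)) :=
    (integrable_const (1 : ℝ)).indicator measurableSet_Iio
  rw [integral_sub hi (integrable_const w),
    integral_indicator_one measurableSet_Iio]
  simp [measureReal_def, hw.1]

section Noise

variable {n : ℕ} {P : Fin n → Fin n → ℝ}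

/-- The difference of a sampled adjacency matrix and its expectation `P`. -/
def edgeNoise (P : Fin n → Fin n → ℝ) (e : Fin n × Fin n → I) (i j : Fin n) : ℝ :=
  centredBernoulli (P i j) (e (min i j, max i j))

theorem edgeNoise_symm (hs : ∀ i j, P i j = P j i) (e : Fin n × Fin n → I) (i j : Fin n) :
    edgeNoise P e i j = edgeNoise P e j i := by
  simp only [edgeNoise, hs i j, min_comm i j, max_comm i j]

theorem measurable_edgeNoise (i j : Fin n) : Measurable fun e => edgeNoise P e i j :=
  (measurable_centredBernoulli _).comp (measurable_pi_apply _)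

theorem minmax_eq {i j k l : Fin n} (h : (min i j, max i j) = (min k l, max k l)) :
    i = k ∧ j = l ∨ i = l ∧ j = k := by
  rw [Prod.mk.injEq] at h
  rcases le_total i j with h1 | h1 <;> rcases le_total k l with h2 | h2 <;>
    simp only [min_eq_left h1, max_eq_right h1, min_eq_right h1, max_eq_left h1,
      min_eq_left h2, max_eq_right h2, min_eq_right h2, max_eq_left h2] at h <;> tauto

/-- In the closed walk through `i, j, k, l` some edge is used exactly once unless opposite vertices
coincide; that independent centred factor kills the mean. -/
theorem integral_edgeNoise_four (hP : ∀ i j, P i j ∈ Set.Icc (0 : ℝ) 1) {i j k l : Fin n}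
    (hik : i ≠ k) (hjl : j ≠ l) :
    ∫ e, edgeNoise P e i j * edgeNoise P e j k * edgeNoise P e i l * edgeNoise P e l k = 0 := by
  let c : Fin 4 → Fin n × Fin n :=
    ![(min i j, max i j), (min j k, max j k), (min i l, max i l), (min l k, max l k)]
  let f : Fin 4 → I → ℝ := ![centredBernoulli (P i j), centredBernoulli (P j k),
    centredBernoulli (P i l), centredBernoulli (P l k)]
  have h : ∀ e : Fin n × Fin n → I, edgeNoise P e i j * edgeNoise P e j k * edgeNoise P e i l *
      edgeNoise P e l k = ∏ m, f m (e (c m)) := fun e => by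
    simp [Fin.prod_univ_four, f, c, edgeNoise]
  simp only [h]
  have hf : ∀ m, ∫ x, f m x = 0 := by
    intro m; fin_cases m <;> exact integral_centredBernoulli (hP _ _)
  -- Edge `ij` can coincide only with `lk`, which forces `i = l` and `j = k`; then the loop at `j`
  -- is the edge used once.
  by_cases h03 : c 0 = c 3
  · refine integral_prod_eval_eq_zero c f 1 (fun m hm => ?_) (hf 1)
    have h1 := minmax_eq h03
    fin_cases m
    · have := minmax_eq hm; grind
    · rfl
    · have := minmax_eq hm; grind
    · have := minmax_eq hm; grind
  · refine integral_prod_eval_eq_zero c f 0 (fun m hm => ?_) (hf 0)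
    fin_cases m
    · rfl
    · have := minmax_eq hm; grind
    · have := minmax_eq hm; grind
    · exact absurd hm.symm h03

theorem abs_edgeNoise_le (hP : ∀ i j, P i j ∈ Set.Icc (0 : ℝ) 1) (e : Fin n × Fin n → I)
    (i j : Fin n) : |edgeNoise P e i j| ≤ 1 :=
  abs_centredBernoulli_le (hP i j) _

theorem abs_edgeNoise_four_le (hP : ∀ i j, P i j ∈ Set.Icc (0 : ℝ) 1) (i j k l : Fin n)
    (e : Fin n × Fin n → I) :
    ‖edgeNoise P e i j * edgeNoise P e j k * edgeNoise P e i l * edgeNoise P e l k‖ ≤ 1 := by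
  rw [norm_mul, norm_mul, norm_mul]
  exact mul_le_one₀ (mul_le_one₀ (mul_le_one₀ (abs_edgeNoise_le hP _ _ _) (norm_nonneg _)
    (abs_edgeNoise_le hP _ _ _)) (norm_nonneg _) (abs_edgeNoise_le hP _ _ _)) (norm_nonneg _)
      (abs_edgeNoise_le hP _ _ _)

theorem integrable_edgeNoise_four (hP : ∀ i j, P i j ∈ Set.Icc (0 : ℝ) 1) (i j k l : Fin n) :
    Integrable fun e => edgeNoise P e i j * edgeNoise P e j k * edgeNoise P e i l *
      edgeNoise P e l k :=
  Integrable.of_bound ((((measurable_edgeNoise i j).mul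
    (measurable_edgeNoise j k)).mul (measurable_edgeNoise i l)).mul
      (measurable_edgeNoise l k)).aestronglyMeasurable 1
      (Filter.Eventually.of_forall (abs_edgeNoise_four_le hP i j k l))

theorem integral_edgeNoise_four_le (hP : ∀ i j, P i j ∈ Set.Icc (0 : ℝ) 1) (i j k l : Fin n) :
    ∫ e, edgeNoise P e i j * edgeNoise P e j k * edgeNoise P e i l * edgeNoise P e l k ≤
      (if i = k then 1 else 0) + if j = l then 1 else 0 := by
  by_cases h : i ≠ k ∧ j ≠ l
  · rw [integral_edgeNoise_four hP h.1 h.2]; positivity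
  · have h1 : (1 : ℝ) ≤ (if i = k then 1 else 0) + if j = l then 1 else 0 := by
      rcases not_and_or.1 h with h | h <;> rw [not_not] at h <;> simp only [h, if_true]
      · have : (0 : ℝ) ≤ if j = l then 1 else 0 := by positivity
        linarith
      · have : (0 : ℝ) ≤ if i = k then 1 else 0 := by positivity
        linarith
    refine le_trans ?_ h1
    have h2 := norm_integral_le_of_norm_le_const (μ := volume)
      (Filter.Eventually.of_forall (abs_edgeNoise_four_le hP i j k l))
    rw [probReal_univ, mul_one] at h2
    exact (le_abs_self _).trans h2

/-- The fourth moment bound behind the concentration of the sampled graph in operator norm. -/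
theorem integral_sum_sq_edgeNoise_le (hP : ∀ i j, P i j ∈ Set.Icc (0 : ℝ) 1) {a : Fin n → ℝ}
    (ha : ∀ i, 0 ≤ a i) (ha1 : ∑ i, a i = 1) :
    (Integrable fun e => ∑ i, ∑ k, a i * a k *
        (∑ j, a j * (edgeNoise P e i j * edgeNoise P e j k)) ^ 2) ∧
      ∫ e, ∑ i, ∑ k, a i * a k * (∑ j, a j * (edgeNoise P e i j * edgeNoise P e j k)) ^ 2 ≤
        2 * ∑ i, a i ^ 2 := by
  have hsq : ∀ e, (∑ i, ∑ k, a i * a k *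
      (∑ j, a j * (edgeNoise P e i j * edgeNoise P e j k)) ^ 2) =
      ∑ i, ∑ k, ∑ j, ∑ l, (a i * a k * (a j * a l)) * (edgeNoise P e i j * edgeNoise P e j k *
        edgeNoise P e i l * edgeNoise P e l k) := by
    intro e
    refine Finset.sum_congr rfl fun i _ => Finset.sum_congr rfl fun k _ => ?_
    rw [sq, Finset.sum_mul_sum, Finset.mul_sum]
    refine Finset.sum_congr rfl fun j _ => ?_
    rw [Finset.mul_sum]
    exact Finset.sum_congr rfl fun l _ => by ring
  simp only [hsq]
  have hint : ∀ i j k l, Integrable fun e => (a i * a k * (a j * a l)) *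
      (edgeNoise P e i j * edgeNoise P e j k * edgeNoise P e i l * edgeNoise P e l k) :=
    fun i j k l => (integrable_edgeNoise_four hP i j k l).const_mul _
  refine ⟨integrable_finsetSum _ fun i _ => integrable_finsetSum _ fun k _ =>
    integrable_finsetSum _ fun j _ => integrable_finsetSum _ fun l _ => hint i j k l, ?_⟩
  rw [integral_finsetSum _ fun i _ => integrable_finsetSum _ fun k _ =>
    integrable_finsetSum _ fun j _ => integrable_finsetSum _ fun l _ => hint i j k l]
  have hle : ∀ i, ∫ e, ∑ k, ∑ j, ∑ l, (a i * a k * (a j * a l)) * (edgeNoise P e i j *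
      edgeNoise P e j k * edgeNoise P e i l * edgeNoise P e l k) ≤
      ∑ k, ∑ j, ∑ l, (a i * a k * (a j * a l)) *
        ((if i = k then 1 else 0) + if j = l then 1 else 0) := by
    intro i
    rw [integral_finsetSum _ fun k _ => integrable_finsetSum _ fun j _ =>
      integrable_finsetSum _ fun l _ => hint i j k l]
    refine Finset.sum_le_sum fun k _ => ?_
    rw [integral_finsetSum _ fun j _ => integrable_finsetSum _ fun l _ => hint i j k l]
    refine Finset.sum_le_sum fun j _ => ?_
    rw [integral_finsetSum _ fun l _ => hint i j k l]
    refine Finset.sum_le_sum fun l _ => ?_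
    rw [integral_const_mul]
    exact mul_le_mul_of_nonneg_left (integral_edgeNoise_four_le hP i j k l)
      (mul_nonneg (mul_nonneg (ha _) (ha _)) (mul_nonneg (ha _) (ha _)))
  refine (Finset.sum_le_sum fun i _ => hle i).trans (le_of_eq ?_)
  simp only [mul_add, Finset.sum_add_distrib, mul_ite, mul_one, mul_zero, Finset.sum_ite_eq,
    Finset.mem_univ, if_true]
  -- Each of the coincidences `i = k` and `j = l` leaves `∑ a i ^ 2`, since the free weights sum to
  -- 1.
  have e1 : ∀ i, ∑ k, ∑ j, ∑ l, (if i = k then a i * a k * (a j * a l) else 0) = a i ^ 2 := by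
    intro i
    rw [Finset.sum_eq_single i (fun k _ hk => by simp [hk.symm]) (by simp)]
    simp only [if_true, ← Finset.mul_sum, ← Finset.sum_mul, ha1]
    ring
  have e2 : ∀ i, ∑ k, ∑ j, a i * a k * (a j * a j) = a i * ∑ j, a j ^ 2 := by
    intro i
    simp only [← Finset.mul_sum, ← Finset.sum_mul, ha1, sq]
    ring
  simp only [e1, e2, ← Finset.sum_mul, ha1]
  ring

end Noise

/-! ### Convergence of the sampled graphon in operator norm -/

section Sampled

variable {n : ℕ}

theorem integral_cellIndex [NeZero n] (u : Fin n → I) (f : Fin n → ℝ) :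
    ∫ v, f (cellIndex u v) = ∑ i, volume.real (cell u i) * f i := by
  have h : ∀ v, f (cellIndex u v) = ∑ i, (cell u i).indicator (fun _ => f i) v := fun v => by
    classical
    simp [Set.indicator_apply, mem_cell_iff]
  simp only [h]
  rw [integral_finsetSum _ fun i _ => (integrable_const _).indicator (measurableSet_cell u i)]
  refine Finset.sum_congr rfl fun i _ => ?_
  rw [integral_indicator_const _ (measurableSet_cell u i), smul_eq_mul]

theorem sum_volume_real_cell [NeZero n] (u : Fin n → I) : ∑ i, volume.real (cell u i) = 1 := by
  have := integral_cellIndex u fun _ => 1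
  simpa using this.symm

/-- The matrix of edge probabilities at the labels `u`. -/
def labelMatrix (W : Graphon) (u : Fin n → I) (i j : Fin n) : ℝ := W.toFun (u i) (u j)

/-- The squared `L²` norm of the square of the noise kernel. -/
def noiseEnergy (W : Graphon) (s : Sample n) : ℝ :=
  ∑ i, ∑ k, volume.real (cell s.1 i) * volume.real (cell s.1 k) *
    (∑ j, volume.real (cell s.1 j) * (edgeNoise (labelMatrix W s.1) s.2 i j *
      edgeNoise (labelMatrix W s.1) s.2 j k)) ^ 2

theorem measurable_noiseEnergy (W : Graphon) : Measurable (noiseEnergy (n := n) W) := by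
  have ha : ∀ i, Measurable fun s : Sample n => volume.real (cell s.1 i) := fun i =>
    ((measurable_volume_cell i).comp measurable_fst).ennreal_toReal
  have he : ∀ i j, Measurable fun s : Sample n => edgeNoise (labelMatrix W s.1) s.2 i j := by
    intro i j
    have hw : Measurable fun s : Sample n => Function.uncurry W.toFun (s.1 i, s.1 j) :=
      W.measurable'.comp (((measurable_pi_apply i).comp measurable_fst).prodMk
        ((measurable_pi_apply j).comp measurable_fst))
    have hx : Measurable fun s : Sample n => ((s.2 (min i j, max i j) : I) : ℝ) :=
      measurable_subtype_coe.comp ((measurable_pi_apply _).comp measurable_snd)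
    exact (Measurable.ite (measurableSet_lt hx hw) measurable_const measurable_const).sub hw
  exact Finset.measurable_sum _ fun i _ => Finset.measurable_sum _ fun k _ =>
    ((ha i).mul (ha k)).mul ((Finset.measurable_sum _ fun j _ =>
      (ha j).mul ((he i j).mul (he j k))).pow_const 2)

/-- For fixed labels the cell lengths are deterministic weights of total mass 1, so the edge average
is at most twice the cell energy; then the labels are averaged. -/
theorem lintegral_noiseEnergy_le (W : Graphon) [NeZero n] :
    ∫⁻ s : Sample n, ENNReal.ofReal (noiseEnergy W s) ≤ ENNReal.ofReal (8 / n) := by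
  rw [Measure.volume_eq_prod, lintegral_prod _
    (measurable_noiseEnergy W).ennreal_ofReal.aemeasurable]
  have h : ∀ u : Fin n → I, ∫⁻ e, ENNReal.ofReal (noiseEnergy W (u, e)) ≤ 2 * cellEnergy u := by
    intro u
    obtain ⟨h1, h2⟩ := integral_sum_sq_edgeNoise_le (P := labelMatrix W u)
      (fun i j => W.mem_Icc' _ _) (a := fun i => volume.real (cell u i))
      (fun i => measureReal_nonneg) (sum_volume_real_cell u)
    unfold noiseEnergy
    rw [← ofReal_integral_eq_lintegral_ofReal h1 (Filter.Eventually.of_forall fun e =>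
      Finset.sum_nonneg fun i _ => Finset.sum_nonneg fun k _ => by positivity)]
    refine (ENNReal.ofReal_le_ofReal h2).trans (le_of_eq ?_)
    rw [ENNReal.ofReal_mul (by norm_num), ENNReal.ofReal_sum_of_nonneg fun i _ => by positivity,
      cellEnergy]
    rw [ENNReal.ofReal_ofNat]
    refine congrArg _ (Finset.sum_congr rfl fun i _ => ?_)
    rw [ENNReal.ofReal_pow measureReal_nonneg, ofReal_measureReal]
  refine (lintegral_mono h).trans ?_
  rw [lintegral_const_mul _ measurable_cellEnergy]
  refine (mul_le_mul' le_rfl (lintegral_cellEnergy_le n)).trans (le_of_eq ?_)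
  have : (2 : ℝ≥0∞) = ENNReal.ofReal 2 := by simp
  rw [this, ← ENNReal.ofReal_mul (by norm_num)]
  congr 1; ring

/-- The graphon evaluated at the labels of the cells. -/
def labelKernel (W : Graphon) [NeZero n] (u : Fin n → I) (x y : I) : ℝ :=
  W.toFun (cellLabel u x) (cellLabel u y)

theorem measurable_labelKernel (W : Graphon) [NeZero n] (u : Fin n → I) :
    Measurable (Function.uncurry (labelKernel W u)) :=
  W.measurable'.comp (((measurable_cellLabel u).comp measurable_fst).prodMk
    ((measurable_cellLabel u).comp measurable_snd))

theorem isKernel_labelKernel (W : Graphon) [NeZero n] (u : Fin n → I) :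
    IsKernel (labelKernel W u) :=
  ⟨measurable_labelKernel W u, fun _ _ => W.isKernel.abs_le _ _⟩

theorem isKernel_labelKernel_sub (W : Graphon) [NeZero n] (u : Fin n → I) :
    IsKernel fun x y => labelKernel W u x y - W.toFun x y where
  measurable := (measurable_labelKernel W u).sub W.measurable'
  abs_le x y := by
    have h1 := W.mem_Icc' (cellLabel u x) (cellLabel u y)
    have h2 := W.mem_Icc' x y
    rw [labelKernel, abs_le]
    constructor <;> linarith [h1.1, h1.2, h2.1, h2.2]

theorem sampledAdj_symm (W : Graphon) (s : Sample n) (i j : Fin n) :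
    sampledAdj W s i j = sampledAdj W s j i := by
  simp only [sampledAdj, min_comm i j, max_comm i j, W.symm' (s.1 i) (s.1 j)]

theorem isKernel_sampledGraphon (W : Graphon) [NeZero n] (s : Sample n) :
    IsKernel (sampledGraphon W s) where
  measurable := measurable_inducedKernel _ _
  abs_le x y := by
    rw [sampledGraphon, inducedKernel_apply, sampledAdj]
    split_ifs <;> simp

theorem sampledGraphon_symm (W : Graphon) [NeZero n] (s : Sample n) (x y : I) :
    sampledGraphon W s x y = sampledGraphon W s y x := by
  simp only [sampledGraphon, inducedKernel_apply, sampledAdj_symm W s (cellIndex s.1 x)]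

theorem sampledGraphon_sub_labelKernel (W : Graphon) [NeZero n] (s : Sample n) (x y : I) :
    sampledGraphon W s x y - labelKernel W s.1 x y =
      edgeNoise (labelMatrix W s.1) s.2 (cellIndex s.1 x) (cellIndex s.1 y) := by
  rw [sampledGraphon, inducedKernel_apply]
  rfl

theorem isKernel_noise (W : Graphon) [NeZero n] (s : Sample n) :
    IsKernel fun x y => sampledGraphon W s x y - labelKernel W s.1 x y where
  measurable := (isKernel_sampledGraphon W s).measurable.sub (measurable_labelKernel W s.1)
  abs_le x y := by
    rw [sampledGraphon_sub_labelKernel]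
    exact abs_edgeNoise_le (fun i j => W.mem_Icc' _ _) _ _ _

/-- The noise kernel is constant on products of cells, and so is its composition with itself; the
`L²` integral becomes the finite sum defining `noiseEnergy`. -/
theorem norm_kernelOp_noise_pow_four_le (W : Graphon) [NeZero n] (s : Sample n) :
    ENNReal.ofReal (‖kernelOp (isKernel_noise W s)‖ ^ 4) ≤ ENNReal.ofReal (noiseEnergy W s) := by
  refine (norm_kernelOp_pow_four_le (isKernel_noise W s) fun x y => ?_).trans (le_of_eq ?_)
  · simp only [sampledGraphon_sub_labelKernel]
    exact edgeNoise_symm (fun i j => W.symm' _ _) _ _ _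
  · have h : ∀ x y, kernelSq (fun x y => sampledGraphon W s x y - labelKernel W s.1 x y) x y =
        ∑ j, volume.real (cell s.1 j) * (edgeNoise (labelMatrix W s.1) s.2 (cellIndex s.1 x) j *
          edgeNoise (labelMatrix W s.1) s.2 j (cellIndex s.1 y)) := fun x y => by
      simp only [kernelSq, sampledGraphon_sub_labelKernel]
      exact integral_cellIndex s.1 fun j => edgeNoise (labelMatrix W s.1) s.2 (cellIndex s.1 x) j *
        edgeNoise (labelMatrix W s.1) s.2 j (cellIndex s.1 y)
    simp only [h]
    rw [lintegral_cellIndex_prod s.1 fun i k => ‖∑ j, volume.real (cell s.1 j) *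
      (edgeNoise (labelMatrix W s.1) s.2 i j * edgeNoise (labelMatrix W s.1) s.2 j k)‖ₑ ^ 2,
      noiseEnergy, ENNReal.ofReal_sum_of_nonneg fun i _ =>
        Finset.sum_nonneg fun k _ => by positivity]
    refine Finset.sum_congr rfl fun i _ => ?_
    rw [ENNReal.ofReal_sum_of_nonneg fun k _ => by positivity]
    refine Finset.sum_congr rfl fun k _ => ?_
    rw [ENNReal.ofReal_mul (by positivity), ENNReal.ofReal_mul (by positivity),
      ofReal_measureReal, ofReal_measureReal, ← ofReal_norm, ← ENNReal.ofReal_pow (norm_nonneg _),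
      Real.norm_eq_abs, sq_abs]

/-- The graphon at the cell labels is interposed. The noise is measured in operator norm, while the
deterministic error is small already in `L²`, which dominates the operator norm. -/
theorem norm_kernelOp_sub_sampledGraphon_le (W : Graphon) [NeZero n] (s : Sample n) {τ : ℝ}
    (hτ : 0 ≤ τ) (h1 : ‖kernelOp (isKernel_noise W s)‖ ≤ τ)
    (h2 : eLpNorm (fun z : I × I => W.toFun (cellLabel s.1 z.1) (cellLabel s.1 z.2) -
      W.toFun z.1 z.2) 2 volume ≤ ENNReal.ofReal τ) :
    ‖kernelOp W.isKernel - kernelOp (isKernel_sampledGraphon W s)‖ ≤ 2 * τ := by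
  have e1 := kernelOp_sub (isKernel_sampledGraphon W s) (isKernel_labelKernel W s.1)
    (isKernel_noise W s) fun _ _ => rfl
  have e2 := kernelOp_sub (isKernel_labelKernel W s.1) W.isKernel
    (isKernel_labelKernel_sub W s.1) fun _ _ => rfl
  have h3 : ‖kernelOp (isKernel_labelKernel_sub W s.1)‖ ≤ τ :=
    (norm_kernelOp_le _).trans (ENNReal.toReal_le_of_le_ofReal hτ h2)
  have e : kernelOp W.isKernel - kernelOp (isKernel_sampledGraphon W s) =
      -(kernelOp (isKernel_noise W s) + kernelOp (isKernel_labelKernel_sub W s.1)) := by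
    rw [e1, e2]; abel
  rw [e, norm_neg, two_mul]
  exact (norm_add_le _ _).trans (add_le_add h1 h3)

end Sampled

/-! ### High-probability bounds for the sampled graphon and signals. -/

theorem whp_norm_kernelOp_noise_le (W : Graphon) {τ : ℝ} (hτ : 0 < τ) :
    WithHighProbability fun _ s => ‖kernelOp (isKernel_noise W s)‖ ≤ τ := by
  intro δ hδ
  obtain ⟨N, hN⟩ := exists_nat_ge (8 / (δ * τ ^ 4))
  refine ⟨N, fun n hn => ?_⟩
  -- The event is enlarged to one about `noiseEnergy`, which is measurable, so Markov's inequality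
  -- applies without measurability of the operator norm.
  refine (measure_mono (t := {s : Sample (n + 1) | ENNReal.ofReal (τ ^ 4) ≤
    ENNReal.ofReal (noiseEnergy W s)}) fun s hs => ?_).trans
    ((meas_ge_le_lintegral_div (measurable_noiseEnergy W).ennreal_ofReal.aemeasurable
      (ENNReal.ofReal_pos.2 (by positivity)).ne' ENNReal.ofReal_ne_top).trans (ENNReal.div_le_of_le_mul ?_))
  · have hs' : τ < ‖kernelOp (isKernel_noise W s)‖ := not_le.1 hs
    exact (ENNReal.ofReal_le_ofReal (pow_le_pow_left₀ hτ.le hs'.le 4)).trans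
      (norm_kernelOp_noise_pow_four_le W s)
  · refine (lintegral_noiseEnergy_le W).trans ?_
    rw [← ENNReal.ofReal_mul hδ.le]
    refine ENNReal.ofReal_le_ofReal ?_
    have hnN : (N : ℝ) ≤ (n + 1 : ℕ) := by exact_mod_cast hn.trans (Nat.le_succ n)
    have := hN.trans hnN
    rw [div_le_iff₀ (by positivity)] at this ⊢
    linarith

theorem whp_norm_kernelOp_sub_sampledGraphon_le (W : Graphon) {τ : ℝ} (hτ : 0 < τ) :
    WithHighProbability fun _ s =>
      ‖kernelOp W.isKernel - kernelOp (isKernel_sampledGraphon W s)‖ ≤ τ := by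
  have hW : MemLp (Function.uncurry W.toFun) 4 volume :=
    MemLp.of_bound W.measurable'.aestronglyMeasurable 1
      (Filter.Eventually.of_forall fun z => W.isKernel.abs_le z.1 z.2)
  have hd : MemLp (fun x => Function.uncurry W.toFun (x, x)) 4 volume :=
    MemLp.of_bound (W.measurable'.comp (measurable_id.prodMk measurable_id)).aestronglyMeasurable 1
      (Filter.Eventually.of_forall fun x => W.isKernel.abs_le x x)
  refine ((whp_norm_kernelOp_noise_le W (half_pos hτ)).and
    (whp_eLpNorm_cellLabel_sub_le W.measurable' hW hd (half_pos hτ))).mono fun n s h => ?_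
  have := norm_kernelOp_sub_sampledGraphon_le W s (half_pos hτ).le h.1 h.2
  linarith

theorem sampledSignal_apply {n p : ℕ} [NeZero n] (s : Sample n) (X : Fin p → I → ℝ) (g : Fin p)
    (v : I) : sampledSignal s X g v = X g (cellLabel s.1 v) := by
  rw [sampledSignal, inducedSignal_apply]
  rfl

/-- The sampling theorem is applied both to each feature and to the exponential of its square; both
are in `L⁴` because exponential moments of every order are finite. -/
theorem whp_signalsNear {p : ℕ} {X : Fin p → I → ℝ} (hX : ∀ g, Measurable (X g))
    (hexp : ∀ g, ∀ c : ℝ, Integrable fun u => Real.exp (c * X g u ^ 2)) {κ : ℝ} (hκ : 0 < κ)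
    (c : ℝ) : WithHighProbability fun _ s => SignalsNear κ c X (sampledSignal s X) := by
  have h4 : ∀ g, MemLp (X g) 4 := fun g => by
    simpa using memLp_of_integrable_exp (hX g) (hexp g) four_ne_zero
  have hm : ∀ g, Measurable fun u => Real.exp (c * X g u ^ 2) := fun g => by
    have := hX g
    fun_prop
  have he4 : ∀ g, MemLp (fun u => Real.exp (c * X g u ^ 2)) 4 := fun g => by
    rw [← integrable_norm_rpow_iff (hm g).aestronglyMeasurable (by norm_num) (by norm_num)]
    refine (hexp g (4 * c)).congr (Filter.Eventually.of_forall fun u => ?_)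
    simp only [Real.norm_eq_abs, Real.abs_exp, ENNReal.toReal_ofNat]
    rw [← Real.exp_mul]
    congr 1; ring
  refine ((WithHighProbability.forall_fin fun g =>
    whp_eLpNorm_comp_cellLabel_sub_le (hX g) (h4 g) hκ).and (WithHighProbability.forall_fin
      fun g => whp_eLpNorm_comp_cellLabel_sub_le (hm g) (he4 g) one_pos)).mono fun n s h => ?_
  have hs : ∀ g, sampledSignal s X g = fun v => X g (cellLabel s.1 v) := fun g =>
    funext fun v => sampledSignal_apply s X g v
  refine ⟨fun g => ?_, fun g => ?_, fun g => ?_⟩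
  · rw [hs]; exact (hX g).comp (measurable_cellLabel s.1)
  · rw [hs]
    exact (eLpNorm_sub_comm (X g) (fun v => X g (cellLabel s.1 v)) 2 volume).trans_le (h.1 g)
  · rw [hs]
    refine (eLpNorm_sub_comm (fun v => Real.exp (c * X g v ^ 2))
      (fun v => Real.exp (c * X g (cellLabel s.1 v) ^ 2)) 2 volume).trans_le ((h.2 g).trans ?_)
    simp

end

/-- Transferability in action distributions. `A = softmax (Ψ.chi T Δ W X₁ X₂)` and `A_n` is the
same with the graphon and signals induced by the sampled `n`-node graph. -/
theorem theorem2 {p q : ℕ} (W : Graphon) (X₁ X₂ : Fin p → I → ℝ)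
    (Δ : Matrix (Fin q) (Fin q) ℝ)
    (hX₁ : ∀ g, Measurable (X₁ g)) (hX₂ : ∀ g, Measurable (X₂ g))
    (hexp₁ : ∀ g, ∀ c : ℝ, Integrable (fun u => Real.exp (c * X₁ g u ^ 2)))
    (hexp₂ : ∀ g, ∀ c : ℝ, Integrable (fun u => Real.exp (c * X₂ g u ^ 2))) :
    ∃ Γ : ℝ, 0 < Γ ∧
      ∀ (L F h T : ℕ) (Ω ω : Fin 3 → ℝ≥0), ∀ η : ℝ, 0 < η →
        ∃ ε₀ : ℝ, 0 < ε₀ ∧ ε₀ ≤ 1 ∧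
          ∀ δ : ℝ, 0 < δ → ∃ N : ℕ, ∀ ε : ℝ, 0 < ε → ε ≤ ε₀ → ∀ n : ℕ, N ≤ n →
            volume {s : Sample n | ¬ ∀ Ψ : WRNN L F p h q, Ψ.Admissible Ω ω ε →
              Integrable (fun z => Real.exp (Ψ.chi T Δ W.toFun X₁ X₂ z)) ∧
              Integrable (fun z => Real.exp (Ψ.chi T Δ (sampledGraphon W s)
                (sampledSignal s X₁) (sampledSignal s X₂) z)) ∧
              eLpNorm (fun z => softmax (Ψ.chi T Δ W.toFun X₁ X₂) z -
                softmax (Ψ.chi T Δ (sampledGraphon W s)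
                  (sampledSignal s X₁) (sampledSignal s X₂)) z) 2 volume
                ≤ ENNReal.ofReal (Γ * η)}
              ≤ ENNReal.ofReal δ := by
  -- Since `η` is arbitrary and all other thresholds may depend on it, `Γ = 1` suffices.
  refine ⟨1, one_pos, fun L F h T Ω ω η hη => ?_⟩
  obtain ⟨κ, c, hκ, htransfer⟩ :=
    exists_transfer W X₁ X₂ Δ hX₁ hX₂ hexp₁ hexp₂ L F h T Ω ω hη
  -- The gluing of the Lipschitz bounds makes the transfer uniform in `ε`, so the largest allowed
  -- threshold works.
  refine ⟨1, one_pos, le_rfl, fun δ hδ => ?_⟩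
  obtain ⟨N, hN⟩ := ((whp_norm_kernelOp_sub_sampledGraphon_le W hκ).and
    ((whp_signalsNear hX₁ hexp₁ hκ c).and (whp_signalsNear hX₂ hexp₂ hκ c))) δ hδ
  -- The shift ensures at least one node, so that cells cover the interval.
  refine ⟨N + 1, fun ε hε _ n hn => ?_⟩
  obtain ⟨m, rfl⟩ : ∃ m, n = m + 1 := ⟨n - 1, by omega⟩
  -- The failures over all networks lie in one event independent of the network. Monotonicity of
  -- `volume` as an outer measure makes measurability of their union unnecessary.
  refine (measure_mono (Set.ofPred_subset_ofPred.2 fun s hs hgood => hs fun Ψ hΨ => ?_)).trans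
    (hN m (by omega))
  rw [one_mul]
  exact htransfer _ _ _ (isKernel_sampledGraphon W s) (sampledGraphon_symm W s) hgood.1
    hgood.2.1 hgood.2.2 ε hε Ψ hΨ
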